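/- Let $\alpha=(\alpha_1,\alpha_2)$ be a pair of real distributions on the circle $[0,2\pi]$ (periodic boundary conditions), with Fourier coefficients $\widehat\alpha_i(n)=\langle\psi_n,\alpha_i\rangle$, $\psi_n(x)=e^{inx}/\sqrt{2\pi}$; write $|\widehat\alpha(n)|^2=\widehat\alpha^*(n)\cdot\widehat\alpha(n)=\sum_i|\widehat\alpha_i(n)|^2$, $\widehat\alpha(n)\cdot\widehat\alpha(n)=\sum_i\widehat\alpha_i(n)^2$ and $\|\widehat\alpha\|_\infty^2=\sup_{n\in\mathbb Z}|\widehat\alpha(n)|^2$. For a real continuous potential $v$ on the circle, with $\|v\|_{\mathcal C}=\sup_x|v(x)|$, let $$\mathbf A_v(\phi,\pi,r)=\bigl(\pi,\;(\partial_x^2-1-v)\phi-\alpha\cdot r,\;\langle\alpha,\pi\rangle-r\bigr),\qquad r\in\mathbb C^2,$$ and let $\mathbf A_v^\dagger(\phi,\pi,r)=\bigl((\partial_x^2-1-v)\pi,\;\phi+\alpha\cdot r,\;-\langle\alpha,\pi\rangle-r\bigr)$ be its adjoint for the pairing $\langle f,e\rangle=\int(f_\phi^*e_\phi+f_\pi^*e_\pi)\,dx+f_r^*\cdot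 e_r$. Eigenvectors $\mathbf A_ve=\lambda e$ are taken with $e_\phi,e_\pi\in H^1$, and eigenvectors $\mathbf A_v^\dagger f=\lambda^*f$ with $f_\phi\in H^{-1}$, $f_\pi\in H^1$ (equations in the sense of distributions). For a simple eigenvalue $\lambda$ (both eigenspaces are lines and $\langle f,e\rangle\ne0$) the eigenprojection is $P=|e\rangle\langle f|/\langle f,e\rangle$; its $\phi(x),r$ entry is the row $P_{\phi(x),r}=e_\phi(x)f_r^*/\langle f,e\rangle$. Modes are $\mathbf n=(n,s)$ with $n\in\mathbb Z$ and a sign $s\in\{+,-\}$. The eigenvalue $\lambda_{\mathbf n}(v)$ is an eigenvalue of $\mathbf A_v$ at distance less than $1/5$ from $s\,i\sqrt{n^2+1}$ such that moreover, if $n>0$, this disc contains another eigenvalue with smaller $|\Im|$, and, if $n<0$, this disc contains another eigenvalue with larger $|\Im|$. (So $(n,s)$ and $(-n,s)$, $n\neq0$, label the pair of nearly degenerate eigenvalues. The two exceptional eigenvalues near $-1$ are not labelled.) Statement. Let $\kappa>0$ and $0<c_2<1$. There are $\delta,\varepsilon_0>0$, depending only on $\kappa$ and $c_2$, such that the following holds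 for every $\alpha$ for which there are constants $c_0$ and $0<c_1<c_2$ with $\kappa c_0\le c_1$, $$c_1\le|\widehat\alpha(n)\cdot\widehat\alpha(n)|\le c_2|\widehat\alpha(n)|^2\quad(n\neq0),\qquad c_2|\widehat\alpha(n)|^2\le c_0\quad(n\in\mathbb Z),$$ and $\|\widehat\alpha\|_\infty^2\le\delta$. There are positive constants $C_\phi,C_\lambda$, independent of $\mathbf n$, $v_1$, $v_2$, such that for every mode $\mathbf n=(n,s)$: (0) for every $v$ with $\|v\|_{\mathcal C}\le\varepsilon_0\|\widehat\alpha\|_\infty^2$ the eigenvalue $\lambda_{\mathbf n}(v)$ exists, is unique and is simple, so that its eigenprojection $P_{\mathbf n}(v)$ is defined; and for all real continuous $v_1,v_2$ with $\|v_1\|_{\mathcal C},\|v_2\|_{\mathcal C}\le\varepsilon_0\|\widehat\alpha\|_\infty^2$: (i) $\displaystyle\sup_x\bigl|P_{\mathbf n,\phi(x),r_j}(v_2)-P_{\mathbf n,\phi(x),r_j}(v_1)\bigr|\le C_\phi\frac{\|v_2-v_1\|_{\mathcal C}}{n^2+1}$ for $j=1,2$; (ii) $\displaystyle|\lambda_{\mathbf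 n}(v_2)-\lambda_{\mathbf n}(v_1)|\le C_\lambda\frac{\|v_2-v_1\|_{\mathcal C}}{|n|+1}$; (iii) $\displaystyle\bigl|\Re\bigl(\lambda_{\mathbf n}(v_2)-\lambda_{\mathbf n}(v_1)\bigr)\bigr|\le C_\lambda\frac{\|v_2-v_1\|_{\mathcal C}}{n^2+1}$. -/

import Mathlib

open scoped ComplexConjugate

namespace ThermalRing

noncomputable section

/-- The circle `[0, 2π]` with periodic boundary conditions. -/
abbrev Circ : Type := AddCircle (2 * Real.pi)

instance : Fact (0 < 2 * Real.pi) := ⟨Real.two_pi_pos⟩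

/-- The `L²`-normalized exponential `ψ_m(x) = e^{imx} / √(2π)`. -/
def expMode (m : ℤ) (x : Circ) : ℂ := fourier m x / (Real.sqrt (2 * Real.pi) : ℂ)

/-- The function with Fourier coefficients `c`, that is `∑ₘ c(m) ψ_m(x)`. -/
def synth (c : ℤ → ℂ) (x : Circ) : ℂ := ∑' m : ℤ, c m * expMode m x

/-- A pair `α = (α₁, α₂)` of real distributions on the circle, `α_i = ∑ₙ α̂_i(n) ψ_n`, given by
the Fourier coefficients `α̂_i(n) = ⟨ψ_n, α_i⟩`. -/
structure Coupling where
  coeff : ℤ → Fin 2 → ℂ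
  real : ∀ n i, coeff (-n) i = conj (coeff n i)
  growth : ∃ (C : ℝ) (k : ℕ), ∀ n i, ‖coeff n i‖ ≤ C * (1 + |(n : ℝ)|) ^ k

/-- `α̂*(n) · α̂(n)`. -/
def Coupling.normSq (α : Coupling) (n : ℤ) : ℝ := ∑ i, ‖α.coeff n i‖ ^ 2

/-- `α̂(n) · α̂(n)` (no complex conjugation). -/
def Coupling.dotSelf (α : Coupling) (n : ℤ) : ℂ := ∑ i, α.coeff n i * α.coeff n i

/-- `sup_n |α̂(n)|²`. -/
def Coupling.supSq (α : Coupling) : ℝ := ⨆ n : ℤ, α.normSq n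

/-- The standing condition on the couplings,
`c₁ ≤ |α̂(n) · α̂(n)| ≤ c₂ α̂*(n) · α̂(n) ≤ c₀`. Since the `α_i` are real, `α̂(0)` is a real vector
and the middle inequality (with `c₂ < 1`, `c₁ > 0`) can only be asked for `n ≠ 0`. -/
structure Coupling.NonDegenerate (α : Coupling) (c₀ c₁ c₂ : ℝ) : Prop where
  pos : 0 < c₁
  lt : c₁ < c₂
  lt_one : c₂ < 1
  lower : ∀ n : ℤ, n ≠ 0 → c₁ ≤ ‖α.dotSelf n‖
  middle : ∀ n : ℤ, n ≠ 0 → ‖α.dotSelf n‖ ≤ c₂ * α.normSq n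
  upper : ∀ n : ℤ, c₂ * α.normSq n ≤ c₀

/-- A `4`-vector `(φ, π, r₁, r₂)`: the components `φ`, `π` are functions or distributions on the
circle, represented by their Fourier coefficients with respect to `ψ_m`. -/
@[ext] structure Vec where
  phi : ℤ → ℂ
  mom : ℤ → ℂ
  r : Fin 2 → ℂ

instance : Zero Vec := ⟨⟨0, 0, 0⟩⟩

instance : SMul ℂ Vec := ⟨fun c e => ⟨c • e.phi, c • e.mom, c • e.r⟩⟩

/-- Membership in the Sobolev space `H¹` of the circle. -/
def MemH1 (c : ℤ → ℂ) : Prop := Summable fun m : ℤ => (1 + (m : ℝ) ^ 2) * ‖c m‖ ^ 2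

/-- Membership in the Sobolev space `H⁻¹` of the circle. -/
def MemHNeg1 (c : ℤ → ℂ) : Prop := Summable fun m : ℤ => ‖c m‖ ^ 2 / (1 + (m : ℝ) ^ 2)

/-- Multiplication by the potential `v`: the Fourier coefficients of `v(x) u(x)`,
where `u` is the function with Fourier coefficients `c`. -/
def mulPot (v : C(Circ, ℝ)) (c : ℤ → ℂ) (m : ℤ) : ℂ :=
  ∫ x : Circ, conj (expMode m x) * ((v x : ℂ) * synth c x)

/-- `⟨α_i, u⟩`, where `u` is the function with Fourier coefficients `c`. -/
def Coupling.pair (α : Coupling) (i : Fin 2) (c : ℤ → ℂ) : ℂ :=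
  ∑' m : ℤ, conj (α.coeff m i) * c m

/-- The drift operator
`A_v (φ, π, r) = (π, (∂ₓ² - 1 - v) φ - α · r, ⟨α, π⟩ - r)`. -/
def drift (α : Coupling) (v : C(Circ, ℝ)) (e : Vec) : Vec where
  phi := e.mom
  mom := fun m => -((m : ℂ) ^ 2 + 1) * e.phi m - mulPot v e.phi m - ∑ i, α.coeff m i * e.r i
  r := fun i => α.pair i e.mom - e.r i

/-- The adjoint `A_v† (φ, π, r) = ((∂ₓ² - 1 - v) π, φ + α · r, -⟨α, π⟩ - r)` of the drift operator
with respect to the pairing `⟨f, e⟩`. -/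
def driftAdj (α : Coupling) (v : C(Circ, ℝ)) (f : Vec) : Vec where
  phi := fun m => -((m : ℂ) ^ 2 + 1) * f.mom m - mulPot v f.mom m
  mom := fun m => f.phi m + ∑ i, α.coeff m i * f.r i
  r := fun i => -α.pair i f.mom - f.r i

/-- The pairing `⟨f, e⟩ = ∫ (f_φ* e_φ + f_π* e_π) dx + f_r* · e_r`. -/
def pairing (f e : Vec) : ℂ :=
  (∑' m : ℤ, conj (f.phi m) * e.phi m) + (∑' m : ℤ, conj (f.mom m) * e.mom m)
    + ∑ i, conj (f.r i) * e.r i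

/-- `A_v e = lam e`, `e ≠ 0`, with `e` in the form domain `H¹ ⊕ H¹ ⊕ ℂ²`
(the equation is one between distributions). -/
def IsRightEigenvector (α : Coupling) (v : C(Circ, ℝ)) (lam : ℂ) (e : Vec) : Prop :=
  e ≠ 0 ∧ MemH1 e.phi ∧ MemH1 e.mom ∧ drift α v e = lam • e

/-- `A_v† f = lam* f`, `f ≠ 0`; the `φ`-component of such an `f` is a distribution in `H⁻¹`. -/
def IsLeftEigenvector (α : Coupling) (v : C(Circ, ℝ)) (lam : ℂ) (f : Vec) : Prop :=
  f ≠ 0 ∧ MemHNeg1 f.phi ∧ MemH1 f.mom ∧ driftAdj α v f = conj lam • f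

def IsEigenvalue (α : Coupling) (v : C(Circ, ℝ)) (lam : ℂ) : Prop :=
  ∃ e, IsRightEigenvector α v lam e

/-- `lam` is a simple eigenvalue of `A_v`: the eigenspaces of `A_v` and `A_v†` are lines, spanned by
`e` and `f` with `⟨f, e⟩ ≠ 0`, so that the eigenprojection is `|e⟩⟨f| / ⟨f, e⟩`. -/
def IsSimpleEigenvalue (α : Coupling) (v : C(Circ, ℝ)) (lam : ℂ) : Prop :=
  ∃ e f, IsRightEigenvector α v lam e ∧ IsLeftEigenvector α v lam f ∧ pairing f e ≠ 0 ∧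
    (∀ e', IsRightEigenvector α v lam e' → ∃ c : ℂ, e' = c • e) ∧
    (∀ f', IsLeftEigenvector α v lam f' → ∃ c : ℂ, f' = c • f)

/-- The unperturbed eigenvalue `i √(n² + 1)` (for `s = 0`) or `-i √(n² + 1)` (for `s = 1`). -/
def freeEigenvalue (n : ℤ) (s : Fin 2) : ℂ :=
  (-1) ^ (s : ℕ) * Complex.I * (Real.sqrt ((n : ℝ) ^ 2 + 1) : ℂ)

/-- The eigenvalues of `A_v` near `± i √(n² + 1)`. The discs of radius `1/5` around the unperturbed
eigenvalues are pairwise disjoint. -/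
def IsLevelEigenvalue (α : Coupling) (v : C(Circ, ℝ)) (n : ℤ) (s : Fin 2) (lam : ℂ) : Prop :=
  IsEigenvalue α v lam ∧ ‖lam - freeEigenvalue n s‖ < 1 / 5

/-- `lam` is the eigenvalue `λ_{(n, s)}(v)` of `A_v` with mode number `(n, s)`: it is close to the
unperturbed eigenvalue, and of the two nearly degenerate eigenvalues there when `n ≠ 0`, the modes
`(|n|, s)` and `(-|n|, s)` denote the one with the larger and with the smaller `|Im|`. -/
def IsModeEigenvalue (α : Coupling) (v : C(Circ, ℝ)) (n : ℤ) (s : Fin 2) (lam : ℂ) : Prop :=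
  IsLevelEigenvalue α v n s lam ∧
    (0 < n → ∃ mu, IsLevelEigenvalue α v n s mu ∧ |mu.im| < |lam.im|) ∧
    (n < 0 → ∃ mu, IsLevelEigenvalue α v n s mu ∧ |lam.im| < |mu.im|)

/-- The `φ(x), r_j` entry of the matrix `P = |e⟩⟨f| / ⟨f, e⟩`. -/
def projPhiR (e f : Vec) (x : Circ) (j : Fin 2) : ℂ :=
  synth e.phi x * conj (f.r j) / pairing f e

end

end ThermalRing

open ThermalRing

namespace ThermalRing

/-! Eliminating the momentum and `r` from `A_v e = λ e` leaves a nonlinear eigenvalue problem for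
the coefficients of φ: the diagonal λ² + m² + 1, a coupling of rank at most two with factor λ/(λ+1),
and the matrix of v. A left eigenvector gives the same problem for the conjugate of its momentum
component. In a real orthonormal basis all matrices are real and symmetric, so one solution `u`
describes both eigenvectors.

For n ≠ 0 the free levels n and -n are degenerate and the coupling has to split them. The real basis
of the span of ψ_n and ψ_{-n} is rotated by half the argument of α̂(n)·α̂(n) (`phase`). Then the two
coupling vectors in ℝ² are orthogonal, and their squared lengths differ by 2|α̂(n)·α̂(n)|
(`sum_sq_phase`). By hypothesis this is at least 2kM, where M = ‖α̂‖∞² and k = min(κc₂, 1).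
Everything that could spoil the splitting is smaller: the entries of v are at most kM/10⁴, and the
other levels act at second order, with size `gapConst`·M², where `gapConst` bounds the sums ∑ 3/|m²
- n²| uniformly in n. Hence for λ near the first-order value `center`, a solution is dominated in ℓ¹
by its n-th component, stably under errors in the other rows (`Near.apriori`).

Existence is a Lyapunov–Schmidt reduction. With u(n) = 1, the rows other than the n-th are solved by
a weighted Neumann series (`Near.exists_solves`). The n-th row is then a nearly linear function of λ
with slope 2λ⁰, where λ⁰ is the free eigenvalue, and it has a zero (`Regular.exists_eigenvalue`).
Conversely, every eigenvalue in the disc is near one of the two centers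
(`Regular.near_or_near_neg`), and these are ordered by |Im| (`Near.abs_im_lt`), which identifies the
labels.

One exact identity carries the perturbation theory (`Solves.residual_sub`): by symmetry, the n-th
rows of two solutions differ by (λ - λ')·`denom` plus the bilinear form of V - V' at u, u'. With ω =
√(n² + 1), `denom` lies within ω of 2λ⁰. This gives the slope in λ, the bound O(‖v - v'‖/ω) for
eigenvalues and, through the a priori estimate, Lipschitz bounds for `u` and uniqueness. At equal
arguments `denom` is the pairing ⟨f, e⟩ (`pairing_eq`), so an entry of the projection has one factor
1/ω from 1/(λ+1) in f_r and another from 1/⟨f, e⟩. For real parts, comparing `u` with its conjugate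
shows Re λ = O(1/ω²) and that `u` is real up to O(1/ω). So the numerator of λ - λ' is nearly real
and its denominator nearly imaginary, which gains one more 1/ω (`ReducedEigen.abs_re_sub_le`). -/

/-! ### Sums over spectral gaps, Neumann series in ℓ¹, and a Newton-type zero lemma. -/

lemma summable_one_div_int_sq : Summable fun j : ℤ => 1 / (j : ℝ) ^ 2 :=
  Real.summable_one_div_int_pow.mpr one_lt_two

/-- An upper bound for the sums `∑ₘ 3 / |m² - n²|` over `m ≠ ± n`. -/
noncomputable def gapConst : ℝ := 1 + 6 * ∑' j : ℤ, 1 / (j : ℝ) ^ 2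

/-- `3 / |m² - n²|`, which is `0` for `m = ± n`. -/
noncomputable def gapInv (n m : ℤ) : ℝ := 3 / |(m : ℝ) ^ 2 - (n : ℝ) ^ 2|

lemma gapInv_nonneg (n m : ℤ) : 0 ≤ gapInv n m := by unfold gapInv; positivity

/-- Factor m² - n² = (m - n)(m + n) and use xy ≤ x² + y² for the inverses. The majorant is a sum of
two translates of 1/j², so its total does not depend on n. -/
lemma gapInv_le (n m : ℤ) :
    gapInv n m ≤ 3 * (1 / ((m - n : ℤ) : ℝ) ^ 2 + 1 / ((m + n : ℤ) : ℝ) ^ 2) := by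
  unfold gapInv
  have hf : (m : ℝ) ^ 2 - (n : ℝ) ^ 2 = ((m - n : ℤ) : ℝ) * ((m + n : ℤ) : ℝ) := by
    push_cast; ring
  rw [hf, abs_mul, div_eq_mul_inv, mul_inv]
  have h1 : 1 / ((m - n : ℤ) : ℝ) ^ 2 = (|((m - n : ℤ) : ℝ)|⁻¹) ^ 2 := by
    rw [inv_pow, sq_abs, one_div]
  have h2 : 1 / ((m + n : ℤ) : ℝ) ^ 2 = (|((m + n : ℤ) : ℝ)|⁻¹) ^ 2 := by
    rw [inv_pow, sq_abs, one_div]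
  rw [h1, h2]
  nlinarith [sq_nonneg (|((m - n : ℤ) : ℝ)|⁻¹ - |((m + n : ℤ) : ℝ)|⁻¹),
    sq_nonneg (|((m - n : ℤ) : ℝ)|⁻¹ + |((m + n : ℤ) : ℝ)|⁻¹)]

lemma hasSum_gap_majorant (n : ℤ) :
    HasSum (fun m : ℤ => 3 * (1 / ((m - n : ℤ) : ℝ) ^ 2 + 1 / ((m + n : ℤ) : ℝ) ^ 2))
      (6 * ∑' j : ℤ, 1 / (j : ℝ) ^ 2) := by
  have h := summable_one_div_int_sq.hasSum
  have h1 := (Equiv.subRight n).hasSum_iff.mpr h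
  have h2 := (Equiv.addRight n).hasSum_iff.mpr h
  have h3 := (h1.add h2).mul_left 3
  rw [show ∀ t : ℝ, 6 * t = 3 * (t + t) from fun t => by ring]
  exact h3

lemma summable_gapInv (n : ℤ) : Summable (gapInv n) :=
  Summable.of_nonneg_of_le (gapInv_nonneg n) (gapInv_le n) (hasSum_gap_majorant n).summable

lemma tsum_gapInv_le (n : ℤ) : ∑' m, gapInv n m ≤ gapConst := by
  have := (summable_gapInv n).tsum_le_tsum (gapInv_le n) (hasSum_gap_majorant n).summable
  rw [(hasSum_gap_majorant n).tsum_eq] at this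
  unfold gapConst; linarith

lemma one_le_gapConst : 1 ≤ gapConst := by
  have : 0 ≤ ∑' j : ℤ, 1 / (j : ℝ) ^ 2 := tsum_nonneg fun j => by positivity
  unfold gapConst; linarith

/-- A matrix whose entries are bounded acts on `ℓ¹`. -/
lemma summable_mul_of_bounded {f u : ℤ → ℂ} {C : ℝ} (hf : ∀ m, ‖f m‖ ≤ C)
    (hu : Summable fun m => ‖u m‖) : Summable fun m => f m * u m := by
  refine Summable.of_norm_bounded (hu.mul_left C) fun m => ?_
  rw [norm_mul]
  exact mul_le_mul_of_nonneg_right (hf m) (norm_nonneg _)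

lemma norm_tsum_mul_le {f u : ℤ → ℂ} {C : ℝ} (hf : ∀ m, ‖f m‖ ≤ C)
    (hu : Summable fun m => ‖u m‖) : ‖∑' m, f m * u m‖ ≤ C * ∑' m, ‖u m‖ := by
  rw [← tsum_mul_left]
  refine tsum_of_norm_bounded (hu.mul_left C).hasSum fun m => ?_
  rw [norm_mul]
  exact mul_le_mul_of_nonneg_right (hf m) (norm_nonneg _)

lemma summable_prod_matrix {G : ℤ → ℤ → ℂ} (hG : ∀ k, Summable fun m => ‖G m k‖)
    (hq : ∀ k, ∑' m, ‖G m k‖ ≤ 1 / 2)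
    {x : ℤ → ℂ} (hx : Summable fun m => ‖x m‖) :
    Summable fun p : ℤ × ℤ => ‖G p.2 p.1 * x p.1‖ := by
  rw [summable_prod_of_nonneg fun _ => norm_nonneg _]
  simp only [norm_mul]
  refine ⟨fun k => (hG k).mul_right _, ?_⟩
  refine Summable.of_nonneg_of_le (fun k => tsum_nonneg fun m => by positivity) (fun k => ?_)
    (hx.mul_left (1 / 2))
  rw [tsum_mul_right]
  exact mul_le_mul_of_nonneg_right (hq k) (norm_nonneg _)

/-- The operator norm on ℓ¹ is the supremum of the absolute column sums: exchange the two sums by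
Tonelli and sum over the rows first. -/
lemma summable_norm_matrix_apply {G : ℤ → ℤ → ℂ} (hG : ∀ k, Summable fun m => ‖G m k‖)
    (hq : ∀ k, ∑' m, ‖G m k‖ ≤ 1 / 2)
    {x : ℤ → ℂ} (hx : Summable fun m => ‖x m‖) :
    (Summable fun m => ‖∑' k, G m k * x k‖) ∧
      ∑' m, ‖∑' k, G m k * x k‖ ≤ 1 / 2 * ∑' m, ‖x m‖ := by
  have hs := summable_prod_matrix hG hq hx
  have hs' : Summable fun p : ℤ × ℤ => ‖G p.1 p.2 * x p.2‖ := hs.prod_symm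
  have hs2 := (summable_prod_of_nonneg fun _ => norm_nonneg _).mp hs'
  have hle : ∀ m, ‖∑' k, G m k * x k‖ ≤ ∑' k, ‖G m k * x k‖ := fun m =>
    norm_tsum_le_tsum_norm (hs2.1 m)
  have hS : Summable fun m => ‖∑' k, G m k * x k‖ :=
    Summable.of_nonneg_of_le (fun _ => norm_nonneg _) hle hs2.2
  refine ⟨hS, (hS.tsum_le_tsum hle hs2.2).trans ?_⟩
  have hcomm : ∑' m, ∑' k, ‖G m k * x k‖ = ∑' k, ∑' m, ‖G m k * x k‖ :=
    Summable.tsum_comm (f := fun k m => ‖G m k * x k‖) hs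
  rw [hcomm, ← tsum_mul_left]
  have hs3 := (summable_prod_of_nonneg fun _ => norm_nonneg _).mp hs
  refine hs3.2.tsum_le_tsum (fun k => ?_) (hx.mul_left _)
  simp only [norm_mul]
  rw [tsum_mul_right]
  exact mul_le_mul_of_nonneg_right (hq k) (norm_nonneg _)

/-- Neumann series in `ℓ¹(ℤ)`. -/
lemma exists_neumann {G : ℤ → ℤ → ℂ} (hG : ∀ k, Summable fun m => ‖G m k‖)
    (hq : ∀ k, ∑' m, ‖G m k‖ ≤ 1 / 2)
    {y : ℤ → ℂ} (hy : Summable fun m => ‖y m‖) :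
    ∃ x : ℤ → ℂ, (Summable fun m => ‖x m‖) ∧ ∀ m, x m = y m + ∑' k, G m k * x k := by
  let T : (ℤ → ℂ) → ℤ → ℂ := fun x m => ∑' k, G m k * x k
  let X : ℕ → ℤ → ℂ := fun j => T^[j] y
  have hX0 : X 0 = y := rfl
  have hXs : ∀ j, X (j + 1) = T (X j) := fun j => Function.iterate_succ_apply' T j y
  have hX : ∀ j, (Summable fun m => ‖X j m‖) ∧ ∑' m, ‖X j m‖ ≤ (1 / 2) ^ j * ∑' m, ‖y m‖ := by
    intro j
    induction j with
    | zero => exact ⟨hy, by simp [hX0]⟩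
    | succ j ih =>
      rw [hXs]
      obtain ⟨h1, h2⟩ := summable_norm_matrix_apply hG hq ih.1
      refine ⟨h1, h2.trans ?_⟩
      rw [pow_succ']
      linarith [ih.2]
  have hP : Summable fun p : ℕ × ℤ => ‖X p.1 p.2‖ := by
    rw [summable_prod_of_nonneg fun _ => norm_nonneg _]
    refine ⟨fun j => (hX j).1, ?_⟩
    refine Summable.of_nonneg_of_le (fun j => tsum_nonneg fun m => norm_nonneg _)
      (fun j => (hX j).2) ?_
    exact (summable_geometric_of_lt_one (by norm_num) (by norm_num)).mul_right _
  have hP' : Summable fun p : ℤ × ℕ => ‖X p.2 p.1‖ := hP.prod_symm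
  have hP2 := (summable_prod_of_nonneg fun _ => norm_nonneg _).mp hP'
  have hXm : ∀ m, Summable fun j => X j m := fun m => (hP2.1 m).of_norm
  refine ⟨fun m => ∑' j, X j m, ?_, fun m => ?_⟩
  · exact Summable.of_nonneg_of_le (fun _ => norm_nonneg _)
      (fun m => norm_tsum_le_tsum_norm (hP2.1 m)) hP2.2
  -- An entry is at most its column sum, so row `m` is bounded and the series over iterates can be
  -- exchanged with the sum over `k`.
  · have hGb : ∀ k, ‖G m k‖ ≤ 1 / 2 := fun k =>
      ((hG k).le_tsum m fun _ _ => norm_nonneg _).trans (hq k)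
    beta_reduce
    rw [(hXm m).tsum_eq_zero_add, hX0]
    congr 1
    have h1 : ∀ j, X (j + 1) m = ∑' k, G m k * X j k := fun j => by rw [hXs]
    simp only [h1, ← tsum_mul_left]
    refine (Summable.tsum_comm (f := fun j k => G m k * X j k) ?_).symm
    refine Summable.of_norm_bounded (hP.mul_left (1 / 2)) fun p => ?_
    simp only [Function.uncurry, norm_mul]
    exact mul_le_mul_of_nonneg_right (hGb _) (norm_nonneg _)

/-- Neumann series in a weighted `ℓ¹` space. -/
lemma exists_weighted_neumann {G : ℤ → ℤ → ℂ} {W : ℤ → ℝ} {c C : ℝ} (hc : 0 < c)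
    (hcW : ∀ m, c ≤ W m) (hWC : ∀ m, W m ≤ C)
    (hG : ∀ k, Summable fun m => W m * ‖G m k‖)
    (hq : ∀ k, ∑' m, W m * ‖G m k‖ ≤ 1 / 2 * W k)
    {y : ℤ → ℂ} (hy : Summable fun m => ‖y m‖) :
    ∃ x : ℤ → ℂ, (Summable fun m => ‖x m‖) ∧ ∀ m, x m = y m + ∑' k, G m k * x k := by
  have hW : ∀ m, 0 < W m := fun m => hc.trans_le (hcW m)
  have hn : ∀ m k, ‖(W m : ℂ) * G m k * (W k : ℂ)⁻¹‖ = W m * ‖G m k‖ * (W k)⁻¹ := by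
    intro m k
    simp [abs_of_pos (hW m), abs_of_pos (hW k)]
  -- Conjugating by the diagonal matrix `W` turns weighted column sums into ordinary ones; the two
  -- bounds on `W` make the weighted and unweighted ℓ¹ norms equivalent.
  obtain ⟨x, hx, hxe⟩ := exists_neumann (G := fun m k => (W m : ℂ) * G m k * (W k : ℂ)⁻¹)
    (y := fun m => (W m : ℂ) * y m)
    (fun k => by simp only [hn]; exact (hG k).mul_right _)
    (fun k => by
      simp only [hn]; rw [tsum_mul_right, ← div_eq_mul_inv, div_le_iff₀ (hW k)]; exact hq k)
    (by
      refine Summable.of_nonneg_of_le (fun _ => norm_nonneg _) (fun m => ?_) (hy.mul_left C)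
      rw [norm_mul, Complex.norm_real, Real.norm_eq_abs, abs_of_pos (hW m)]
      exact mul_le_mul_of_nonneg_right (hWC m) (norm_nonneg _))
  refine ⟨fun m => (W m : ℂ)⁻¹ * x m, ?_, fun m => ?_⟩
  · refine Summable.of_nonneg_of_le (fun _ => norm_nonneg _) (fun m => ?_) (hx.mul_left c⁻¹)
    rw [norm_mul, norm_inv, Complex.norm_real, Real.norm_eq_abs, abs_of_pos (hW m)]
    exact mul_le_mul_of_nonneg_right (inv_anti₀ hc (hcW m)) (norm_nonneg _)
  · have hne : (W m : ℂ) ≠ 0 := by exact_mod_cast (hW m).ne'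
    have h1 : ∑' k, (W m : ℂ) * G m k * (W k : ℂ)⁻¹ * x k
        = W m * ∑' k, G m k * ((W k : ℂ)⁻¹ * x k) := by
      rw [← tsum_mul_left]; congr 1; ext k; ring
    beta_reduce
    rw [hxe m, h1, mul_add, inv_mul_cancel_left₀ hne, inv_mul_cancel_left₀ hne]

/-- A function that is close to a linear one has a zero. -/
lemma exists_zero_of_approx_linear {F : ℂ → ℂ} {c l : ℂ} {r : ℝ} (hr : 0 ≤ r) (hl : l ≠ 0)
    (hF : ∀ z ∈ Metric.closedBall c r, ∀ w ∈ Metric.closedBall c r,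
      ‖F z - F w - l * (z - w)‖ ≤ ‖l‖ / 2 * ‖z - w‖)
    (h0 : ‖F c‖ ≤ ‖l‖ / 2 * r) : ∃ z ∈ Metric.closedBall c r, F z = 0 := by
  have hl' : 0 < ‖l‖ := norm_pos_iff.mpr hl
  have hcm : c ∈ Metric.closedBall c r := Metric.mem_closedBall_self hr
  -- The simplified Newton map with fixed slope `l`: it contracts by 1/2, and `h0` keeps the ball
  -- invariant.
  let f : ℂ → ℂ := fun z => z - F z / l
  have hlip : ∀ z ∈ Metric.closedBall c r, ∀ w ∈ Metric.closedBall c r,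
      ‖f z - f w‖ ≤ 1 / 2 * ‖z - w‖ := by
    intro z hz w hw
    have : f z - f w = -(F z - F w - l * (z - w)) / l := by simp only [f]; field_simp; ring
    rw [this, norm_div, norm_neg, div_le_iff₀ hl']
    linarith [hF z hz w hw]
  have hmaps : Set.MapsTo f (Metric.closedBall c r) (Metric.closedBall c r) := by
    intro z hz
    have h1 := hlip z hz c hcm
    have h2 : ‖f c - c‖ ≤ r / 2 := by
      have : f c - c = -(F c / l) := by simp only [f]; ring
      rw [this, norm_neg, norm_div, div_le_iff₀ hl']; linarith
    rw [mem_closedBall_iff_norm] at hz ⊢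
    have h3 : f z - c = (f z - f c) + (f c - c) := by ring
    rw [h3]
    linarith [norm_add_le (f z - f c) (f c - c)]
  have hcontr : ContractingWith (1 / 2) (hmaps.restrict f _ _) := by
    refine ⟨by rw [← NNReal.coe_lt_coe]; norm_num, LipschitzWith.of_dist_le_mul ?_⟩
    rintro ⟨z, hz⟩ ⟨w, hw⟩
    simpa [Subtype.dist_eq, dist_eq_norm] using hlip z hz w hw
  obtain ⟨z, hz, hfix, -⟩ := hcontr.exists_fixedPoint' Metric.isClosed_closedBall.isComplete
    hmaps hcm (edist_ne_top _ _)
  refine ⟨z, hz, ?_⟩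
  have h1 : z - F z / l = z := hfix
  have h2 : F z / l = 0 := by simpa using h1
  simpa [hl] using h2

/-! ### Estimates on the disc of radius 1/5 around a free eigenvalue. -/

section

/-- The unperturbed frequency `√(n² + 1)`. -/
noncomputable def freq (n : ℤ) : ℝ := Real.sqrt ((n : ℝ) ^ 2 + 1)

lemma freq_sq (n : ℤ) : freq n ^ 2 = (n : ℝ) ^ 2 + 1 := Real.sq_sqrt (by positivity)

lemma one_le_freq (n : ℤ) : 1 ≤ freq n := by
  rw [freq, Real.one_le_sqrt]; nlinarith [sq_nonneg (n : ℝ)]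

lemma abs_le_freq (n : ℤ) : |(n : ℝ)| ≤ freq n := by
  rw [← abs_of_nonneg ((zero_le_one).trans (one_le_freq n)), ← sq_le_sq, freq_sq]; linarith

lemma freeEigenvalue_eq (n : ℤ) (s : Fin 2) :
    freeEigenvalue n s = (((-1 : ℝ) ^ (s : ℕ) * freq n : ℝ) : ℂ) * Complex.I := by
  unfold freeEigenvalue freq; push_cast; ring

lemma sign_sq (s : Fin 2) : ((-1 : ℝ) ^ (s : ℕ)) ^ 2 = 1 := by
  rw [← pow_mul, mul_comm, pow_mul]; norm_num

lemma freeEigenvalue_sq (n : ℤ) (s : Fin 2) :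
    freeEigenvalue n s ^ 2 = -((n : ℂ) ^ 2 + 1) := by
  have h : ((((-1 : ℝ) ^ (s : ℕ) * freq n : ℝ)) ^ 2 : ℝ) = (n : ℝ) ^ 2 + 1 := by
    rw [mul_pow, sign_sq, freq_sq, one_mul]
  rw [freeEigenvalue_eq, mul_pow, Complex.I_sq, ← Complex.ofReal_pow, h]; push_cast; ring

lemma freeEigenvalue_re (n : ℤ) (s : Fin 2) : (freeEigenvalue n s).re = 0 := by
  rw [freeEigenvalue_eq, Complex.re_ofReal_mul, Complex.I_re, mul_zero]

lemma freeEigenvalue_im (n : ℤ) (s : Fin 2) :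
    (freeEigenvalue n s).im = (-1 : ℝ) ^ (s : ℕ) * freq n := by
  rw [freeEigenvalue_eq, Complex.im_ofReal_mul, Complex.I_im, mul_one]

lemma abs_sign (s : Fin 2) : |(-1 : ℝ) ^ (s : ℕ)| = 1 := by
  rw [abs_pow]; simp

lemma freeEigenvalue_norm (n : ℤ) (s : Fin 2) : ‖freeEigenvalue n s‖ = freq n := by
  rw [freeEigenvalue_eq, norm_mul, Complex.norm_I, Complex.norm_real, Real.norm_eq_abs, abs_mul,
    abs_sign, mul_one, one_mul, abs_of_nonneg ((zero_le_one).trans (one_le_freq n))]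

lemma freeEigenvalue_neg (n : ℤ) (s : Fin 2) : freeEigenvalue (-n) s = freeEigenvalue n s := by
  simp [freeEigenvalue]

lemma freq_neg (n : ℤ) : freq (-n) = freq n := by simp [freq]

section Disc

variable {n : ℤ} {s : Fin 2} {lam mu : ℂ}

/-- The imaginary part alone is at least ω - 1/5. This keeps the discs away from the pole of λ/(λ+1)
at -1, and 1/(λ+1) supplies the first factor 1/ω in the final bounds. -/
lemma freq_le_norm_add_one (h : ‖lam - freeEigenvalue n s‖ < 1 / 5) :
    4 / 5 * freq n ≤ ‖lam + 1‖ := by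
  have h1 := Complex.abs_im_le_norm (lam + 1)
  have h2 := Complex.abs_im_le_norm (lam - freeEigenvalue n s)
  have h3 : |(freeEigenvalue n s).im| = freq n := by
    rw [freeEigenvalue_im, abs_mul, abs_sign, one_mul,
      abs_of_nonneg ((zero_le_one).trans (one_le_freq n))]
  have h4 : (freeEigenvalue n s).im = (lam + 1).im - (lam - freeEigenvalue n s).im := by simp
  have h5 := abs_sub (lam + 1).im (lam - freeEigenvalue n s).im
  rw [← h4, h3] at h5
  linarith [one_le_freq n]

lemma add_one_ne_zero_of_mem (h : ‖lam - freeEigenvalue n s‖ < 1 / 5) : lam + 1 ≠ 0 := by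
  rw [← norm_pos_iff]
  linarith [freq_le_norm_add_one h, one_le_freq n]

lemma norm_inv_add_one_le (h : ‖lam - freeEigenvalue n s‖ < 1 / 5) :
    ‖(lam + 1)⁻¹‖ ≤ 5 / 4 / freq n := by
  have h1 := freq_le_norm_add_one h
  have h2 := one_le_freq n
  rw [norm_inv, inv_le_comm₀ (by linarith) (by positivity), inv_div]
  linarith

lemma norm_le_of_mem (h : ‖lam - freeEigenvalue n s‖ < 1 / 5) :
    4 / 5 * freq n ≤ ‖lam‖ ∧ ‖lam‖ ≤ 6 / 5 * freq n := by
  have h1 := freeEigenvalue_norm n s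
  have h2 := norm_sub_norm_le (freeEigenvalue n s) lam
  have h3 := norm_sub_norm_le lam (freeEigenvalue n s)
  rw [norm_sub_rev] at h2
  constructor <;> linarith [one_le_freq n]

lemma ratio_eq (h : lam + 1 ≠ 0) : lam / (lam + 1) = 1 - (lam + 1)⁻¹ := by field_simp; ring

lemma ratio_sub (h : lam + 1 ≠ 0) (h' : mu + 1 ≠ 0) :
    lam / (lam + 1) - mu / (mu + 1) = (lam - mu) * ((lam + 1)⁻¹ * (mu + 1)⁻¹) := by
  field_simp; ring

lemma norm_ratio_le (h : ‖lam - freeEigenvalue n s‖ < 1 / 5) : ‖lam / (lam + 1)‖ ≤ 9 / 4 := by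
  rw [ratio_eq (add_one_ne_zero_of_mem h)]
  refine (norm_sub_le _ _).trans ?_
  have h1 := norm_inv_add_one_le h
  have h2 : 5 / 4 / freq n ≤ 5 / 4 := div_le_self (by norm_num) (one_le_freq n)
  rw [norm_one]; linarith

lemma le_norm_ratio (h : ‖lam - freeEigenvalue n s‖ < 1 / 5) : 4 / 11 ≤ ‖lam / (lam + 1)‖ := by
  have h0 := one_le_freq n
  rw [norm_div, le_div_iff₀ (norm_pos_iff.mpr (add_one_ne_zero_of_mem h))]
  have h1 := norm_le_of_mem h
  have h2 := norm_add_le lam 1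
  rw [norm_one] at h2
  linarith

lemma norm_ratio_sub_le (h : ‖lam - freeEigenvalue n s‖ < 1 / 5)
    (h' : ‖mu - freeEigenvalue n s‖ < 1 / 5) :
    ‖lam / (lam + 1) - mu / (mu + 1)‖ ≤ 25 / 16 / freq n ^ 2 * ‖lam - mu‖ := by
  rw [ratio_sub (add_one_ne_zero_of_mem h) (add_one_ne_zero_of_mem h'), norm_mul, norm_mul]
  have h1 := norm_inv_add_one_le h
  have h2 := norm_inv_add_one_le h'
  have h3 : ‖(lam + 1)⁻¹‖ * ‖(mu + 1)⁻¹‖ ≤ 5 / 4 / freq n * (5 / 4 / freq n) :=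
    mul_le_mul h1 h2 (norm_nonneg _) (by linarith [norm_nonneg (lam + 1)⁻¹])
  rw [mul_comm]
  refine mul_le_mul_of_nonneg_right (h3.trans (le_of_eq ?_)) (norm_nonneg _)
  ring

lemma le_norm_add_freeEigenvalue (h : ‖lam - freeEigenvalue n s‖ < 1 / 5) :
    9 / 5 * freq n ≤ ‖lam + freeEigenvalue n s‖ := by
  have h1 : 2 * freeEigenvalue n s
      = (lam + freeEigenvalue n s) - (lam - freeEigenvalue n s) := by ring
  have h2 : ‖2 * freeEigenvalue n s‖ = 2 * freq n := by
    rw [norm_mul, freeEigenvalue_norm]; norm_num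
  have h3 := norm_sub_le (lam + freeEigenvalue n s) (lam - freeEigenvalue n s)
  rw [← h1, h2] at h3
  linarith [one_le_freq n]

lemma sq_add_eq (lam : ℂ) (n : ℤ) (s : Fin 2) :
    lam ^ 2 + (n : ℂ) ^ 2 + 1 = (lam - freeEigenvalue n s) * (lam + freeEigenvalue n s) := by
  linear_combination freeEigenvalue_sq n s

lemma le_abs_sq_sub_sq {m n : ℤ} (hm : m ≠ n) (hm' : m ≠ -n) :
    1 ≤ |m ^ 2 - n ^ 2| ∧ 2 * |n| - 1 ≤ |m ^ 2 - n ^ 2| := by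
  have hne : |m| ≠ |n| := by
    rw [Ne, abs_eq_abs]; tauto
  rw [← sq_abs m, ← sq_abs n]
  have ha := abs_nonneg m
  have hb := abs_nonneg n
  rcases lt_or_gt_of_ne hne with h | h
  · have h6 : |m| + 1 ≤ |n| := h
    rw [abs_of_neg (by nlinarith)]
    constructor <;> nlinarith
  · have h6 : |n| + 1 ≤ |m| := h
    rw [abs_of_pos (by nlinarith)]
    constructor <;> nlinarith

/-- Write λ² + m² + 1 as (m² - n²) + (λ² + n² + 1). The radius 1/5 makes the second term at most 2/3
of the first; the tightest case is |n| = 1. -/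
lemma gap_lower {m : ℤ} (h : ‖lam - freeEigenvalue n s‖ < 1 / 5) (hm : m ≠ n) (hm' : m ≠ -n) :
    |(m : ℝ) ^ 2 - (n : ℝ) ^ 2| / 3 ≤ ‖lam ^ 2 + (m : ℂ) ^ 2 + 1‖ := by
  obtain ⟨hX1, hX2⟩ := le_abs_sq_sub_sq hm hm'
  have hX1' : (1 : ℝ) ≤ |(m : ℝ) ^ 2 - (n : ℝ) ^ 2| := by exact_mod_cast hX1
  have hX2' : 2 * |(n : ℝ)| - 1 ≤ |(m : ℝ) ^ 2 - (n : ℝ) ^ 2| := by exact_mod_cast hX2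
  set X : ℝ := |(m : ℝ) ^ 2 - (n : ℝ) ^ 2| with hX
  have h1 : ‖lam ^ 2 + (n : ℂ) ^ 2 + 1‖ ≤ 1 / 5 * (2 * freq n + 1 / 5) := by
    rw [sq_add_eq lam n s, norm_mul]
    have h2 : ‖lam + freeEigenvalue n s‖ ≤ 2 * freq n + 1 / 5 := by
      have h3 : lam + freeEigenvalue n s = 2 * freeEigenvalue n s + (lam - freeEigenvalue n s) := by
        ring
      have h4 : ‖2 * freeEigenvalue n s‖ = 2 * freq n := by
        rw [norm_mul, freeEigenvalue_norm]; norm_num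
      rw [h3]
      linarith [norm_add_le (2 * freeEigenvalue n s) (lam - freeEigenvalue n s)]
    exact mul_le_mul h.le h2 (norm_nonneg _) (by norm_num)
  have h2 : X ≤ ‖lam ^ 2 + (m : ℂ) ^ 2 + 1‖ + ‖lam ^ 2 + (n : ℂ) ^ 2 + 1‖ := by
    have h3 : (((m : ℝ) ^ 2 - (n : ℝ) ^ 2 : ℝ) : ℂ)
        = (lam ^ 2 + (m : ℂ) ^ 2 + 1) - (lam ^ 2 + (n : ℂ) ^ 2 + 1) := by push_cast; ring
    rw [hX, ← Real.norm_eq_abs, ← Complex.norm_real, h3]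
    exact norm_sub_le _ _
  have h3 : 1 / 5 * (2 * freq n + 1 / 5) ≤ 2 / 3 * X := by
    have hsq := freq_sq n
    have h1f := one_le_freq n
    rw [← sq_abs (n : ℝ)] at hsq
    by_cases hn : n = 0
    · subst hn
      have : freq 0 = 1 := by simp [freq]
      rw [this]; linarith
    · have hN : (1 : ℝ) ≤ |(n : ℝ)| := by exact_mod_cast Int.one_le_abs hn
      have : freq n ≤ |(n : ℝ)| + 1 / 2 := by nlinarith
      linarith
  linarith

lemma norm_inv_le_gapInv {m : ℤ} (h : ‖lam - freeEigenvalue n s‖ < 1 / 5) (hm : m ≠ n)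
    (hm' : m ≠ -n) : ‖(lam ^ 2 + (m : ℂ) ^ 2 + 1)⁻¹‖ ≤ gapInv n m := by
  have h1 := gap_lower h hm hm'
  have hX1 : (1 : ℝ) ≤ |(m : ℝ) ^ 2 - (n : ℝ) ^ 2| := by
    exact_mod_cast (le_abs_sq_sub_sq hm hm').1
  rw [gapInv, norm_inv, inv_le_comm₀ (by linarith) (by positivity), inv_div]
  exact h1

lemma sq_add_ne_zero {m : ℤ} (h : ‖lam - freeEigenvalue n s‖ < 1 / 5) (hm : m ≠ n)
    (hm' : m ≠ -n) : lam ^ 2 + (m : ℂ) ^ 2 + 1 ≠ 0 := by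
  have h1 := gap_lower h hm hm'
  have hX1 : (1 : ℝ) ≤ |(m : ℝ) ^ 2 - (n : ℝ) ^ 2| := by
    exact_mod_cast (le_abs_sq_sub_sq hm hm').1
  rw [← norm_pos_iff]; linarith

end Disc

end

/-! ### The reduced equation in a real basis: level splitting and the a priori estimate. -/

section

/-- `∑ₖ A(k) u(k)`, the pairing of the couplings with `u` in a real orthonormal basis. -/
noncomputable def coupled (A : ℤ → Fin 2 → ℝ) (u : ℤ → ℂ) (i : Fin 2) : ℂ :=
  ∑' k, (A k i : ℂ) * u k

/-- The action of a real matrix on a sequence. -/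
noncomputable def potApply (V : ℤ → ℤ → ℝ) (u : ℤ → ℂ) (m : ℤ) : ℂ := ∑' k, (V m k : ℂ) * u k

/-- The left-hand side of the reduced eigenvalue equation
`(lam² + m² + 1) u(m) + lam / (lam + 1) A(m) · ∑ₖ A(k) u(k) + ∑ₖ V(m, k) u(k) = 0`. -/
noncomputable def residual (A : ℤ → Fin 2 → ℝ) (V : ℤ → ℤ → ℝ) (lam : ℂ) (u : ℤ → ℂ) (m : ℤ) : ℂ :=
  (lam ^ 2 + (m : ℂ) ^ 2 + 1) * u m + lam / (lam + 1) * ∑ i, (A m i : ℂ) * coupled A u i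
    + potApply V u m

noncomputable def strength (A : ℤ → Fin 2 → ℝ) (m : ℤ) : ℝ := ∑ i, A m i * A m i

/-- The properties of the couplings, in a real basis adapted to them, that the spectral analysis
rests on. -/
structure Regular (A : ℤ → Fin 2 → ℝ) (M k : ℝ) : Prop where
  M_pos : 0 < M
  k_pos : 0 < k
  k_le : k ≤ 1
  small : gapConst * M ≤ k / 10 ^ 4
  dot_le : ∀ m l, |∑ i, A m i * A l i| ≤ 2 * M
  orth : ∀ m, m ≠ 0 → ∑ i, A m i * A (-m) i = 0
  gap : ∀ m, 0 < m → 2 * k * M ≤ strength A m - strength A (-m)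

/-- Only the size of the entries and the symmetry matter; no decay away from the diagonal is needed,
since all sequences are estimated in ℓ¹. -/
structure Potential (V : ℤ → ℤ → ℝ) (w : ℝ) : Prop where
  symm : ∀ m l, V m l = V l m
  bound : ∀ m l, |V m l| ≤ w

noncomputable def l1 (u : ℤ → ℂ) : ℝ := ∑' m, ‖u m‖

/-- The size of the component at `-n`, if that is not the one at `n`. -/
noncomputable def opp (n : ℤ) (u : ℤ → ℂ) : ℝ := if n = 0 then 0 else ‖u (-n)‖

/-- The `ℓ¹` norm of the components off the level `± n`. -/
noncomputable def tail (n : ℤ) (u : ℤ → ℂ) : ℝ :=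
  ∑' m, if m = n ∨ m = -n then 0 else ‖u m‖

/-- The n-th diagonal entry of the reduced equation without the potential; its zero is the leading
approximation to the eigenvalue. -/
noncomputable def levelSymbol (A : ℤ → Fin 2 → ℝ) (lam : ℂ) (n : ℤ) : ℂ :=
  lam ^ 2 + (n : ℂ) ^ 2 + 1 + lam / (lam + 1) * strength A n

/-- First-order approximation of the eigenvalue with mode number `(n, s)`. -/
noncomputable def center (A : ℤ → Fin 2 → ℝ) (n : ℤ) (s : Fin 2) : ℂ :=
  freeEigenvalue n s - freeEigenvalue n s / (freeEigenvalue n s + 1) * strength A n /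
    (2 * freeEigenvalue n s)

/-- Multiplied by the slope 2ω, the radius becomes kM/8, a small part of the splitting 2kM of the
two level symbols. -/
def Near (A : ℤ → Fin 2 → ℝ) (M k : ℝ) (n : ℤ) (s : Fin 2) (lam : ℂ) : Prop :=
  ‖lam - center A n s‖ ≤ k * M / (16 * freq n)

variable {A : ℤ → Fin 2 → ℝ} {V : ℤ → ℤ → ℝ} {M k w : ℝ} {n : ℤ} {s : Fin 2} {lam : ℂ}
  {u : ℤ → ℂ}

lemma Regular.M_le (h : Regular A M k) : M ≤ k / 10 ^ 4 :=
  le_trans (by nlinarith [h.M_pos, one_le_gapConst]) h.small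

lemma Regular.M_le' (h : Regular A M k) : M ≤ 1 / 10 ^ 4 :=
  h.M_le.trans (by linarith [h.k_le])

lemma Regular.coupling_abs_le (h : Regular A M k) (m : ℤ) (i : Fin 2) : |A m i| ≤ 1 := by
  have h1 := (abs_le.mp (h.dot_le m m)).2
  have h2 := h.M_le'
  rw [Fin.sum_univ_two] at h1
  rw [← sq_le_one_iff_abs_le_one]
  fin_cases i <;> simp only [Fin.zero_eta, Fin.mk_one] <;>
    nlinarith [mul_self_nonneg (A m 0), mul_self_nonneg (A m 1)]

lemma Regular.norm_strength_le (h : Regular A M k) (m : ℤ) : ‖(strength A m : ℂ)‖ ≤ 2 * M := by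
  rw [Complex.norm_real]; exact h.dot_le m m

lemma Regular.summable_coupled (h : Regular A M k) (hu : Summable fun m => ‖u m‖) (i : Fin 2) :
    Summable fun m => (A m i : ℂ) * u m :=
  summable_mul_of_bounded (C := 1) (fun m => by
    rw [Complex.norm_real]; exact h.coupling_abs_le m i) hu

lemma Regular.norm_coupled_le (h : Regular A M k) (hu : Summable fun m => ‖u m‖) (i : Fin 2) :
    ‖coupled A u i‖ ≤ l1 u := by
  have := norm_tsum_mul_le (f := fun m => (A m i : ℂ)) (C := 1) (fun m => by
    rw [Complex.norm_real]; exact h.coupling_abs_le m i) hu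
  rw [one_mul] at this
  exact this

lemma Regular.sum_mul_coupled (h : Regular A M k) (hu : Summable fun m => ‖u m‖)
    (a : Fin 2 → ℂ) :
    ∑ i, a i * coupled A u i = ∑' l, (∑ i, a i * (A l i : ℂ)) * u l := by
  simp only [coupled, ← tsum_mul_left, Finset.sum_mul]
  rw [Summable.tsum_finsetSum fun i _ => by
    simpa only [mul_assoc] using (h.summable_coupled hu i).mul_left (a i)]
  simp only [mul_assoc]

lemma Regular.norm_dot_le (h : Regular A M k) (m l : ℤ) :
    ‖∑ i, (A m i : ℂ) * (A l i : ℂ)‖ ≤ 2 * M := by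
  have : ∑ i, (A m i : ℂ) * (A l i : ℂ) = ((∑ i, A m i * A l i : ℝ) : ℂ) := by push_cast; rfl
  rw [this, Complex.norm_real]; exact h.dot_le m l

lemma Regular.norm_sum_coupled_le (h : Regular A M k) (hu : Summable fun m => ‖u m‖) (m : ℤ) :
    ‖∑ i, (A m i : ℂ) * coupled A u i‖ ≤ 2 * M * l1 u := by
  rw [h.sum_mul_coupled hu]
  exact norm_tsum_mul_le (h.norm_dot_le m) hu

lemma Regular.norm_coupled_dot_le (h : Regular A M k) {u' : ℤ → ℂ}
    (hu : Summable fun m => ‖u m‖) (hu' : Summable fun m => ‖u' m‖) :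
    ‖∑ i, coupled A u i * coupled A u' i‖ ≤ 2 * M * l1 u * l1 u' := by
  rw [h.sum_mul_coupled hu']
  refine norm_tsum_mul_le (fun m => ?_) hu'
  simp only [mul_comm (coupled A u _)]
  exact h.norm_sum_coupled_le hu m

lemma Potential.norm_le (hV : Potential V w) (m l : ℤ) : ‖(V m l : ℂ)‖ ≤ w := by
  rw [Complex.norm_real]; exact hV.bound m l

lemma Potential.nonneg (hV : Potential V w) : 0 ≤ w := (abs_nonneg _).trans (hV.bound 0 0)

lemma Potential.norm_potApply_le (hV : Potential V w) (hu : Summable fun m => ‖u m‖) (m : ℤ) :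
    ‖potApply V u m‖ ≤ w * l1 u := norm_tsum_mul_le (hV.norm_le m) hu

lemma l1_nonneg (u : ℤ → ℂ) : 0 ≤ l1 u := tsum_nonneg fun _ => norm_nonneg _
lemma opp_nonneg (n : ℤ) (u : ℤ → ℂ) : 0 ≤ opp n u := by
  unfold opp; split_ifs <;> positivity
lemma tail_nonneg (n : ℤ) (u : ℤ → ℂ) : 0 ≤ tail n u := tsum_nonneg fun _ => by
  split_ifs <;> positivity

lemma summable_tail (n : ℤ) (hu : Summable fun m => ‖u m‖) :
    Summable fun m => if m = n ∨ m = -n then 0 else ‖u m‖ :=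
  Summable.of_nonneg_of_le (fun m => by split_ifs <;> positivity)
    (fun m => by split_ifs <;> simp) hu

lemma l1_eq (n : ℤ) (hu : Summable fun m => ‖u m‖) :
    l1 u = ‖u n‖ + opp n u + tail n u := by
  have h1 := hu.tsum_eq_add_tsum_ite n
  have h2 : Summable fun m => if m = n then 0 else ‖u m‖ :=
    Summable.of_nonneg_of_le (fun m => by split_ifs <;> positivity)
      (fun m => by split_ifs <;> simp) hu
  unfold l1 opp tail
  rw [h1]
  split_ifs with hn
  · subst hn; simp
  · have h3 := h2.tsum_eq_add_tsum_ite (-n)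
    have hne : -n ≠ n := by omega
    rw [h3, if_neg hne, add_assoc]
    congr 3
    ext m
    by_cases h4 : m = n <;> by_cases h5 : m = -n <;> simp [h4, h5]

lemma tail_neg (n : ℤ) (u : ℤ → ℂ) : tail (-n) u = tail n u := by
  unfold tail; congr 1; ext m; simp only [neg_neg, or_comm]

/-- Divide each row off the level by its diagonal entry and sum with the weights `gapInv`. The tail
reappears on the right with a factor 5·`gapConst`·M ≤ 1/2 and is absorbed. -/
lemma Regular.tail_le (h : Regular A M k) (hV : Potential V w) (hw : w ≤ k * M / 10 ^ 4)
    (hlam : ‖lam - freeEigenvalue n s‖ < 1 / 5) (hu : Summable fun m => ‖u m‖) {ρ : ℝ}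
    (hρ : 0 ≤ ρ) (hr : ∀ m, m ≠ n → m ≠ -n → ‖residual A V lam u m‖ ≤ ρ) :
    tail n u ≤ 2 * gapConst * (5 * M * (‖u n‖ + opp n u) + ρ) := by
  have hM := h.M_pos
  have hl := l1_nonneg u
  have hw' : w ≤ M / 2 := by nlinarith [h.k_le]
  have hpt : ∀ m, (if m = n ∨ m = -n then 0 else ‖u m‖) ≤ gapInv n m * (5 * M * l1 u + ρ) := by
    intro m
    split_ifs with hm
    · exact mul_nonneg (gapInv_nonneg n m) (by positivity)
    · push Not at hm
      have hd := sq_add_ne_zero hlam hm.1 hm.2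
      have h1 : u m = (lam ^ 2 + (m : ℂ) ^ 2 + 1)⁻¹ * (residual A V lam u m
          - lam / (lam + 1) * ∑ i, (A m i : ℂ) * coupled A u i - potApply V u m) := by
        rw [eq_inv_mul_iff_mul_eq₀ hd]; unfold residual; ring
      rw [h1, norm_mul]
      refine mul_le_mul (norm_inv_le_gapInv hlam hm.1 hm.2) ?_ (norm_nonneg _)
        (gapInv_nonneg n m)
      have h2 := hr m hm.1 hm.2
      have h3 : ‖lam / (lam + 1) * ∑ i, (A m i : ℂ) * coupled A u i‖ ≤ 9 / 4 * (2 * M * l1 u) := by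
        rw [norm_mul]
        exact mul_le_mul (norm_ratio_le hlam) (h.norm_sum_coupled_le hu m) (norm_nonneg _)
          (by norm_num)
      have h4 := hV.norm_potApply_le hu m
      have h5 : w * l1 u ≤ M / 2 * l1 u := mul_le_mul_of_nonneg_right hw' hl
      have h6 := norm_sub_le (residual A V lam u m
          - lam / (lam + 1) * ∑ i, (A m i : ℂ) * coupled A u i) (potApply V u m)
      have h7 := norm_sub_le (residual A V lam u m)
        (lam / (lam + 1) * ∑ i, (A m i : ℂ) * coupled A u i)
      linarith
  have h1 := (summable_tail n hu).tsum_le_tsum hpt ((summable_gapInv n).mul_right _)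
  rw [tsum_mul_right] at h1
  have h2 : tail n u ≤ gapConst * (5 * M * l1 u + ρ) :=
    h1.trans (mul_le_mul_of_nonneg_right (tsum_gapInv_le n) (by positivity))
  rw [l1_eq n hu] at h2
  have h3 := h.small
  have h4 := h.k_le
  have h5 := tail_nonneg n u
  have h6 : gapConst * M * tail n u ≤ 1 / 10 * tail n u :=
    mul_le_mul_of_nonneg_right (by linarith) h5
  linarith

/-- Since the coupling vectors at n and -n are orthogonal, the coupling does not link the two
components of the level: only the tail and the potential disturb the diagonal term. -/
lemma Regular.norm_residual_sub_le (h : Regular A M k) (hV : Potential V w)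
    (hlam : ‖lam - freeEigenvalue n s‖ < 1 / 5) (hu : Summable fun m => ‖u m‖) :
    ‖residual A V lam u n - levelSymbol A lam n * u n‖ ≤ 9 / 2 * M * tail n u + w * l1 u := by
  have hM := h.M_pos
  have hs : Summable fun l => (∑ i, (A n i : ℂ) * (A l i : ℂ)) * u l :=
    summable_mul_of_bounded (h.norm_dot_le n) hu
  have h1 : ∑ i, (A n i : ℂ) * coupled A u i = strength A n * u n +
      ∑' l, if l = n then 0 else (∑ i, (A n i : ℂ) * (A l i : ℂ)) * u l := by
    rw [h.sum_mul_coupled hu, hs.tsum_eq_add_tsum_ite n]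
    congr 1
    simp [strength]
  have h2 : ‖∑' l, if l = n then 0 else (∑ i, (A n i : ℂ) * (A l i : ℂ)) * u l‖
      ≤ 2 * M * tail n u := by
    unfold tail
    rw [← tsum_mul_left]
    refine tsum_of_norm_bounded ((summable_tail n hu).mul_left _).hasSum fun l => ?_
    by_cases hl : l = n
    · simp [hl]
    · by_cases hl' : l = -n
      · have hn : n ≠ 0 := by rintro rfl; simp at hl'; exact hl hl'
        have : ∑ i, (A n i : ℂ) * (A l i : ℂ) = 0 := by
          rw [hl']; exact_mod_cast h.orth n hn
        rw [if_neg hl, this, zero_mul, norm_zero, if_pos (Or.inr hl'), mul_zero]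
      · simp only [hl, hl', if_false, or_self]
        rw [norm_mul]
        exact mul_le_mul_of_nonneg_right (h.norm_dot_le n l) (norm_nonneg _)
  have h3 : residual A V lam u n - levelSymbol A lam n * u n = lam / (lam + 1) *
      (∑' l, if l = n then 0 else (∑ i, (A n i : ℂ) * (A l i : ℂ)) * u l) + potApply V u n := by
    unfold residual levelSymbol; rw [h1]; ring
  rw [h3]
  refine (norm_add_le _ _).trans (add_le_add ?_ (hV.norm_potApply_le hu n))
  rw [norm_mul]
  refine (mul_le_mul (norm_ratio_le hlam) h2 (norm_nonneg _) (by norm_num)).trans (le_of_eq ?_)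
  ring

lemma freeEigenvalue_ne_zero (n : ℤ) (s : Fin 2) : freeEigenvalue n s ≠ 0 := by
  rw [← norm_pos_iff, freeEigenvalue_norm]; linarith [one_le_freq n]

/-- Expansion of the level symbol around the approximate eigenvalue. -/
lemma levelSymbol_eq (A : ℤ → Fin 2 → ℝ) (lam : ℂ) (n : ℤ) (s : Fin 2) :
    levelSymbol A lam n = 2 * freeEigenvalue n s * (lam - center A n s)
      + (lam - freeEigenvalue n s) ^ 2
      + (lam / (lam + 1) - freeEigenvalue n s / (freeEigenvalue n s + 1)) * strength A n := by
  have h0 := freeEigenvalue_ne_zero n s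
  have h1 : 2 * freeEigenvalue n s * (lam - center A n s) =
      2 * freeEigenvalue n s * (lam - freeEigenvalue n s)
        + freeEigenvalue n s / (freeEigenvalue n s + 1) * strength A n := by
    unfold center
    generalize freeEigenvalue n s / (freeEigenvalue n s + 1) * strength A n = q
    field_simp; ring
  rw [h1, levelSymbol, sq_add_eq lam n s]
  ring

lemma norm_freeRatio_le (n : ℤ) (s : Fin 2) :
    ‖freeEigenvalue n s / (freeEigenvalue n s + 1)‖ ≤ 1 := by
  have h0 : freeEigenvalue n s + 1 ≠ 0 :=
    add_one_ne_zero_of_mem (n := n) (s := s) (by simp)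
  rw [norm_div, div_le_one (norm_pos_iff.mpr h0), ← sq_le_sq₀ (norm_nonneg _) (norm_nonneg _),
    ← Complex.normSq_eq_norm_sq, ← Complex.normSq_eq_norm_sq, Complex.normSq_apply,
    Complex.normSq_apply]
  simp [freeEigenvalue_re]

lemma Regular.norm_center_sub_le (h : Regular A M k) (n : ℤ) (s : Fin 2) :
    ‖center A n s - freeEigenvalue n s‖ ≤ M / freq n := by
  have h0 := one_le_freq n
  have h1 : center A n s - freeEigenvalue n s = -(freeEigenvalue n s / (freeEigenvalue n s + 1) *
      strength A n / (2 * freeEigenvalue n s)) := by unfold center; ring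
  rw [h1, norm_neg, norm_div, norm_mul, norm_mul 2, freeEigenvalue_norm, Complex.norm_ofNat,
    div_le_div_iff₀ (by positivity) (by positivity)]
  have h2 : ‖freeEigenvalue n s / (freeEigenvalue n s + 1)‖ * ‖(strength A n : ℂ)‖ ≤ 1 * (2 * M) :=
    mul_le_mul (norm_freeRatio_le n s) (h.norm_strength_le n) (norm_nonneg _) zero_le_one
  nlinarith

lemma Regular.near_center (h : Regular A M k) (n : ℤ) (s : Fin 2) : Near A M k n s (center A n s) := by
  have := h.M_pos; have := h.k_pos; have := one_le_freq n
  unfold Near; rw [sub_self, norm_zero]; positivity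

lemma Near.dist_le (hlam : Near A M k n s lam) (h : Regular A M k) :
    ‖lam - freeEigenvalue n s‖ ≤ 2 * M / freq n := by
  have h0 := one_le_freq n
  have h1 := h.norm_center_sub_le n s
  have h2 : lam - freeEigenvalue n s = (lam - center A n s) + (center A n s - freeEigenvalue n s) := by
    ring
  have h3 : k * M / (16 * freq n) ≤ M / freq n := by
    rw [div_le_div_iff₀ (by positivity) (by positivity)]
    have := mul_le_mul_of_nonneg_right h.k_le (mul_pos h.M_pos (by linarith : 0 < freq n)).le
    nlinarith [h.M_pos, mul_pos h.M_pos (by linarith : 0 < freq n)]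
  rw [h2]
  refine (norm_add_le _ _).trans ?_
  unfold Near at hlam
  rw [show 2 * M / freq n = M / freq n + M / freq n by ring]
  linarith

lemma Near.mem_disc (hlam : Near A M k n s lam) (h : Regular A M k) :
    ‖lam - freeEigenvalue n s‖ < 1 / 5 := by
  have h1 := hlam.dist_le h
  have h2 : 2 * M / freq n ≤ 2 * M := div_le_self (by linarith [h.M_pos]) (one_le_freq n)
  linarith [h.M_le']

/-- The error is quadratic in M: one part is the square of a displacement O(M), the other a
variation O(M) of λ/(λ+1) times a strength O(M). -/
lemma Regular.norm_levelSymbol_sub_le (h : Regular A M k)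
    (hlam : ‖lam - freeEigenvalue n s‖ < 1 / 5) (hsub : ‖lam - freeEigenvalue n s‖ ≤ 3 * M / freq n) :
    ‖levelSymbol A lam n - 2 * freeEigenvalue n s * (lam - center A n s)‖ ≤ 20 * M ^ 2 := by
  have hM := h.M_pos
  have h0 := one_le_freq n
  have h3 : 3 * M / freq n ≤ 3 * M := div_le_self (by linarith) h0
  have h3' := hsub.trans h3
  rw [levelSymbol_eq A lam n s]
  have h1 : ∀ a b c : ℂ, a + b + c - a = b + c := fun a b c => by ring
  rw [h1]
  refine (norm_add_le _ _).trans ?_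
  rw [norm_pow, norm_mul]
  have h4 : ‖lam / (lam + 1) - freeEigenvalue n s / (freeEigenvalue n s + 1)‖
      ≤ 25 / 16 * (3 * M) := by
    refine (norm_ratio_sub_le hlam (mu := freeEigenvalue n s) (by simp)).trans ?_
    have h5 : 25 / 16 / freq n ^ 2 ≤ 25 / 16 := div_le_self (by norm_num) (by nlinarith)
    exact mul_le_mul h5 h3' (norm_nonneg _) (by norm_num)
  have h5 := mul_le_mul h4 (h.norm_strength_le n) (norm_nonneg _) (by positivity)
  have h6 := pow_le_pow_left₀ (norm_nonneg _) h3' 2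
  nlinarith

lemma Near.norm_levelSymbol_le (hlam : Near A M k n s lam) (h : Regular A M k) :
    ‖levelSymbol A lam n‖ ≤ k * M / 4 := by
  have hM := h.M_pos
  have hk := h.k_pos
  have h0 := one_le_freq n
  have h1 : ‖lam - freeEigenvalue n s‖ ≤ 3 * M / freq n :=
    (hlam.dist_le h).trans (by gcongr; norm_num)
  have h2 := h.norm_levelSymbol_sub_le (hlam.mem_disc h) h1
  have h3 : ‖2 * freeEigenvalue n s * (lam - center A n s)‖ ≤ k * M / 8 := by
    rw [norm_mul, norm_mul, freeEigenvalue_norm, Complex.norm_ofNat]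
    refine (mul_le_mul_of_nonneg_left hlam (by positivity)).trans (le_of_eq ?_)
    field_simp; norm_num
  have h4 := norm_add_le (levelSymbol A lam n - 2 * freeEigenvalue n s * (lam - center A n s))
    (2 * freeEigenvalue n s * (lam - center A n s))
  rw [sub_add_cancel] at h4
  nlinarith [h.M_le]

lemma Regular.le_abs_strength_sub (h : Regular A M k) (hn : n ≠ 0) :
    2 * k * M ≤ |strength A (-n) - strength A n| := by
  rcases lt_or_gt_of_ne hn with h1 | h1
  · have := h.gap (-n) (by omega)
    rw [neg_neg] at this
    exact this.trans (le_abs_self _)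
  · rw [abs_sub_comm]
    exact (h.gap n h1).trans (le_abs_self _)

/-- The symbols at n and -n differ by λ/(λ+1) times the strength gap, hence by at least (4/11)·2kM,
while the one at n is at most kM/4. So row -n can be solved for u(-n), at the cost of a factor
3/(kM). -/
lemma Near.le_norm_levelSymbol_neg (hlam : Near A M k n s lam) (h : Regular A M k) (hn : n ≠ 0) :
    k * M / 3 ≤ ‖levelSymbol A lam (-n)‖ := by
  have h1 := hlam.norm_levelSymbol_le h
  have h2 := le_norm_ratio (hlam.mem_disc h)
  have h3 : levelSymbol A lam (-n) - levelSymbol A lam n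
      = lam / (lam + 1) * ((strength A (-n) - strength A n : ℝ) : ℂ) := by
    unfold levelSymbol; push_cast; ring
  have h4 : 4 / 11 * (2 * k * M) ≤ ‖levelSymbol A lam (-n) - levelSymbol A lam n‖ := by
    rw [h3, norm_mul, Complex.norm_real]
    have := mul_pos h.k_pos h.M_pos
    exact mul_le_mul h2 (h.le_abs_strength_sub hn) (by nlinarith) (norm_nonneg _)
  have h5 := norm_sub_le (levelSymbol A lam (-n)) (levelSymbol A lam n)
  nlinarith [mul_pos h.k_pos h.M_pos]

noncomputable def aprioriConst (M k : ℝ) : ℝ := 8 / (k * M) + 3 * gapConst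

/-- A priori estimate: off the `n`-th component, the rows other than the `n`-th control `u`. -/
lemma Near.apriori (hlam : Near A M k n s lam) (h : Regular A M k) (hV : Potential V w)
    (hw : w ≤ k * M / 10 ^ 4) (hu : Summable fun m => ‖u m‖) {ρ : ℝ} (hρ : 0 ≤ ρ)
    (hr : ∀ m, m ≠ n → ‖residual A V lam u m‖ ≤ ρ) :
    opp n u + tail n u ≤ 1 / 4 * ‖u n‖ + aprioriConst M k * ρ := by
  have hM := h.M_pos
  have hk := h.k_pos
  have hG := one_le_gapConst
  have hkM : 0 < k * M := mul_pos hk hM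
  have hd := hlam.mem_disc h
  have ha := norm_nonneg (u n)
  have hy := opp_nonneg n u
  have hq := tail_nonneg n u
  have h1 := h.tail_le hV hw hd hu hρ fun m hm _ => hr m hm
  have hGM : gapConst * M * (‖u n‖ + opp n u) ≤ k / 10 ^ 4 * (‖u n‖ + opp n u) :=
    mul_le_mul_of_nonneg_right h.small (by positivity)
  have hk1 : k * (‖u n‖ + opp n u) ≤ ‖u n‖ + opp n u := mul_le_of_le_one_left (by positivity) h.k_le
  have hy2 : opp n u ≤ 1 / 50 * ‖u n‖ + 7 / (k * M) * ρ := by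
    by_cases hn : n = 0
    · have : opp n u = 0 := by simp [opp, hn]
      rw [this]; positivity
    have hopp : opp n u = ‖u (-n)‖ := by simp [opp, hn]
    have hd' : ‖lam - freeEigenvalue (-n) s‖ < 1 / 5 := by rwa [freeEigenvalue_neg]
    have h2 := h.norm_residual_sub_le hV hd' hu
    rw [tail_neg, l1_eq n hu] at h2
    have h3 := hr (-n) (by omega)
    have h4 : ‖levelSymbol A lam (-n) * u (-n)‖ ≤
        ρ + (9 / 2 * M * tail n u + w * (‖u n‖ + opp n u + tail n u)) := by
      have := norm_sub_le (residual A V lam u (-n))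
        (residual A V lam u (-n) - levelSymbol A lam (-n) * u (-n))
      rw [sub_sub_cancel] at this
      linarith
    rw [norm_mul, ← hopp] at h4
    have h5 := mul_le_mul_of_nonneg_right (hlam.le_norm_levelSymbol_neg h hn) hy
    have h6 : w * (‖u n‖ + opp n u + tail n u) ≤
        k * M / 10 ^ 4 * (‖u n‖ + opp n u + tail n u) :=
      mul_le_mul_of_nonneg_right hw (by positivity)
    have h7 : k * M * tail n u ≤ M * tail n u := by
      rw [mul_assoc]; exact mul_le_of_le_one_left (by positivity) h.k_le
    -- The tail acts on row -n at second order, with size `gapConst`·M²; `h.small` makes this a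
    -- small fraction of kM, the size of the symbol at -n.
    have h8 : M * tail n u ≤ M * (2 * gapConst * (5 * M * (‖u n‖ + opp n u) + ρ)) :=
      mul_le_mul_of_nonneg_left h1 hM.le
    have h9 : M * (gapConst * M * (‖u n‖ + opp n u)) ≤ M * (k / 10 ^ 4 * (‖u n‖ + opp n u)) :=
      mul_le_mul_of_nonneg_left hGM hM.le
    have h10 : gapConst * M * ρ ≤ 1 / 10 ^ 4 * ρ :=
      mul_le_mul_of_nonneg_right (h.small.trans (by linarith [h.k_le])) hρ
    have h11 : k * M * opp n u * (33 / 100) ≤ 2 * ρ + 6 / 1000 * (k * M) * (‖u n‖ + opp n u) := by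
      nlinarith
    have h12 : k * M * opp n u ≤ k * M * (1 / 50 * ‖u n‖ + 7 / (k * M) * ρ) := by
      have : k * M * (7 / (k * M) * ρ) = 7 * ρ := by field_simp
      rw [mul_add, this]
      nlinarith [mul_nonneg hkM.le ha]
    exact le_of_mul_le_mul_left h12 hkM
  have h3 : tail n u ≤ 1 / 100 * (‖u n‖ + opp n u) + 2 * gapConst * ρ := by nlinarith
  have h4 : aprioriConst M k * ρ = 7 / (k * M) * ρ + 1 / (k * M) * ρ + 3 * (gapConst * ρ) := by
    unfold aprioriConst; ring
  have h5 : 0 ≤ 1 / (k * M) * ρ := by positivity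
  have h6 : 0 ≤ gapConst * ρ := by positivity
  have h7 : 7 / (k * M) * ρ = 7 * (1 / (k * M) * ρ) := by ring
  rw [h4]
  rw [h7] at hy2 ⊢
  linarith

end

/-! ### Separation of the nearly degenerate pair, and the exact difference identity. -/

section

variable {A : ℤ → Fin 2 → ℝ} {V V' : ℤ → ℤ → ℝ} {M k w w' : ℝ} {n : ℤ} {s : Fin 2} {lam lam' : ℂ}
  {u u' : ℤ → ℂ}

lemma eq_zero_of_l1 (hu : Summable fun m => ‖u m‖) (h : l1 u ≤ 0) : u = 0 := by
  ext m
  have := hu.le_tsum m fun _ _ => norm_nonneg _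
  exact norm_le_zero_iff.mp (this.trans h)

lemma opp_le_of_le (h : ‖u (-n)‖ ≤ ‖u n‖) : opp n u ≤ ‖u n‖ := by
  unfold opp; split_ifs
  · positivity
  · exact h

/-- An eigenvalue in the disc whose eigenvector is larger at `n` than at `-n` is near the
approximate eigenvalue with mode number `n`. -/
lemma Regular.near_of_residual_eq_zero (h : Regular A M k) (hV : Potential V w)
    (hw : w ≤ k * M / 10 ^ 4) (hlam : ‖lam - freeEigenvalue n s‖ < 1 / 5)
    (hu : Summable fun m => ‖u m‖) (hu0 : u ≠ 0) (hr : ∀ m, residual A V lam u m = 0)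
    (hle : ‖u (-n)‖ ≤ ‖u n‖) : Near A M k n s lam := by
  have hM := h.M_pos
  have hk := h.k_pos
  have hkM : 0 < k * M := mul_pos hk hM
  have h0 := one_le_freq n
  have hy := opp_le_of_le hle
  have hy0 := opp_nonneg n u
  have h1 := h.tail_le hV hw hlam hu le_rfl fun m _ _ => by rw [hr]; simp
  have hGM : gapConst * M * ‖u n‖ ≤ k / 10 ^ 4 * ‖u n‖ :=
    mul_le_mul_of_nonneg_right h.small (norm_nonneg _)
  have hGM' : gapConst * M * opp n u ≤ gapConst * M * ‖u n‖ :=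
    mul_le_mul_of_nonneg_left hy (by have := one_le_gapConst; positivity)
  have h2 : tail n u ≤ 2 / 10 ^ 3 * k * ‖u n‖ := by linarith
  -- If u(n) vanished, the larger component at the level would vanish, hence the tail and all of
  -- `u`.
  have ha : 0 < ‖u n‖ := by
    rw [norm_pos_iff]
    intro ha
    refine hu0 (eq_zero_of_l1 hu ?_)
    rw [l1_eq n hu]
    rw [ha, norm_zero] at hy h2 ⊢
    linarith
  have hka : k * ‖u n‖ ≤ ‖u n‖ := mul_le_of_le_one_left ha.le h.k_le
  have h3 := h.norm_residual_sub_le hV hlam hu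
  rw [hr, zero_sub, norm_neg, norm_mul, l1_eq n hu] at h3
  have h4 : w * (‖u n‖ + opp n u + tail n u) ≤ k * M / 10 ^ 4 * (3 * ‖u n‖) :=
    mul_le_mul hw (by linarith) (by linarith [tail_nonneg n u]) (by positivity)
  have h5 : M * tail n u ≤ M * (2 / 10 ^ 3 * k * ‖u n‖) := mul_le_mul_of_nonneg_left h2 hM.le
  have h6 : ‖levelSymbol A lam n‖ ≤ k * M / 100 := by
    refine le_of_mul_le_mul_right ?_ ha
    have := mul_pos hkM ha
    nlinarith
  -- Being in the disc only gives distance 1/5. As the level symbol is small, (λ - λ⁰)(λ + λ⁰) is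
  -- O(M), and |λ + λ⁰| ≥ 9ω/5 improves the distance to O(M/ω), as the expansion around the center
  -- requires.
  have h7 : ‖lam - freeEigenvalue n s‖ ≤ 3 * M / freq n := by
    have h8 : (lam - freeEigenvalue n s) * (lam + freeEigenvalue n s)
        = levelSymbol A lam n - lam / (lam + 1) * strength A n := by
      rw [← sq_add_eq, levelSymbol]; ring
    have h9 : ‖lam - freeEigenvalue n s‖ * ‖lam + freeEigenvalue n s‖ ≤ 5 * M := by
      rw [← norm_mul, h8]
      refine (norm_sub_le _ _).trans ?_
      rw [norm_mul]
      have := mul_le_mul (norm_ratio_le hlam) (h.norm_strength_le n) (norm_nonneg _) (by norm_num)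
      nlinarith [h.k_le]
    have h10 := mul_le_mul_of_nonneg_left (le_norm_add_freeEigenvalue hlam)
      (norm_nonneg (lam - freeEigenvalue n s))
    rw [le_div_iff₀ (by linarith)]
    nlinarith
  have h8 := h.norm_levelSymbol_sub_le hlam h7
  have h9 : ‖2 * freeEigenvalue n s * (lam - center A n s)‖ ≤ k * M / 8 := by
    have := norm_sub_le (levelSymbol A lam n)
      (levelSymbol A lam n - 2 * freeEigenvalue n s * (lam - center A n s))
    rw [sub_sub_cancel] at this
    have h11 : M ^ 2 ≤ k * M / 10 ^ 4 := by nlinarith [h.M_le]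
    linarith
  rw [norm_mul, norm_mul, freeEigenvalue_norm, Complex.norm_ofNat] at h9
  unfold Near
  rw [le_div_iff₀ (by positivity)]
  linarith

lemma Regular.near_or_near_neg (h : Regular A M k) (hV : Potential V w)
    (hw : w ≤ k * M / 10 ^ 4) (hlam : ‖lam - freeEigenvalue n s‖ < 1 / 5)
    (hu : Summable fun m => ‖u m‖) (hu0 : u ≠ 0) (hr : ∀ m, residual A V lam u m = 0) :
    Near A M k n s lam ∨ Near A M k (-n) s lam := by
  rcases le_total ‖u (-n)‖ ‖u n‖ with h1 | h1
  · exact Or.inl (h.near_of_residual_eq_zero hV hw hlam hu hu0 hr h1)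
  · refine Or.inr (h.near_of_residual_eq_zero hV hw ?_ hu hu0 hr (by rwa [neg_neg]))
    rwa [freeEigenvalue_neg]

lemma center_eq (A : ℤ → Fin 2 → ℝ) (n : ℤ) (s : Fin 2) :
    center A n s = freeEigenvalue n s - (strength A n / 2 : ℝ) * (freeEigenvalue n s + 1)⁻¹ := by
  have h0 := freeEigenvalue_ne_zero n s
  have h1 : freeEigenvalue n s + 1 ≠ 0 := add_one_ne_zero_of_mem (n := n) (s := s) (by simp)
  unfold center; push_cast
  field_simp

/-- The shift of |Im| is proportional to the strength, so the component with the stronger coupling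
has the larger |Im|. -/
lemma sign_mul_center_im (A : ℤ → Fin 2 → ℝ) (n : ℤ) (s : Fin 2) :
    (-1 : ℝ) ^ (s : ℕ) * (center A n s).im
      = freq n + strength A n / 2 * (freq n / (1 + freq n ^ 2)) := by
  have h1 : (freeEigenvalue n s + 1)⁻¹.im
      = -((-1 : ℝ) ^ (s : ℕ) * freq n) / (1 + freq n ^ 2) := by
    rw [Complex.inv_im, Complex.normSq_apply]
    simp only [Complex.add_im, Complex.one_im, Complex.add_re, Complex.one_re,
      freeEigenvalue_im, freeEigenvalue_re, add_zero, zero_add, one_mul]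
    congr 2
    linear_combination freq n ^ 2 * sign_sq s
  rw [center_eq, Complex.sub_im, Complex.im_ofReal_mul, h1, freeEigenvalue_im]
  linear_combination (freq n + strength A n / 2 * (freq n / (1 + freq n ^ 2))) * sign_sq s

lemma sign_mul_im_eq_abs (h : ‖lam - freeEigenvalue n s‖ < 1 / 5) :
    (-1 : ℝ) ^ (s : ℕ) * lam.im = |lam.im| := by
  have h1 : |(-1 : ℝ) ^ (s : ℕ) * lam.im| = |lam.im| := by rw [abs_mul, abs_sign, one_mul]
  rw [← h1, abs_of_nonneg]
  have h2 := Complex.abs_im_le_norm (lam - freeEigenvalue n s)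
  have h3 : (-1 : ℝ) ^ (s : ℕ) * lam.im
      = freq n + (-1 : ℝ) ^ (s : ℕ) * (lam - freeEigenvalue n s).im := by
    rw [Complex.sub_im, freeEigenvalue_im]
    linear_combination freq n * sign_sq s
  have h4 : |(-1 : ℝ) ^ (s : ℕ) * (lam - freeEigenvalue n s).im| ≤ 1 / 5 := by
    rw [abs_mul, abs_sign, one_mul]; linarith
  rw [h3]
  linarith [one_le_freq n, (abs_le.mp h4).1]

lemma Near.abs_im_bound (hlam : Near A M k n s lam) (h : Regular A M k) :
    |(|lam.im| - (freq n + strength A n / 2 * (freq n / (1 + freq n ^ 2))))|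
      ≤ k * M / (16 * freq n) := by
  rw [← sign_mul_im_eq_abs (hlam.mem_disc h), ← sign_mul_center_im A n s, ← mul_sub, abs_mul,
    abs_sign, one_mul, ← Complex.sub_im]
  exact (Complex.abs_im_le_norm _).trans hlam

/-- Of the two eigenvalues at a level, the one with positive mode number has the larger `|Im|`. -/
lemma Near.abs_im_lt {mu : ℂ} (hmu : Near A M k (-n) s mu) (hlam : Near A M k n s lam)
    (h : Regular A M k) (hn : 0 < n) : |mu.im| < |lam.im| := by
  have h0 := one_le_freq n
  have hkM : 0 < k * M := mul_pos h.k_pos h.M_pos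
  have h1 := (abs_le.mp (hmu.abs_im_bound h)).2
  have h2 := (abs_le.mp (hlam.abs_im_bound h)).1
  rw [freq_neg] at h1
  have h3 := h.gap n hn
  -- The centers are at least kM/(2ω) apart in |Im|, whereas the two radii add up to kM/(8ω).
  have h4 : 1 / (2 * freq n) ≤ freq n / (1 + freq n ^ 2) := by
    rw [div_le_div_iff₀ (by positivity) (by positivity)]; nlinarith
  have h5 : k * M * (1 / (2 * freq n)) ≤
      (strength A n - strength A (-n)) / 2 * (freq n / (1 + freq n ^ 2)) :=
    mul_le_mul (by linarith) h4 (by positivity) (by linarith)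
  have h6 : k * M / (16 * freq n) = k * M * (1 / (2 * freq n)) / 8 := by
    field_simp; ring
  have h7 : 0 < k * M * (1 / (2 * freq n)) := by positivity
  rw [h6] at h1 h2
  linarith

/-- `∑ₘ u(m) u'(m)`. -/
noncomputable def bilin (u u' : ℤ → ℂ) : ℂ := ∑' m, u m * u' m

lemma norm_apply_le_l1 (hu : Summable fun m => ‖u m‖) (m : ℤ) : ‖u m‖ ≤ l1 u :=
  hu.le_tsum m fun _ _ => norm_nonneg _

lemma Potential.summable_potApply_mul (hV : Potential V w) (hu : Summable fun m => ‖u m‖)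
    (hu' : Summable fun m => ‖u' m‖) : Summable fun m => potApply V u m * u' m :=
  summable_mul_of_bounded (hV.norm_potApply_le hu) hu'

lemma Potential.tsum_potApply_comm (hV : Potential V w) (hu : Summable fun m => ‖u m‖)
    (hu' : Summable fun m => ‖u' m‖) :
    ∑' m, potApply V u m * u' m = ∑' m, potApply V u' m * u m := by
  have h1 : Summable (Function.uncurry fun m l : ℤ => (V m l : ℂ) * u l * u' m) := by
    have h2 := hu'.mul_of_nonneg hu (fun _ => norm_nonneg _) (fun _ => norm_nonneg _)
    refine Summable.of_norm_bounded (h2.mul_left w) fun p => ?_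
    simp only [Function.uncurry, norm_mul]
    have := mul_le_mul_of_nonneg_right (hV.norm_le p.1 p.2)
      (mul_nonneg (norm_nonneg (u' p.1)) (norm_nonneg (u p.2)))
    linarith
  simp only [potApply, ← tsum_mul_right]
  rw [← h1.tsum_comm]
  refine tsum_congr fun m => tsum_congr fun l => ?_
  rw [hV.symm l m]; ring

lemma potApply_sub (hV : Potential V w) (hV' : Potential V' w') (hu : Summable fun m => ‖u m‖)
    (m : ℤ) : potApply (fun m l => V m l - V' m l) u m = potApply V u m - potApply V' u m := by
  unfold potApply
  rw [← (summable_mul_of_bounded (hV.norm_le m) hu).tsum_sub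
    (summable_mul_of_bounded (hV'.norm_le m) hu)]
  refine tsum_congr fun l => ?_
  push_cast; ring

/-- The reduced eigenvalue equation, except perhaps for its `n`-th row, with `u(n) = 1`. -/
structure Solves (A : ℤ → Fin 2 → ℝ) (V : ℤ → ℤ → ℝ) (n : ℤ) (lam : ℂ) (u : ℤ → ℂ) : Prop where
  summable : Summable fun m => ‖u m‖
  apply_self : u n = 1
  eq_zero : ∀ m, m ≠ n → residual A V lam u m = 0

/-- The difference quotient in λ of the reduced problem, tested against `u` and `u'`. At equal
arguments it is the normalization ⟨f, e⟩ of the eigenprojection. -/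
noncomputable def denom (A : ℤ → Fin 2 → ℝ) (lam lam' : ℂ) (u u' : ℤ → ℂ) : ℂ :=
  (lam + lam') * bilin u u'
    + (lam + 1)⁻¹ * (lam' + 1)⁻¹ * ∑ i, coupled A u i * coupled A u' i

lemma Regular.tsum_sum_coupled (h : Regular A M k) (hu : Summable fun m => ‖u m‖)
    (hu' : Summable fun m => ‖u' m‖) :
    HasSum (fun m => (∑ i, (A m i : ℂ) * coupled A u i) * u' m)
      (∑ i, coupled A u i * coupled A u' i) := by
  have h1 : Summable fun m => (∑ i, (A m i : ℂ) * coupled A u i) * u' m :=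
    summable_mul_of_bounded (h.norm_sum_coupled_le hu) hu'
  have h2 := h.sum_mul_coupled hu' (coupled A u)
  rw [h2]
  simpa only [mul_comm (coupled A u _)] using h1.hasSum

/-- The exact difference of the `n`-th rows for two solutions. -/
lemma Solves.residual_sub (hu : Solves A V n lam u) (hu' : Solves A V' n lam' u')
    (h : Regular A M k) (hV : Potential V w) (hV' : Potential V' w')
    (hlam : lam + 1 ≠ 0) (hlam' : lam' + 1 ≠ 0) :
    residual A V lam u n - residual A V' lam' u' n = (lam - lam') * denom A lam lam' u u'
      + ∑' m, potApply (fun m l => V m l - V' m l) u m * u' m := by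
  -- Test each residual with the other solution and subtract. The rows other than the n-th vanish
  -- and u(n) = u'(n) = 1, so only the n-th rows survive; by symmetry, what remains of the other
  -- terms is the change in λ and V.
  have e1 : HasSum (fun m => residual A V lam u m * u' m - residual A V' lam' u' m * u m)
      (residual A V lam u n - residual A V' lam' u' n) := by
    have := hasSum_single (f := fun m => residual A V lam u m * u' m
      - residual A V' lam' u' m * u m) n fun m hm => by
        rw [hu.eq_zero m hm, hu'.eq_zero m hm]; ring
    simpa [hu.apply_self, hu'.apply_self] using this
  have s1 : HasSum (fun m => u m * u' m) (bilin u u') :=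
    (summable_mul_of_bounded (norm_apply_le_l1 hu.summable) hu'.summable).hasSum
  have s2 := h.tsum_sum_coupled hu.summable hu'.summable
  have s3 := h.tsum_sum_coupled hu'.summable hu.summable
  have s4 := (hV.summable_potApply_mul hu.summable hu'.summable).hasSum
  have s5 := (hV'.summable_potApply_mul hu'.summable hu.summable).hasSum
  have s6 := (hV'.summable_potApply_mul hu.summable hu'.summable).hasSum
  rw [← hV'.tsum_potApply_comm hu.summable hu'.summable] at s5
  have e2 := (((s1.mul_left (lam ^ 2 - lam' ^ 2)).add (s2.mul_left (lam / (lam + 1)))).sub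
    (s3.mul_left (lam' / (lam' + 1)))).add (s4.sub s5)
  have e3 := e1.unique (e2.congr_fun fun m => by unfold residual; ring)
  simp only [potApply_sub hV hV' hu.summable, sub_mul]
  rw [e3, (s4.summable.tsum_sub s6.summable), denom]
  simp only [mul_comm (coupled A u' _)]
  linear_combination (∑ i, coupled A u i * coupled A u' i) * ratio_sub hlam hlam'

lemma l1_sub_apply (n : ℤ) (hu : Summable fun m => ‖u m‖) :
    (Summable fun m => if m = n then 0 else ‖u m‖) ∧
      ∑' m, (if m = n then 0 else ‖u m‖) = opp n u + tail n u := by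
  have h2 : Summable fun m => if m = n then 0 else ‖u m‖ :=
    Summable.of_nonneg_of_le (fun m => by split_ifs <;> positivity)
      (fun m => by split_ifs <;> simp) hu
  refine ⟨h2, ?_⟩
  have h1 := hu.tsum_eq_add_tsum_ite n
  have h3 := l1_eq n hu
  unfold l1 at h3
  linarith

lemma Solves.off_le (hu : Solves A V n lam u) (h : Regular A M k) (hV : Potential V w)
    (hw : w ≤ k * M / 10 ^ 4) (hlam : Near A M k n s lam) : opp n u + tail n u ≤ 1 / 4 := by
  have := hlam.apriori h hV hw hu.summable le_rfl fun m hm => by rw [hu.eq_zero m hm]; simp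
  simpa [hu.apply_self] using this

lemma Solves.l1_le (hu : Solves A V n lam u) (h : Regular A M k) (hV : Potential V w)
    (hw : w ≤ k * M / 10 ^ 4) (hlam : Near A M k n s lam) : l1 u ≤ 5 / 4 := by
  have := hu.off_le h hV hw hlam
  rw [l1_eq n hu.summable, hu.apply_self, norm_one]; linarith

/-- `bilin` has no complex conjugation and could vanish in general. Here the n-th term is 1, and the
others contribute at most the product of two off-diagonal masses 1/4. -/
lemma norm_bilin_sub_one_le (hu : Summable fun m => ‖u m‖) (hu' : Summable fun m => ‖u' m‖)
    (h1 : u n = 1) (h1' : u' n = 1) (ho : opp n u + tail n u ≤ 1 / 4)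
    (ho' : opp n u' + tail n u' ≤ 1 / 4) : ‖bilin u u' - 1‖ ≤ 1 / 16 := by
  have hs : Summable fun m => u m * u' m :=
    summable_mul_of_bounded (norm_apply_le_l1 hu) hu'
  obtain ⟨a1, a2⟩ := l1_sub_apply n hu
  obtain ⟨b1, b2⟩ := l1_sub_apply n hu'
  have h2 : bilin u u' - 1 = ∑' m, if m = n then 0 else u m * u' m := by
    unfold bilin
    rw [hs.tsum_eq_add_tsum_ite n, h1, h1']; ring
  rw [h2]
  have h3 : ∀ m, ‖(if m = n then 0 else u m * u' m)‖ ≤ 1 / 4 * (if m = n then 0 else ‖u' m‖) := by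
    intro m
    split_ifs with hm
    · simp
    · rw [norm_mul]
      refine mul_le_mul_of_nonneg_right ?_ (norm_nonneg _)
      have := a1.le_tsum m fun j _ => by split_ifs <;> positivity
      rw [a2, if_neg hm] at this
      linarith
  refine (tsum_of_norm_bounded (b1.mul_left (1 / 4)).hasSum h3).trans ?_
  rw [tsum_mul_left, b2]; linarith

/-- The term 2λ⁰·(`bilin` - 1) is at most ω/8 and the remaining ones are small constants. Closeness
to the imaginary number 2λ⁰ is stronger than a lower bound for the modulus; the real part estimate
needs it. -/
lemma norm_denom_sub_le (h : Regular A M k) (hlam : Near A M k n s lam)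
    (hlam' : Near A M k n s lam') (hu : Summable fun m => ‖u m‖) (hu' : Summable fun m => ‖u' m‖)
    (h1 : u n = 1) (h1' : u' n = 1) (ho : opp n u + tail n u ≤ 1 / 4)
    (ho' : opp n u' + tail n u' ≤ 1 / 4) :
    ‖denom A lam lam' u u' - 2 * freeEigenvalue n s‖ ≤ freq n := by
  have h0 := one_le_freq n
  have hM := h.M_pos
  have hM' := h.M_le'
  have hb := norm_bilin_sub_one_le hu hu' h1 h1' ho ho'
  have hd : ∀ {mu : ℂ}, Near A M k n s mu → ‖mu - freeEigenvalue n s‖ ≤ 1 / 100 := by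
    intro mu hmu
    have h2 : 2 * M / freq n ≤ 2 * M := div_le_self (by linarith) h0
    linarith [hmu.dist_le h]
  have hinv : ∀ {mu : ℂ}, Near A M k n s mu → ‖(mu + 1)⁻¹‖ ≤ 5 / 4 := by
    intro mu hmu
    have h2 : 5 / 4 / freq n ≤ 5 / 4 := div_le_self (by linarith) h0
    linarith [norm_inv_add_one_le (hmu.mem_disc h)]
  have hl : l1 u ≤ 5 / 4 := by rw [l1_eq n hu, h1, norm_one]; linarith
  have hl' : l1 u' ≤ 5 / 4 := by rw [l1_eq n hu', h1', norm_one]; linarith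
  have hS : ‖∑ i, coupled A u i * coupled A u' i‖ ≤ 2 * M * (5 / 4) * (5 / 4) :=
    (h.norm_coupled_dot_le hu hu').trans
      (mul_le_mul (mul_le_mul_of_nonneg_left hl (by linarith)) hl' (l1_nonneg _) (by linarith))
  have e : denom A lam lam' u u' - 2 * freeEigenvalue n s =
      ((lam - freeEigenvalue n s) + (lam' - freeEigenvalue n s)) * bilin u u'
      + 2 * freeEigenvalue n s * (bilin u u' - 1)
      + (lam + 1)⁻¹ * (lam' + 1)⁻¹ * ∑ i, coupled A u i * coupled A u' i := by
    unfold denom; ring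
  have hb' : ‖bilin u u'‖ ≤ 17 / 16 := by
    have := norm_add_le (bilin u u' - 1) 1
    rw [sub_add_cancel, norm_one] at this; linarith
  have t1 : ‖((lam - freeEigenvalue n s) + (lam' - freeEigenvalue n s)) * bilin u u'‖
      ≤ 1 / 50 * (17 / 16) := by
    rw [norm_mul]
    refine mul_le_mul ?_ hb' (norm_nonneg _) (by norm_num)
    linarith [norm_add_le (lam - freeEigenvalue n s) (lam' - freeEigenvalue n s), hd hlam, hd hlam']
  have t2 : ‖2 * freeEigenvalue n s * (bilin u u' - 1)‖ ≤ 2 * freq n * (1 / 16) := by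
    rw [norm_mul, norm_mul, freeEigenvalue_norm, Complex.norm_ofNat]
    exact mul_le_mul_of_nonneg_left hb (by linarith)
  have t3 : ‖(lam + 1)⁻¹ * (lam' + 1)⁻¹ * ∑ i, coupled A u i * coupled A u' i‖
      ≤ 5 / 4 * (5 / 4) * (2 * M * (5 / 4) * (5 / 4)) := by
    rw [norm_mul, norm_mul]
    exact mul_le_mul (mul_le_mul (hinv hlam) (hinv hlam') (norm_nonneg _) (by norm_num)) hS
      (norm_nonneg _) (by norm_num)
  rw [e]
  refine (norm_add₃_le).trans ?_
  linarith

lemma freq_le_norm_denom (h : Regular A M k) (hlam : Near A M k n s lam)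
    (hlam' : Near A M k n s lam') (hu : Summable fun m => ‖u m‖) (hu' : Summable fun m => ‖u' m‖)
    (h1 : u n = 1) (h1' : u' n = 1) (ho : opp n u + tail n u ≤ 1 / 4)
    (ho' : opp n u' + tail n u' ≤ 1 / 4) : freq n ≤ ‖denom A lam lam' u u'‖ := by
  have h2 := norm_denom_sub_le h hlam hlam' hu hu' h1 h1' ho ho'
  have h3 : ‖2 * freeEigenvalue n s‖ = 2 * freq n := by
    rw [norm_mul, freeEigenvalue_norm, Complex.norm_ofNat]
  have h4 := norm_sub_norm_le (2 * freeEigenvalue n s) (denom A lam lam' u u')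
  rw [norm_sub_rev] at h4
  linarith

end

/-! ### Existence of the eigenvalue by Lyapunov–Schmidt reduction. -/

section

variable {A : ℤ → Fin 2 → ℝ} {V V' : ℤ → ℤ → ℝ} {M k w w' W : ℝ} {n : ℤ} {s : Fin 2} {lam lam' : ℂ}
  {u u' : ℤ → ℂ}

/-- The matrix of the reduced equation without its diagonal `lam² + m² + 1`. -/
noncomputable def coeffMatrix (A : ℤ → Fin 2 → ℝ) (V : ℤ → ℤ → ℝ) (lam : ℂ) (m l : ℤ) : ℂ :=
  lam / (lam + 1) * ∑ i, (A m i : ℂ) * (A l i : ℂ) + V m l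

lemma norm_coeffMatrix_le (h : Regular A M k) (hV : Potential V w) (hw : w ≤ k * M / 10 ^ 4)
    (hlam : ‖lam - freeEigenvalue n s‖ < 1 / 5) (m l : ℤ) : ‖coeffMatrix A V lam m l‖ ≤ 5 * M := by
  have hw' : w ≤ M / 2 := by nlinarith [h.k_le, h.M_pos]
  refine (norm_add_le _ _).trans ?_
  rw [norm_mul]
  have h1 := mul_le_mul (norm_ratio_le hlam) (h.norm_dot_le m l) (norm_nonneg _) (by norm_num)
  linarith [hV.norm_le m l]

lemma residual_eq (h : Regular A M k) (hV : Potential V w) (hu : Summable fun m => ‖u m‖) (m : ℤ) :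
    residual A V lam u m =
      (lam ^ 2 + (m : ℂ) ^ 2 + 1) * u m + ∑' l, coeffMatrix A V lam m l * u l := by
  have s1 := (summable_mul_of_bounded (h.norm_dot_le m) hu).mul_left (lam / (lam + 1))
  have s2 := summable_mul_of_bounded (hV.norm_le m) hu
  have : ∀ l, coeffMatrix A V lam m l * u l = lam / (lam + 1) *
      ((∑ i, (A m i : ℂ) * (A l i : ℂ)) * u l) + V m l * u l := fun l => by
    unfold coeffMatrix; ring
  simp only [this]
  rw [s1.tsum_add s2, tsum_mul_left, ← h.sum_mul_coupled hu, ← add_assoc]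
  rfl

/-- For `lam` near the approximate eigenvalue, all rows but the `n`-th can be solved. -/
lemma Near.exists_solves (hlam : Near A M k n s lam) (h : Regular A M k) (hV : Potential V w)
    (hw : w ≤ k * M / 10 ^ 4) : ∃ u, Solves A V n lam u := by
  have hM := h.M_pos
  have hk := h.k_pos
  have hkM : 0 < k * M := mul_pos hk hM
  have hd := hlam.mem_disc h
  have hG := one_le_gapConst
  have hk1 : 1 ≤ 1 / k := by rw [le_div_iff₀ hk]; linarith [h.k_le]
  -- The diagonal coupling at -n is moved into the diagonal: there λ² + m² + 1 may be too small to
  -- invert, but the level symbol is not.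
  let corr : ℤ → ℂ := fun m => if m = -n then lam / (lam + 1) * strength A m else 0
  let d : ℤ → ℂ := fun m => lam ^ 2 + (m : ℂ) ^ 2 + 1 + corr m
  let K : ℤ → ℤ → ℂ := fun m l => coeffMatrix A V lam m l - if l = m then corr m else 0
  -- Bounds for row -n after division by a symbol of size at least kM/3: on the diagonal only the
  -- potential is left, elsewhere the bound is 5M·3/(kM) = 15/k, which is not small.
  let c : ℤ → ℝ := fun l => if l = -n then 3 * w / (k * M) else 15 / k
  have hw0 := hV.nonneg
  have hc0 : ∀ l, 0 ≤ c l := fun l => by simp only [c]; split_ifs <;> positivity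
  have hdm : ∀ m, m ≠ n → d m ≠ 0 ∧ ∀ l,
      ‖(d m)⁻¹ * K m l‖ ≤ gapInv n m * (5 * M) + if m = -n then c l else 0 := by
    intro m hm
    by_cases hm' : m = -n
    · have hn : n ≠ 0 := by rintro rfl; simp at hm'; exact hm hm'
      have hdl : d m = levelSymbol A lam (-n) := by
        simp only [d, corr, hm', if_true, levelSymbol]
      have hdn := hlam.le_norm_levelSymbol_neg h hn
      have hd0 : d m ≠ 0 := by
        rw [hdl, ← norm_pos_iff]; linarith
      refine ⟨hd0, fun l => ?_⟩
      have hg : gapInv n m = 0 := by simp [gapInv, hm']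
      rw [hg, zero_mul, zero_add, if_pos hm', norm_mul, norm_inv, hdl]
      have h1 : ‖levelSymbol A lam (-n)‖⁻¹ ≤ 3 / (k * M) := by
        rw [inv_le_comm₀ (by linarith) (by positivity), inv_div]; exact hdn
      by_cases hl : l = -n
      · have h2 : ‖K m l‖ ≤ w := by
          have : K m l = V m l := by
            simp only [K, corr, hl, hm', if_true, coeffMatrix, strength]
            push_cast; ring
          rw [this]; exact hV.norm_le m l
        simp only [c, hl, if_true]
        rw [mul_div_right_comm]
        rw [hl] at h2
        exact mul_le_mul h1 h2 (norm_nonneg _) (by positivity)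
      · have h2 : ‖K m l‖ ≤ 5 * M := by
          have : K m l = coeffMatrix A V lam m l := by
            simp only [K, hm', hl, if_false, sub_zero]
          rw [this]; exact norm_coeffMatrix_le h hV hw hd m l
        simp only [c, hl, if_false]
        refine (mul_le_mul h1 h2 (norm_nonneg _) (by positivity)).trans (le_of_eq ?_)
        field_simp; norm_num
    · have hdl : d m = lam ^ 2 + (m : ℂ) ^ 2 + 1 := by
        simp only [d, corr, hm', if_false, add_zero]
      refine ⟨by rw [hdl]; exact sq_add_ne_zero hd hm hm', fun l => ?_⟩
      have hK : K m l = coeffMatrix A V lam m l := by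
        simp only [K, corr, hm', if_false, ite_self, sub_zero]
      rw [if_neg hm', add_zero, norm_mul, hK, hdl]
      exact mul_le_mul (norm_inv_le_gapInv hd hm hm') (norm_coeffMatrix_le h hV hw hd m l)
        (norm_nonneg _) (gapInv_nonneg n m)
  -- The weight 60/k of the other columns compensates the entries 15/k of row -n. The rows off the
  -- level pay this weight, but they carry the factor `gapConst`·M ≤ k/10⁴.
  let Wt : ℤ → ℝ := fun m => if m = -n then 1 else 60 / k
  -- Row n is left out, and column n goes to the inhomogeneity `y` because u(n) is prescribed to be
  -- 1.
  let G : ℤ → ℤ → ℂ := fun m l => if m = n ∨ l = n then 0 else -((d m)⁻¹ * K m l)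
  have hL : 1 ≤ 60 / k := by rw [le_div_iff₀ hk]; linarith [h.k_le]
  have hWt : ∀ m, 1 ≤ Wt m ∧ Wt m ≤ 60 / k := fun m => by
    simp only [Wt]; split_ifs
    · exact ⟨le_rfl, hL⟩
    · exact ⟨hL, le_rfl⟩
  -- Since 3/0 = 0, `gapInv n` vanishes at ±n, and the conditional alone accounts for row -n.
  have hmaj : ∀ C : ℝ, HasSum (fun m => gapInv n m * (60 / k * (5 * M)) + if m = -n then C else 0)
      ((∑' m, gapInv n m) * (60 / k * (5 * M)) + C) := fun C =>
    ((summable_gapInv n).hasSum.mul_right _).add (hasSum_ite_eq (-n) C)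
  have hWG : ∀ l m, Wt m * ‖G m l‖
      ≤ gapInv n m * (60 / k * (5 * M)) + if m = -n then c l else 0 := by
    intro l m
    by_cases hml : m = n ∨ l = n
    · simp only [G, hml, if_true, norm_zero, mul_zero]
      have h1 := gapInv_nonneg n m
      have h2 := hc0 l
      split_ifs <;> positivity
    · have hm : m ≠ n := fun h => hml (Or.inl h)
      simp only [G, hml, if_false, norm_neg]
      have h1 := (hdm m hm).2 l
      by_cases hm' : m = -n
      · have hg : gapInv n m = 0 := by simp [gapInv, hm']
        rw [hg, if_pos hm', zero_mul, zero_add] at h1 ⊢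
        simpa only [Wt, hm', if_true, one_mul] using h1
      · rw [if_neg hm', add_zero] at h1 ⊢
        simp only [Wt, hm', if_false]
        have h2 : 0 < 60 / k := by positivity
        nlinarith
  have hGs : ∀ l, Summable fun m => Wt m * ‖G m l‖ := fun l =>
    Summable.of_nonneg_of_le (fun m => mul_nonneg (by linarith [(hWt m).1]) (norm_nonneg _))
      (hWG l) (hmaj (c l)).summable
  have hGq : ∀ l, ∑' m, Wt m * ‖G m l‖ ≤ 1 / 2 * Wt l := by
    intro l
    have h1 := (hGs l).tsum_le_tsum (hWG l) (hmaj (c l)).summable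
    rw [(hmaj (c l)).tsum_eq] at h1
    have h2 : (∑' m, gapInv n m) * (60 / k * (5 * M)) ≤ 3 / 100 := by
      have h3 : (∑' m, gapInv n m) * (60 / k * (5 * M)) ≤ gapConst * (60 / k * (5 * M)) :=
        mul_le_mul_of_nonneg_right (tsum_gapInv_le n) (by positivity)
      have h4 : gapConst * (60 / k * (5 * M)) = 300 / k * (gapConst * M) := by ring
      have h5 : 300 / k * (gapConst * M) ≤ 300 / k * (k / 10 ^ 4) :=
        mul_le_mul_of_nonneg_left h.small (by positivity)
      have h6 : 300 / k * (k / 10 ^ 4) = 3 / 100 := by field_simp; norm_num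
      linarith
    by_cases hl : l = -n
    · have h3 : 3 * w / (k * M) ≤ 3 / 10 ^ 4 := by
        rw [div_le_iff₀ hkM]; linarith
      simp only [c, Wt, hl, if_true] at h1 ⊢
      linarith
    · simp only [c, Wt, hl, if_false] at h1 ⊢
      have h3 : 15 / k = 15 * (1 / k) := by ring
      have h4 : 60 / k = 60 * (1 / k) := by ring
      rw [h3] at h1
      rw [h4] at h1 h2 ⊢
      linarith
  let y : ℤ → ℂ := fun m => if m = n then 0 else -((d m)⁻¹ * K m n)
  have hy : Summable fun m => ‖y m‖ := by
    refine Summable.of_nonneg_of_le (fun _ => norm_nonneg _) (fun m => ?_)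
      (((summable_gapInv n).hasSum.mul_right (5 * M)).add (hasSum_ite_eq (-n) (c n))).summable
    by_cases hm : m = n
    · simp only [y, hm, if_true, norm_zero]
      have h1 := gapInv_nonneg n n
      have h2 := hc0 n
      split_ifs <;> positivity
    · simp only [y, hm, if_false, norm_neg]
      exact (hdm m hm).2 n
  obtain ⟨x, hx, hxe⟩ := exists_weighted_neumann one_pos (fun m => (hWt m).1) (fun m => (hWt m).2)
    hGs hGq hy
  let v : ℤ → ℂ := fun m => if m = n then 1 else x m
  have hv : Summable fun m => ‖v m‖ := by
    refine Summable.of_nonneg_of_le (fun _ => norm_nonneg _) (fun m => ?_)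
      (hx.add (hasSum_ite_eq n (1 : ℝ)).summable)
    simp only [v]; split_ifs <;> simp
  refine ⟨v, hv, if_pos rfl, fun m hm => ?_⟩
  obtain ⟨hd0, -⟩ := hdm m hm
  have hvm : v m = x m := if_neg hm
  have sK : Summable fun l => coeffMatrix A V lam m l * v l :=
    summable_mul_of_bounded (norm_coeffMatrix_le h hV hw hd m) hv
  have h1 : ∑' l, coeffMatrix A V lam m l * v l = corr m * v m + ∑' l, K m l * v l := by
    have h2 : ∀ l, K m l * v l = coeffMatrix A V lam m l * v l
        - if l = m then corr m * v m else 0 := by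
      intro l
      simp only [K]
      split_ifs with hl
      · rw [hl]; ring
      · ring
    simp only [h2]
    rw [sK.tsum_sub (hasSum_ite_eq m _).summable, tsum_ite_eq]
    ring
  have sK' : Summable fun l => K m l * v l := by
    refine summable_mul_of_bounded (C := 5 * M + ‖corr m‖) (fun l => ?_) hv
    refine (norm_sub_le _ _).trans (add_le_add (norm_coeffMatrix_le h hV hw hd m l) ?_)
    split_ifs <;> simp
  have h3 : ∑' l, K m l * v l = K m n + ∑' l, if l = n then 0 else K m l * x l := by
    rw [sK'.tsum_eq_add_tsum_ite n]
    congr 1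
    · simp [v]
    · refine tsum_congr fun l => ?_
      split_ifs with hl
      · rfl
      · simp only [v, hl, if_false]
  have h4 : ∑' l, G m l * x l = -((d m)⁻¹ * ∑' l, if l = n then 0 else K m l * x l) := by
    rw [← tsum_mul_left, ← tsum_neg]
    refine tsum_congr fun l => ?_
    by_cases hl : l = n
    · simp [G, hl]
    · simp only [G, hm, hl, or_self, if_false]; ring
  have h5 := hxe m
  rw [h4] at h5
  simp only [y, hm, if_false] at h5
  rw [residual_eq h hV hv, h1, h3, hvm]
  have h6 : d m * x m = -(K m n + ∑' l, if l = n then 0 else K m l * x l) := by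
    rw [h5]; field_simp; ring
  simp only [d] at h6
  linear_combination h6

/-- Existence of the eigenvalue near the approximate eigenvalue. -/
lemma Regular.exists_eigenvalue (h : Regular A M k) (hV : Potential V w)
    (hw : w ≤ k * M / 10 ^ 4) (n : ℤ) (s : Fin 2) :
    ∃ lam u, Near A M k n s lam ∧ Solves A V n lam u ∧ residual A V lam u n = 0 := by
  have hM := h.M_pos
  have hk := h.k_pos
  have hkM : 0 < k * M := mul_pos hk hM
  have h0 := one_le_freq n
  -- Off the disc of `Near` the chosen sequence is a dummy.
  have hex : ∀ lam, ∃ u, Near A M k n s lam → Solves A V n lam u := fun lam => by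
    by_cases hl : Near A M k n s lam
    · obtain ⟨u, hu⟩ := hl.exists_solves h hV hw
      exact ⟨u, fun _ => hu⟩
    · exact ⟨0, fun h => absurd h hl⟩
  choose U hU using hex
  have hl2 : ‖2 * freeEigenvalue n s‖ = 2 * freq n := by
    rw [norm_mul, freeEigenvalue_norm, Complex.norm_ofNat]
  obtain ⟨lam, hlam, hF⟩ := exists_zero_of_approx_linear
    (F := fun lam => residual A V lam (U lam) n) (c := center A n s)
    (l := 2 * freeEigenvalue n s) (r := k * M / (16 * freq n)) (by positivity)
    (mul_ne_zero two_ne_zero (freeEigenvalue_ne_zero n s)) (by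
      intro z hz z' hz'
      rw [mem_closedBall_iff_norm] at hz hz'
      have hz1 : Near A M k n s z := hz
      have hz1' : Near A M k n s z' := hz'
      -- With equal potentials the identity says that the difference quotient of the n-th row is
      -- exactly `denom`, so no differentiability of λ ↦ `U` λ is needed.
      have e := (hU z hz).residual_sub (hU z' hz') h hV hV
        (add_one_ne_zero_of_mem (hz1.mem_disc h)) (add_one_ne_zero_of_mem (hz1'.mem_disc h))
      simp only [sub_self, potApply, Complex.ofReal_zero, zero_mul, tsum_zero, add_zero] at e
      rw [e, mul_comm (2 * freeEigenvalue n s), ← mul_sub, norm_mul, hl2, mul_comm]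
      refine mul_le_mul_of_nonneg_right ?_ (norm_nonneg _)
      have := norm_denom_sub_le h hz1 hz1' (hU z hz).summable (hU z' hz').summable
        (hU z hz).apply_self (hU z' hz').apply_self ((hU z hz).off_le h hV hw hz1)
        ((hU z' hz').off_le h hV hw hz1')
      linarith) (by
      -- At the center the n-th row is the level symbol O(M²) plus tail and potential terms, all
      -- small multiples of kM, below the admissible kM/16.
      have hc := h.near_center n s
      have hs := hU _ hc
      have h1 := h.norm_residual_sub_le hV (hc.mem_disc h) hs.summable
      have h2 := h.norm_levelSymbol_sub_le (hc.mem_disc h)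
        ((hc.dist_le h).trans (by gcongr; norm_num))
      rw [sub_self, mul_zero, sub_zero] at h2
      rw [hs.apply_self, mul_one] at h1
      have h3 := h.tail_le hV hw (hc.mem_disc h) hs.summable le_rfl fun m hm _ => by
        rw [hs.eq_zero m hm]; simp
      rw [hs.apply_self, norm_one, add_zero] at h3
      have h4 := hs.off_le h hV hw hc
      have h5 := hs.l1_le h hV hw hc
      have h6 : w * l1 (U (center A n s)) ≤ k * M / 10 ^ 4 * (5 / 4) :=
        mul_le_mul hw h5 (l1_nonneg _) (by positivity)
      have h7 := tail_nonneg n (U (center A n s))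
      have h8 : tail n (U (center A n s)) ≤ 2 / 10 ^ 3 * k := by
        have : gapConst * M * (1 + opp n (U (center A n s))) ≤ k / 10 ^ 4 * (5 / 4) :=
          mul_le_mul h.small (by linarith) (by linarith [opp_nonneg n (U (center A n s))])
            (by positivity)
        linarith
      have h9 : M * tail n (U (center A n s)) ≤ M * (2 / 10 ^ 3 * k) :=
        mul_le_mul_of_nonneg_left h8 hM.le
      have h10 : M ^ 2 ≤ k * M / 10 ^ 4 := by nlinarith [h.M_le]
      have h11 := norm_add_le (residual A V (center A n s) (U (center A n s)) n
        - levelSymbol A (center A n s) n) (levelSymbol A (center A n s) n)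
      rw [sub_add_cancel] at h11
      have h12 : 2 * freq n / 2 * (k * M / (16 * freq n)) = k * M / 16 := by field_simp
      rw [hl2, h12]
      linarith)
  rw [mem_closedBall_iff_norm] at hlam
  exact ⟨lam, U lam, hlam, hU lam hlam, hF⟩

end

/-! ### Dependence of eigenvalues, eigenvectors and real parts on the potential. -/

section

variable {A : ℤ → Fin 2 → ℝ} {V V' : ℤ → ℤ → ℝ} {M k w w' W : ℝ} {n : ℤ} {s : Fin 2} {lam lam' : ℂ}
  {u u' : ℤ → ℂ}

/-- A normalized solution of the reduced eigenvalue equation near the approximate eigenvalue. -/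
structure ReducedEigen (A : ℤ → Fin 2 → ℝ) (V : ℤ → ℤ → ℝ) (M k : ℝ) (n : ℤ) (s : Fin 2) (lam : ℂ)
    (u : ℤ → ℂ) : Prop where
  near : Near A M k n s lam
  solves : Solves A V n lam u
  eq_self : residual A V lam u n = 0

lemma ReducedEigen.eq_zero (h : ReducedEigen A V M k n s lam u) (m : ℤ) :
    residual A V lam u m = 0 := by
  by_cases hm : m = n
  · rw [hm]; exact h.eq_self
  · exact h.solves.eq_zero m hm

lemma summable_norm_sub (hu : Summable fun m => ‖u m‖) (hu' : Summable fun m => ‖u' m‖) :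
    Summable fun m => ‖u m - u' m‖ :=
  Summable.of_nonneg_of_le (fun _ => norm_nonneg _) (fun _ => norm_sub_le _ _) (hu.add hu')

lemma potApply_sub_right (hV : Potential V w) (hu : Summable fun m => ‖u m‖)
    (hu' : Summable fun m => ‖u' m‖) (m : ℤ) :
    potApply V (fun m => u m - u' m) m = potApply V u m - potApply V u' m := by
  unfold potApply
  rw [← (summable_mul_of_bounded (hV.norm_le m) hu).tsum_sub
    (summable_mul_of_bounded (hV.norm_le m) hu')]
  exact tsum_congr fun l => by ring

lemma Regular.coupled_sub (h : Regular A M k) (hu : Summable fun m => ‖u m‖)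
    (hu' : Summable fun m => ‖u' m‖) (i : Fin 2) :
    coupled A (fun m => u m - u' m) i = coupled A u i - coupled A u' i := by
  unfold coupled
  rw [← (h.summable_coupled hu i).tsum_sub (h.summable_coupled hu' i)]
  exact tsum_congr fun l => by ring

lemma Regular.residual_sub_right (h : Regular A M k) (hV : Potential V w)
    (hu : Summable fun m => ‖u m‖) (hu' : Summable fun m => ‖u' m‖) (m : ℤ) :
    residual A V lam (fun m => u m - u' m) m = residual A V lam u m - residual A V lam u' m := by
  unfold residual
  simp only [h.coupled_sub hu hu', potApply_sub_right hV hu hu', Fin.sum_univ_two]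
  ring

lemma residual_change (hV : Potential V w) (hV' : Potential V' w')
    (hu : Summable fun m => ‖u m‖) (m : ℤ) :
    residual A V lam u m = residual A V' lam' u m + (lam ^ 2 - lam' ^ 2) * u m
      + (lam / (lam + 1) - lam' / (lam' + 1)) * ∑ i, (A m i : ℂ) * coupled A u i
      + potApply (fun m l => V m l - V' m l) u m := by
  rw [potApply_sub hV hV' hu]; unfold residual; ring

lemma Potential.norm_tsum_le (hV : Potential V w) (hu : Summable fun m => ‖u m‖)
    (hu' : Summable fun m => ‖u' m‖) :
    ‖∑' m, potApply V u m * u' m‖ ≤ w * l1 u * l1 u' :=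
  norm_tsum_mul_le (hV.norm_potApply_le hu) hu'

lemma ReducedEigen.mul_denom (hu : ReducedEigen A V M k n s lam u)
    (hu' : ReducedEigen A V' M k n s lam' u') (h : Regular A M k) (hV : Potential V w)
    (hV' : Potential V' w) :
    (lam - lam') * denom A lam lam' u u'
      = -∑' m, potApply (fun m l => V m l - V' m l) u m * u' m := by
  have e := hu.solves.residual_sub hu'.solves h hV hV'
    (add_one_ne_zero_of_mem (hu.near.mem_disc h)) (add_one_ne_zero_of_mem (hu'.near.mem_disc h))
  rw [hu.eq_self, hu'.eq_self] at e
  linear_combination -e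

lemma ReducedEigen.freq_le_norm_denom (hu : ReducedEigen A V M k n s lam u)
    (hu' : ReducedEigen A V' M k n s lam' u') (h : Regular A M k) (hV : Potential V w)
    (hV' : Potential V' w) (hw : w ≤ k * M / 10 ^ 4) : freq n ≤ ‖denom A lam lam' u u'‖ :=
  ThermalRing.freq_le_norm_denom h hu.near hu'.near hu.solves.summable hu'.solves.summable
    hu.solves.apply_self hu'.solves.apply_self (hu.solves.off_le h hV hw hu.near)
    (hu'.solves.off_le h hV' hw hu'.near)

/-- The numerator in `mul_denom` is at most W·(5/4)², as both solutions have ℓ¹ norm at most 5/4,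
and the denominator is at least ω. -/
lemma ReducedEigen.eigenvalue_sub_le (hu : ReducedEigen A V M k n s lam u)
    (hu' : ReducedEigen A V' M k n s lam' u') (h : Regular A M k) (hV : Potential V w)
    (hV' : Potential V' w) (hw : w ≤ k * M / 10 ^ 4)
    (hD : Potential (fun m l => V m l - V' m l) W) : ‖lam - lam'‖ ≤ 25 / 16 * W / freq n := by
  have h0 := one_le_freq n
  have e := hu.mul_denom hu' h hV hV'
  have h1 := hu.freq_le_norm_denom hu' h hV hV' hw
  have h2 := hD.norm_tsum_le hu.solves.summable hu'.solves.summable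
  have h3 : W * l1 u * l1 u' ≤ W * (5 / 4) * (5 / 4) :=
    mul_le_mul (mul_le_mul_of_nonneg_left (hu.solves.l1_le h hV hw hu.near) hD.nonneg)
      (hu'.solves.l1_le h hV' hw hu'.near) (l1_nonneg _) (by linarith [hD.nonneg])
  rw [← norm_neg, ← e, norm_mul] at h2
  rw [le_div_iff₀ (by linarith)]
  nlinarith [norm_nonneg (lam - lam')]

/-- Lipschitz dependence of the normalized eigenvectors on the potential. -/
lemma ReducedEigen.l1_sub_le (hu : ReducedEigen A V M k n s lam u)
    (hu' : ReducedEigen A V' M k n s lam' u') (h : Regular A M k) (hV : Potential V w)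
    (hV' : Potential V' w) (hw : w ≤ k * M / 10 ^ 4)
    (hD : Potential (fun m l => V m l - V' m l) W) :
    l1 (fun m => u m - u' m) ≤ aprioriConst M k * (8 * W) := by
  have h0 := one_le_freq n
  have hW := hD.nonneg
  have hM := h.M_pos
  have hs := summable_norm_sub hu.solves.summable hu'.solves.summable
  have hl' := hu'.solves.l1_le h hV' hw hu'.near
  have hdiff := hu.eigenvalue_sub_le hu' h hV hV' hw hD
  -- The difference has vanishing n-th component, and its rows are the terms by which the equation
  -- changed. The change of λ² is O(W/ω)·O(ω) = O(W), so the bound is uniform in n.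
  have h1 := hu.near.apriori h hV hw hs (ρ := 8 * W) (by linarith) fun m hm => by
    rw [h.residual_sub_right hV hu.solves.summable hu'.solves.summable, hu.eq_zero,
      residual_change hV hV' hu'.solves.summable (lam' := lam'), hu'.eq_zero, zero_sub, norm_neg,
      zero_add]
    have t1 : ‖(lam ^ 2 - lam' ^ 2) * u' m‖ ≤ 19 / 4 * W := by
      have e : lam ^ 2 - lam' ^ 2 = (lam - lam') * (lam + lam') := by ring
      have h2 : ‖lam + lam'‖ ≤ 12 / 5 * freq n := by
        linarith [norm_add_le lam lam', norm_le_of_mem (hu.near.mem_disc h),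
          norm_le_of_mem (hu'.near.mem_disc h)]
      have h3 : ‖lam - lam'‖ * ‖lam + lam'‖ ≤ 25 / 16 * W / freq n * (12 / 5 * freq n) :=
        mul_le_mul hdiff h2 (norm_nonneg _) (by positivity)
      have h4 : 25 / 16 * W / freq n * (12 / 5 * freq n) = 15 / 4 * W := by field_simp; ring
      rw [e, norm_mul, norm_mul]
      have h5 := mul_le_mul (h3.trans_eq h4)
        ((norm_apply_le_l1 hu'.solves.summable m).trans hl') (norm_nonneg _) (by positivity)
      linarith
    have t2 : ‖(lam / (lam + 1) - lam' / (lam' + 1)) * ∑ i, (A m i : ℂ) * coupled A u' i‖ ≤ W := by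
      rw [norm_mul]
      have h2 := norm_ratio_sub_le (hu.near.mem_disc h) (hu'.near.mem_disc h)
      have h3 : 25 / 16 / freq n ^ 2 ≤ 25 / 16 := div_le_self (by norm_num) (by nlinarith)
      have h4 : 25 / 16 * W / freq n ≤ 25 / 16 * W := div_le_self (by positivity) h0
      have h5 : 25 / 16 / freq n ^ 2 * ‖lam - lam'‖ ≤ 25 / 16 * (25 / 16 * W) :=
        mul_le_mul h3 (hdiff.trans h4) (norm_nonneg _) (by norm_num)
      have h6 : ‖∑ i, (A m i : ℂ) * coupled A u' i‖ ≤ 1 / 100 := by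
        refine (h.norm_sum_coupled_le hu'.solves.summable m).trans ?_
        have := mul_le_mul h.M_le' hl' (l1_nonneg _) (by norm_num)
        linarith
      have h7 := mul_le_mul (h2.trans h5) h6 (norm_nonneg _) (by positivity)
      linarith
    have t3 : ‖potApply (fun m l => V m l - V' m l) u' m‖ ≤ 5 / 4 * W := by
      refine (hD.norm_potApply_le hu'.solves.summable m).trans ?_
      have := mul_le_mul_of_nonneg_left hl' hW
      linarith
    refine (norm_add₃_le).trans ?_
    linarith
  have e : u n - u' n = 0 := by rw [hu.solves.apply_self, hu'.solves.apply_self, sub_self]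
  rw [l1_eq n hs, e, norm_zero, zero_add]
  rw [e, norm_zero] at h1
  linarith

/-- The Lipschitz bounds with W = 0. -/
lemma ReducedEigen.unique (hu : ReducedEigen A V M k n s lam u)
    (hu' : ReducedEigen A V M k n s lam' u') (h : Regular A M k) (hV : Potential V w)
    (hw : w ≤ k * M / 10 ^ 4) : lam = lam' ∧ u = u' := by
  have hD : Potential (fun m l => V m l - V m l) 0 := ⟨fun _ _ => by simp, fun _ _ => by simp⟩
  have h1 := hu.eigenvalue_sub_le hu' h hV hV hw hD
  have h2 := hu.l1_sub_le hu' h hV hV hw hD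
  simp only [mul_zero, zero_div] at h1 h2
  refine ⟨sub_eq_zero.mp (norm_le_zero_iff.mp h1), ?_⟩
  have h3 := eq_zero_of_l1 (summable_norm_sub hu.solves.summable hu'.solves.summable) h2
  ext m
  exact sub_eq_zero.mp (congrFun h3 m)

lemma l1_conj (u : ℤ → ℂ) : l1 (fun m => conj (u m)) = l1 u := by simp [l1]

lemma summable_norm_conj (hu : Summable fun m => ‖u m‖) : Summable fun m => ‖conj (u m)‖ := by
  simpa using hu

lemma coupled_conj (A : ℤ → Fin 2 → ℝ) (u : ℤ → ℂ) (i : Fin 2) :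
    coupled A (fun m => conj (u m)) i = conj (coupled A u i) := by
  simp [coupled, Complex.conj_tsum]

lemma potApply_conj (V : ℤ → ℤ → ℝ) (u : ℤ → ℂ) (m : ℤ) :
    potApply V (fun m => conj (u m)) m = conj (potApply V u m) := by
  simp [potApply, Complex.conj_tsum]

lemma residual_conj (A : ℤ → Fin 2 → ℝ) (V : ℤ → ℤ → ℝ) (lam : ℂ) (u : ℤ → ℂ) (m : ℤ) :
    residual A V (conj lam) (fun m => conj (u m)) m = conj (residual A V lam u m) := by
  simp [residual, coupled_conj, potApply_conj]

lemma opp_conj (n : ℤ) (u : ℤ → ℂ) : opp n (fun m => conj (u m)) = opp n u := by simp [opp]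
lemma tail_conj (n : ℤ) (u : ℤ → ℂ) : tail n (fun m => conj (u m)) = tail n u := by simp [tail]

lemma Solves.conj (hu : Solves A V n lam u) :
    Solves A V n (conj lam) (fun m => conj (u m)) where
  summable := summable_norm_conj hu.summable
  apply_self := by simp [hu.apply_self]
  eq_zero m hm := by rw [residual_conj, hu.eq_zero m hm, map_zero]

/-- The real part of the eigenvalue is of second order in the inverse frequency. -/
lemma ReducedEigen.abs_re_le (hu : ReducedEigen A V M k n s lam u) (h : Regular A M k)
    (hV : Potential V w) (hw : w ≤ k * M / 10 ^ 4) : |lam.re| ≤ 1 / freq n ^ 2 := by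
  have h0 := one_le_freq n
  have hM := h.M_pos
  have hd := hu.near.mem_disc h
  have hl := hu.solves.l1_le h hV hw hu.near
  have ho := hu.solves.off_le h hV hw hu.near
  have h1 : lam + 1 ≠ 0 := add_one_ne_zero_of_mem hd
  have h1' : conj lam + 1 ≠ 0 := by
    have := (map_ne_zero (starRingEnd ℂ)).mpr h1
    simpa using this
  -- The conjugate of `u` solves the problem at λ̄. As λ is not real, `denom` must vanish: 2 Re λ ·
  -- ∑|u|² = -|λ+1|⁻² ∑ᵢ |∑ₖ A(k)ᵢ u(k)|², which is O(1/ω²).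
  have e := hu.solves.residual_sub hu.solves.conj h hV hV h1 h1'
  rw [residual_conj, hu.eq_self, map_zero] at e
  simp only [sub_self, potApply, Complex.ofReal_zero, zero_mul, tsum_zero, add_zero] at e
  have hi : lam - conj lam ≠ 0 := by
    intro hc
    have h2 : lam.im = 0 := Complex.conj_eq_iff_im.mp (sub_eq_zero.mp hc).symm
    have h3 := Complex.abs_im_le_norm (lam - freeEigenvalue n s)
    rw [Complex.sub_im, h2, freeEigenvalue_im, zero_sub, abs_neg, abs_mul, abs_sign, one_mul,
      abs_of_nonneg (by linarith)] at h3
    linarith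
  have e2 : denom A lam (conj lam) u (fun m => conj (u m)) = 0 :=
    (mul_eq_zero.mp e.symm).resolve_left hi
  unfold denom at e2
  have hb := norm_bilin_sub_one_le (n := n) hu.solves.summable
    (summable_norm_conj hu.solves.summable) hu.solves.apply_self hu.solves.conj.apply_self ho
    (by rw [opp_conj, tail_conj]; exact ho)
  have hb' : 15 / 16 ≤ ‖bilin u fun m => conj (u m)‖ := by
    have := norm_sub_norm_le (1 : ℂ) (bilin u fun m => conj (u m))
    rw [norm_sub_rev, norm_one] at this; linarith
  have h2 : ‖(lam + conj lam) * bilin u fun m => conj (u m)‖ ≤ 1 / freq n ^ 2 := by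
    rw [eq_neg_of_add_eq_zero_left e2, norm_neg, norm_mul, norm_mul]
    have h3 := norm_inv_add_one_le hd
    have h4 : ‖(conj lam + 1)⁻¹‖ = ‖(lam + 1)⁻¹‖ := by
      rw [norm_inv, norm_inv, ← Complex.norm_conj (lam + 1)]; simp
    have h5 := h.norm_coupled_dot_le hu.solves.summable (summable_norm_conj hu.solves.summable)
    rw [l1_conj] at h5
    have h6 : 2 * M * l1 u * l1 u ≤ 2 * M * (5 / 4) * (5 / 4) :=
      mul_le_mul (mul_le_mul_of_nonneg_left hl (by linarith)) hl (l1_nonneg _) (by linarith)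
    have h7 : ‖∑ i, coupled A u i * coupled A (fun m => conj (u m)) i‖ ≤ 1 / 100 := by
      linarith [h.M_le']
    rw [h4]
    have h8 := mul_le_mul (mul_le_mul h3 h3 (norm_nonneg _) (by positivity)) h7 (norm_nonneg _)
      (by positivity)
    refine h8.trans ?_
    have h9 : 5 / 4 / freq n * (5 / 4 / freq n) * (1 / 100) = 1 / 64 * (1 / freq n ^ 2) := by
      field_simp; ring
    rw [h9]
    have : 0 ≤ 1 / freq n ^ 2 := by positivity
    linarith
  rw [norm_mul, Complex.add_conj, Complex.norm_real, Real.norm_eq_abs, abs_mul, abs_two] at h2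
  nlinarith [abs_nonneg lam.re]

/-- The normalized eigenvector is real up to terms of first order in the inverse frequency. -/
lemma ReducedEigen.l1_sub_conj_le (hu : ReducedEigen A V M k n s lam u) (h : Regular A M k)
    (hV : Potential V w) (hw : w ≤ k * M / 10 ^ 4) :
    l1 (fun m => u m - conj (u m)) ≤ aprioriConst M k * (8 / freq n) := by
  have h0 := one_le_freq n
  have hM := h.M_pos
  have hd := hu.near.mem_disc h
  have hl := hu.solves.l1_le h hV hw hu.near
  have hsc := summable_norm_conj hu.solves.summable
  have hs := summable_norm_sub hu.solves.summable hsc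
  have hre := hu.abs_re_le h hV hw
  have hinv := norm_inv_add_one_le hd
  have h1 : lam + 1 ≠ 0 := add_one_ne_zero_of_mem hd
  have h1' : conj lam + 1 ≠ 0 := by
    have := (map_ne_zero (starRingEnd ℂ)).mpr h1
    simpa using this
  have hinv' : ‖(conj lam + 1)⁻¹‖ = ‖(lam + 1)⁻¹‖ := by
    rw [norm_inv, norm_inv, ← Complex.norm_conj (lam + 1)]; simp
  have hz : potApply (fun m l => V m l - V m l) (fun m => conj (u m)) = 0 := by
    ext m; simp [potApply]
  -- Apply the a priori estimate to u - ū, whose n-th component vanishes. The potential terms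
  -- cancel, λ² - λ̄² is O(ω)·O(1/ω²), and the two ratios differ by O(1/ω).
  have h2 := hu.near.apriori h hV hw hs (ρ := 8 / freq n) (by positivity) fun m hm => by
    rw [h.residual_sub_right hV hu.solves.summable hsc, hu.eq_zero,
      residual_change hV hV hsc (lam' := conj lam), residual_conj, hu.eq_zero, map_zero, zero_sub,
      norm_neg, zero_add, hz, Pi.zero_apply, add_zero]
    have t1 : ‖(lam ^ 2 - conj lam ^ 2) * conj (u m)‖ ≤ 6 / freq n := by
      have e : lam ^ 2 - conj lam ^ 2 = (lam - conj lam) * (lam + conj lam) := by ring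
      have h3 : ‖lam - conj lam‖ ≤ 12 / 5 * freq n := by
        have := norm_sub_le lam (conj lam)
        rw [Complex.norm_conj] at this
        linarith [(norm_le_of_mem hd).2]
      have h4 : ‖lam + conj lam‖ ≤ 2 * (1 / freq n ^ 2) := by
        rw [Complex.add_conj, Complex.norm_real, Real.norm_eq_abs, abs_mul, abs_two]; linarith
      rw [e, norm_mul, norm_mul, Complex.norm_conj]
      have h5 := mul_le_mul (mul_le_mul h3 h4 (norm_nonneg _) (by positivity))
        ((norm_apply_le_l1 hu.solves.summable m).trans hl) (norm_nonneg _) (by positivity)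
      refine h5.trans (le_of_eq ?_)
      field_simp; ring
    have t2 : ‖(lam / (lam + 1) - conj lam / (conj lam + 1))
        * ∑ i, (A m i : ℂ) * coupled A (fun m => conj (u m)) i‖ ≤ 2 / freq n := by
      rw [norm_mul]
      have h3 : ‖lam / (lam + 1) - conj lam / (conj lam + 1)‖ ≤ 5 / 2 / freq n := by
        have e : lam / (lam + 1) - conj lam / (conj lam + 1)
            = (conj lam + 1)⁻¹ - (lam + 1)⁻¹ := by
          rw [ratio_eq h1, ratio_eq h1']; ring
        rw [e]
        refine (norm_sub_le _ _).trans ?_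
        rw [hinv', show 5 / 2 / freq n = 5 / 4 / freq n + 5 / 4 / freq n by ring]
        linarith
      have h4 := h.norm_sum_coupled_le hsc m
      rw [l1_conj] at h4
      have h5 : ‖∑ i, (A m i : ℂ) * coupled A (fun m => conj (u m)) i‖ ≤ 4 / 5 := by
        have := mul_le_mul h.M_le' hl (l1_nonneg _) (by norm_num)
        linarith
      refine (mul_le_mul h3 h5 (norm_nonneg _) (by positivity)).trans (le_of_eq ?_)
      field_simp; ring
    refine (norm_add_le _ _).trans ?_
    rw [show 8 / freq n = 6 / freq n + 2 / freq n by ring]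
    linarith
  have e : u n - conj (u n) = 0 := by rw [hu.solves.apply_self]; simp
  rw [l1_eq n hs, e, norm_zero, zero_add]
  rw [e, norm_zero] at h2
  linarith

lemma bilin_conj (u u' : ℤ → ℂ) :
    bilin (fun m => conj (u m)) (fun m => conj (u' m)) = conj (bilin u u') := by
  simp [bilin, Complex.conj_tsum]

lemma norm_bilin_le (hu : Summable fun m => ‖u m‖) (hu' : Summable fun m => ‖u' m‖) :
    ‖bilin u u'‖ ≤ l1 u * l1 u' := norm_tsum_mul_le (norm_apply_le_l1 hu) hu'

lemma bilin_sub_bilin {v v' : ℤ → ℂ} (hu : Summable fun m => ‖u m‖)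
    (hu' : Summable fun m => ‖u' m‖) (hv : Summable fun m => ‖v m‖)
    (hv' : Summable fun m => ‖v' m‖) :
    bilin u u' - bilin v v' = bilin (fun m => u m - v m) u' + bilin v (fun m => u' m - v' m) := by
  unfold bilin
  have s := fun {a b : ℤ → ℂ} (ha : Summable fun m => ‖a m‖) (hb : Summable fun m => ‖b m‖) =>
    summable_mul_of_bounded (norm_apply_le_l1 ha) hb
  rw [← (s hu hu').tsum_sub (s hv hv'), ← (s (summable_norm_sub hu hv) hu').tsum_add
    (s hv (summable_norm_sub hu' hv'))]
  exact tsum_congr fun m => by ring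

lemma norm_bilin_sub_le {v v' : ℤ → ℂ} (hu : Summable fun m => ‖u m‖)
    (hu' : Summable fun m => ‖u' m‖) (hv : Summable fun m => ‖v m‖)
    (hv' : Summable fun m => ‖v' m‖) :
    ‖bilin u u' - bilin v v'‖
      ≤ l1 (fun m => u m - v m) * l1 u' + l1 v * l1 (fun m => u' m - v' m) := by
  rw [bilin_sub_bilin hu hu' hv hv']
  exact (norm_add_le _ _).trans (add_le_add (norm_bilin_le (summable_norm_sub hu hv) hu')
    (norm_bilin_le hv (summable_norm_sub hu' hv')))

lemma Potential.norm_tsum_sub_le {v v' : ℤ → ℂ} (hV : Potential V w)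
    (hu : Summable fun m => ‖u m‖)
    (hu' : Summable fun m => ‖u' m‖) (hv : Summable fun m => ‖v m‖)
    (hv' : Summable fun m => ‖v' m‖) :
    ‖∑' m, potApply V u m * u' m - ∑' m, potApply V v m * v' m‖
      ≤ w * l1 (fun m => u m - v m) * l1 u' + w * l1 v * l1 (fun m => u' m - v' m) := by
  have e : ∑' m, potApply V u m * u' m - ∑' m, potApply V v m * v' m
      = ∑' m, potApply V (fun m => u m - v m) m * u' m
        + ∑' m, potApply V v m * (u' m - v' m) := by
    rw [← (hV.summable_potApply_mul hu hu').tsum_sub (hV.summable_potApply_mul hv hv'),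
      ← (hV.summable_potApply_mul (summable_norm_sub hu hv) hu').tsum_add
        (hV.summable_potApply_mul hv (summable_norm_sub hu' hv'))]
    exact tsum_congr fun m => by rw [potApply_sub_right hV hu hv]; ring
  rw [e]
  exact (norm_add_le _ _).trans (add_le_add (hV.norm_tsum_le (summable_norm_sub hu hv) hu')
    (hV.norm_tsum_le hv (summable_norm_sub hu' hv')))

lemma two_mul_abs_im (z : ℂ) : 2 * |z.im| = ‖z - conj z‖ := by
  rw [Complex.sub_conj, norm_mul, Complex.norm_I, mul_one, Complex.norm_real, Real.norm_eq_abs,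
    abs_mul, abs_two]

lemma aprioriConst_nonneg (h : Regular A M k) : 0 ≤ aprioriConst M k := by
  have := h.M_pos; have := h.k_pos; have := one_le_gapConst
  unfold aprioriConst; positivity

/-- Differences of the real parts of the eigenvalues are of second order in the inverse
frequency. -/
lemma ReducedEigen.abs_re_sub_le (hu : ReducedEigen A V M k n s lam u)
    (hu' : ReducedEigen A V' M k n s lam' u') (h : Regular A M k) (hV : Potential V w)
    (hV' : Potential V' w) (hw : w ≤ k * M / 10 ^ 4)
    (hD : Potential (fun m l => V m l - V' m l) W) :
    |(lam - lam').re| ≤ (60 * aprioriConst M k + 10) * W / freq n ^ 2 := by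
  have h0 := one_le_freq n
  have hM := h.M_pos
  have hW := hD.nonneg
  have hC := aprioriConst_nonneg h
  set C := aprioriConst M k
  have hl := hu.solves.l1_le h hV hw hu.near
  have hl' := hu'.solves.l1_le h hV' hw hu'.near
  have hs := hu.solves.summable
  have hs' := hu'.solves.summable
  have hc := hu.l1_sub_conj_le h hV hw
  have hc' := hu'.l1_sub_conj_le h hV' hw
  have hE : 0 ≤ C * (8 / freq n) := by positivity
  set D := denom A lam lam' u u' with hDdef
  set X := ∑' m, potApply (fun m l => V m l - V' m l) u m * u' m with hX
  have hmul : (lam - lam') * D = -X := hu.mul_denom hu' h hV hV'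
  -- For real `u` and `u'` the number `X` would be real; its imaginary part measures their deviation
  -- from reality, which is O(1/ω).
  have hXim : |X.im| ≤ 10 * C * W / freq n := by
    have e : conj X = ∑' m, potApply (fun m l => V m l - V' m l) (fun m => conj (u m)) m
        * conj (u' m) := by
      simp only [hX, Complex.conj_tsum, map_mul, potApply_conj]
    have h1 := hD.norm_tsum_sub_le hs hs' (summable_norm_conj hs) (summable_norm_conj hs')
    rw [← hX, ← e, l1_conj, ← two_mul_abs_im] at h1
    have h2 : W * l1 (fun m => u m - conj (u m)) * l1 u' ≤ W * (C * (8 / freq n)) * (5 / 4) :=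
      mul_le_mul (mul_le_mul_of_nonneg_left hc hW) hl' (l1_nonneg _) (by positivity)
    have h3 : W * l1 u * l1 (fun m => u' m - conj (u' m)) ≤ W * (5 / 4) * (C * (8 / freq n)) :=
      mul_le_mul (mul_le_mul_of_nonneg_left hl hW) hc' (l1_nonneg _) (by positivity)
    rw [show 10 * C * W / freq n = (W * (C * (8 / freq n)) * (5 / 4)
      + W * (5 / 4) * (C * (8 / freq n))) / 2 by ring]
    linarith
  have hYim : |(bilin u u').im| ≤ 10 * C / freq n := by
    have h1 := norm_bilin_sub_le hs hs' (summable_norm_conj hs) (summable_norm_conj hs')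
    rw [bilin_conj, l1_conj, ← two_mul_abs_im] at h1
    have h2 : l1 (fun m => u m - conj (u m)) * l1 u' ≤ (C * (8 / freq n)) * (5 / 4) :=
      mul_le_mul hc hl' (l1_nonneg _) (by positivity)
    have h3 : l1 u * l1 (fun m => u' m - conj (u' m)) ≤ (5 / 4) * (C * (8 / freq n)) :=
      mul_le_mul hl hc' (l1_nonneg _) (by positivity)
    rw [show 10 * C / freq n = ((C * (8 / freq n)) * (5 / 4)
      + (5 / 4) * (C * (8 / freq n))) / 2 by ring]
    linarith
  -- The only large factor, Im(λ + λ') = O(ω), meets the imaginary part of `bilin`, which is O(1/ω).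
  have hDre : |D.re| ≤ 24 * C + 4 := by
    have e : D.re = (lam + lam').re * (bilin u u').re - (lam + lam').im * (bilin u u').im
        + ((lam + 1)⁻¹ * (lam' + 1)⁻¹ * ∑ i, coupled A u i * coupled A u' i).re := by
      rw [hDdef, denom, Complex.add_re, Complex.mul_re]
    have hf : 1 / freq n ^ 2 ≤ 1 := div_le_self zero_le_one (by nlinarith)
    have h1 : |(lam + lam').re| ≤ 2 := by
      rw [Complex.add_re]
      linarith [abs_add_le lam.re lam'.re, hu.abs_re_le h hV hw, hu'.abs_re_le h hV' hw]
    have h2 : |(bilin u u').re| ≤ 25 / 16 := by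
      refine (Complex.abs_re_le_norm _).trans ((norm_bilin_le hs hs').trans ?_)
      have := mul_le_mul hl hl' (l1_nonneg _) (by norm_num)
      linarith
    have h3 : |(lam + lam').im| ≤ 12 / 5 * freq n := by
      refine (Complex.abs_im_le_norm _).trans ?_
      linarith [norm_add_le lam lam', norm_le_of_mem (hu.near.mem_disc h),
          norm_le_of_mem (hu'.near.mem_disc h)]
    have h4 : ‖(lam + 1)⁻¹ * (lam' + 1)⁻¹ * ∑ i, coupled A u i * coupled A u' i‖ ≤ 1 / 2 := by
      rw [norm_mul, norm_mul]
      have hi : 5 / 4 / freq n ≤ 5 / 4 := div_le_self (by norm_num) h0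
      have h5 := h.norm_coupled_dot_le hs hs'
      have h6 : 2 * M * l1 u * l1 u' ≤ 2 * M * (5 / 4) * (5 / 4) :=
        mul_le_mul (mul_le_mul_of_nonneg_left hl (by linarith)) hl' (l1_nonneg _) (by linarith)
      have h7 := mul_le_mul (mul_le_mul ((norm_inv_add_one_le (hu.near.mem_disc h)).trans hi)
        ((norm_inv_add_one_le (hu'.near.mem_disc h)).trans hi) (norm_nonneg _) (by norm_num))
        (h5.trans h6) (norm_nonneg _) (by norm_num)
      linarith [h.M_le']
    have h5 := (Complex.abs_re_le_norm _).trans h4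
    have h6 : |(lam + lam').re * (bilin u u').re| ≤ 2 * (25 / 16) := by
      rw [abs_mul]; exact mul_le_mul h1 h2 (abs_nonneg _) (by norm_num)
    have h7 : |(lam + lam').im * (bilin u u').im| ≤ 24 * C := by
      rw [abs_mul]
      refine (mul_le_mul h3 hYim (abs_nonneg _) (by positivity)).trans (le_of_eq ?_)
      field_simp; ring
    rw [e]
    refine (abs_add_le _ _).trans ?_
    linarith [abs_sub ((lam + lam').re * (bilin u u').re) ((lam + lam').im * (bilin u u').im)]
  have hDim : freq n ≤ |D.im| := by
    have h1 := norm_denom_sub_le h hu.near hu'.near hs hs' hu.solves.apply_self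
      hu'.solves.apply_self (hu.solves.off_le h hV hw hu.near)
      (hu'.solves.off_le h hV' hw hu'.near)
    rw [← hDdef] at h1
    have h2 := (Complex.abs_im_le_norm _).trans h1
    have h3 : |(2 * freeEigenvalue n s).im| = 2 * freq n := by
      have : (2 * freeEigenvalue n s).im = 2 * (freeEigenvalue n s).im := by simp
      rw [this, freeEigenvalue_im, abs_mul, abs_mul, abs_sign, abs_two, one_mul,
        abs_of_nonneg (by linarith)]
    rw [Complex.sub_im] at h2
    have h4 := abs_sub_abs_le_abs_sub (2 * freeEigenvalue n s).im D.im
    rw [abs_sub_comm, h3] at h4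
    linarith
  have hΔ := hu.eigenvalue_sub_le hu' h hV hV' hw hD
  have hΔim := (Complex.abs_im_le_norm _).trans hΔ
  -- The imaginary part of (λ - λ')D = -X. Both terms on the right are O(W/ω), and division by |Im
  -- D| ≥ ω gives the second power.
  have e : (lam - lam').re * D.im = -X.im - (lam - lam').im * D.re := by
    have := congrArg Complex.im hmul
    rw [Complex.mul_im, Complex.neg_im] at this
    linarith
  have h1 : |(lam - lam').re| * freq n ≤ (60 * C + 10) * W / freq n := by
    calc |(lam - lam').re| * freq n ≤ |(lam - lam').re| * |D.im| :=
          mul_le_mul_of_nonneg_left hDim (abs_nonneg _)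
      _ = |-X.im - (lam - lam').im * D.re| := by rw [← abs_mul, e]
      _ ≤ |X.im| + |(lam - lam').im| * |D.re| := by
          refine (abs_sub _ _).trans ?_
          rw [abs_neg, abs_mul]
      _ ≤ 10 * C * W / freq n + 25 / 16 * W / freq n * (24 * C + 4) :=
          add_le_add hXim (mul_le_mul hΔim hDre (abs_nonneg _) (by positivity))
      _ = (47.5 * C + 6.25) * W / freq n := by ring
      _ ≤ (60 * C + 10) * W / freq n := by
          refine div_le_div_of_nonneg_right ?_ (by linarith)
          exact mul_le_mul_of_nonneg_right (by linarith) hW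
  rw [le_div_iff₀ (by positivity)]
  rw [le_div_iff₀ (by linarith)] at h1
  linarith

end

/-! ### Lipschitz bound for the entries of the eigenprojection. -/

section

variable {A : ℤ → Fin 2 → ℝ} {V V' : ℤ → ℤ → ℝ} {M k w w' W : ℝ} {n : ℤ} {s : Fin 2} {lam lam' : ℂ}
  {u u' : ℤ → ℂ}

lemma norm_mul_sub_mul_le {R : Type*} [NormedRing R] {x x' y y' : R} {a b c d : ℝ} (hx : ‖x'‖ ≤ a)
    (hy : ‖y‖ ≤ b) (hxx : ‖x - x'‖ ≤ c) (hyy : ‖y - y'‖ ≤ d) : ‖x * y - x' * y'‖ ≤ c * b + a * d := by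
  have e : x * y - x' * y' = (x - x') * y + x' * (y - y') := by noncomm_ring
  rw [e]
  refine (norm_add_le _ _).trans (add_le_add ((norm_mul_le _ _).trans ?_)
    ((norm_mul_le _ _).trans ?_))
  · exact mul_le_mul hxx hy (norm_nonneg _) ((norm_nonneg _).trans hxx)
  · exact mul_le_mul hx hyy (norm_nonneg _) ((norm_nonneg _).trans hx)

/-- An entry of the eigenprojection in terms of a solution of the reduced equation. -/
noncomputable def projEntry (A : ℤ → Fin 2 → ℝ) (ε : ℤ → ℂ) (lam : ℂ) (u : ℤ → ℂ) (i : Fin 2) : ℂ :=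
  (∑' m, ε m * u m) * -coupled A u i * ((lam + 1)⁻¹ * (denom A lam lam u u)⁻¹)

/-- The growth with ω comes from 2λ times the change of `bilin`. It is harmless: the difference of
the inverses carries two further factors 1/ω. -/
lemma ReducedEigen.norm_denom_sub_denom_le (hu : ReducedEigen A V M k n s lam u)
    (hu' : ReducedEigen A V' M k n s lam' u') (h : Regular A M k) (hV : Potential V w)
    (hV' : Potential V' w) (hw : w ≤ k * M / 10 ^ 4)
    (hD : Potential (fun m l => V m l - V' m l) W) :
    ‖denom A lam lam u u - denom A lam' lam' u' u'‖
      ≤ (120 * aprioriConst M k + 40) * W * freq n := by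
  have h0 := one_le_freq n
  have hW := hD.nonneg
  have hC := aprioriConst_nonneg h
  have hΔ := hu.eigenvalue_sub_le hu' h hV hV' hw hD
  have hΔu := hu.l1_sub_le hu' h hV hV' hw hD
  set C := aprioriConst M k
  have hl := hu.solves.l1_le h hV hw hu.near
  have hl' := hu'.solves.l1_le h hV' hw hu'.near
  have hs := hu.solves.summable
  have hs' := hu'.solves.summable
  have hd := hu.near.mem_disc h
  have hd' := hu'.near.mem_disc h
  have hΔ1 : ‖lam - lam'‖ ≤ 25 / 16 * W := hΔ.trans (div_le_self (by positivity) h0)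
  have hi : 5 / 4 / freq n ≤ 5 / 4 := div_le_self (by norm_num) h0
  have hp := (norm_inv_add_one_le hd).trans hi
  have hp' := (norm_inv_add_one_le hd').trans hi
  have hpp : ‖(lam + 1)⁻¹ - (lam' + 1)⁻¹‖ ≤ 3 * W := by
    have e : (lam + 1)⁻¹ - (lam' + 1)⁻¹ = -((lam - lam') * ((lam + 1)⁻¹ * (lam' + 1)⁻¹)) := by
      have h1 := add_one_ne_zero_of_mem hd
      have h2 := add_one_ne_zero_of_mem hd'
      field_simp; ring
    rw [e, norm_neg, norm_mul, norm_mul]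
    have := mul_le_mul hΔ1 (mul_le_mul hp hp' (norm_nonneg _) (by norm_num)) (by positivity)
      (by positivity)
    linarith
  have hY : ‖bilin u u‖ ≤ 25 / 16 := (norm_bilin_le hs hs).trans (by
    have := mul_le_mul hl hl (l1_nonneg _) (by norm_num); linarith)
  have hYY : ‖bilin u u - bilin u' u'‖ ≤ 20 * C * W := by
    refine (norm_bilin_sub_le hs hs hs' hs').trans ?_
    have h1 := mul_le_mul hΔu hl (l1_nonneg _) (by positivity)
    have h2 := mul_le_mul hl' hΔu (l1_nonneg _) (by positivity)
    linarith
  have hS : ∀ i, ‖coupled A u i‖ ≤ 5 / 4 := fun i => (h.norm_coupled_le hs i).trans hl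
  have hS' : ∀ i, ‖coupled A u' i‖ ≤ 5 / 4 := fun i => (h.norm_coupled_le hs' i).trans hl'
  have hSS : ∀ i, ‖coupled A u i - coupled A u' i‖ ≤ 8 * C * W := fun i => by
    rw [← h.coupled_sub hs hs']
    linarith [h.norm_coupled_le (summable_norm_sub hs hs') i]
  have hZ : ‖∑ i, coupled A u i * coupled A u i‖ ≤ 25 / 8 := by
    rw [Fin.sum_univ_two]
    refine (norm_add_le _ _).trans ?_
    rw [norm_mul, norm_mul]
    have h1 := mul_le_mul (hS 0) (hS 0) (norm_nonneg _) (by norm_num)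
    have h2 := mul_le_mul (hS 1) (hS 1) (norm_nonneg _) (by norm_num)
    linarith
  have hZZ : ‖∑ i, coupled A u i * coupled A u i - ∑ i, coupled A u' i * coupled A u' i‖
      ≤ 40 * C * W := by
    rw [← Finset.sum_sub_distrib, Fin.sum_univ_two]
    refine (norm_add_le _ _).trans ?_
    have h1 := norm_mul_sub_mul_le (hS' 0) (hS 0) (hSS 0) (hSS 0)
    have h2 := norm_mul_sub_mul_le (hS' 1) (hS 1) (hSS 1) (hSS 1)
    linarith
  have t1 : ‖(lam + lam) * bilin u u - (lam' + lam') * bilin u' u'‖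
      ≤ 25 / 8 * W * (25 / 16) + 12 / 5 * freq n * (20 * C * W) := by
    refine norm_mul_sub_mul_le ?_ hY ?_ hYY
    · linarith [norm_add_le lam' lam', norm_le_of_mem hd']
    · rw [show lam + lam - (lam' + lam') = (lam - lam') + (lam - lam') by ring]
      linarith [norm_add_le (lam - lam') (lam - lam')]
  have t2 : ‖(lam + 1)⁻¹ * (lam + 1)⁻¹ * ∑ i, coupled A u i * coupled A u i
      - (lam' + 1)⁻¹ * (lam' + 1)⁻¹ * ∑ i, coupled A u' i * coupled A u' i‖
      ≤ (3 * W * (5 / 4) + 5 / 4 * (3 * W)) * (25 / 8) + 5 / 4 * (5 / 4) * (40 * C * W) := by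
    refine norm_mul_sub_mul_le ?_ hZ (norm_mul_sub_mul_le hp' hp hpp hpp) hZZ
    rw [norm_mul]; exact mul_le_mul hp' hp' (norm_nonneg _) (by norm_num)
  have e : ∀ a b c d : ℂ, a + b - (c + d) = (a - c) + (b - d) := fun a b c d => by ring
  unfold denom
  rw [e]
  refine (norm_add_le _ _).trans ?_
  have hWf : W ≤ W * freq n := le_mul_of_one_le_right hW h0
  have hCW : 0 ≤ C * W := by positivity
  have hCWf : C * W ≤ C * W * freq n := le_mul_of_one_le_right hCW h0
  linarith

/-- Lipschitz dependence of the entries of the eigenprojection on the potential. -/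
lemma ReducedEigen.norm_projEntry_sub_le (hu : ReducedEigen A V M k n s lam u)
    (hu' : ReducedEigen A V' M k n s lam' u') (h : Regular A M k) (hV : Potential V w)
    (hV' : Potential V' w) (hw : w ≤ k * M / 10 ^ 4)
    (hD : Potential (fun m l => V m l - V' m l) W) {ε : ℤ → ℂ} (hε : ∀ m, ‖ε m‖ ≤ 1)
    (i : Fin 2) :
    ‖projEntry A ε lam u i - projEntry A ε lam' u' i‖
      ≤ (300 * aprioriConst M k + 100) * W / freq n ^ 2 := by
  have h0 := one_le_freq n
  have hW := hD.nonneg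
  have hC := aprioriConst_nonneg h
  have hΔ := hu.eigenvalue_sub_le hu' h hV hV' hw hD
  have hΔu := hu.l1_sub_le hu' h hV hV' hw hD
  have hDD := hu.norm_denom_sub_denom_le hu' h hV hV' hw hD
  have hq := hu.freq_le_norm_denom hu h hV hV hw
  have hq' := hu'.freq_le_norm_denom hu' h hV' hV' hw
  set C := aprioriConst M k
  have hl := hu.solves.l1_le h hV hw hu.near
  have hl' := hu'.solves.l1_le h hV' hw hu'.near
  have hs := hu.solves.summable
  have hs' := hu'.solves.summable
  have hd := hu.near.mem_disc h
  have hd' := hu'.near.mem_disc h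
  have hΔ1 : ‖lam - lam'‖ ≤ 25 / 16 * W := hΔ.trans (div_le_self (by positivity) h0)
  have hp := norm_inv_add_one_le hd
  have hp' := norm_inv_add_one_le hd'
  set D := denom A lam lam u u
  set D' := denom A lam' lam' u' u'
  have hD0 : D ≠ 0 := norm_pos_iff.mp (by linarith)
  have hD0' : D' ≠ 0 := norm_pos_iff.mp (by linarith)
  have hqi : ‖D⁻¹‖ ≤ 1 / freq n := by
    rw [norm_inv, inv_le_comm₀ (by linarith) (by positivity), one_div, inv_inv]; exact hq
  have hqi' : ‖D'⁻¹‖ ≤ 1 / freq n := by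
    rw [norm_inv, inv_le_comm₀ (by linarith) (by positivity), one_div, inv_inv]; exact hq'
  have hqq : ‖D⁻¹ - D'⁻¹‖ ≤ (120 * C + 40) * W / freq n := by
    have e : D⁻¹ - D'⁻¹ = -((D - D') * (D⁻¹ * D'⁻¹)) := by field_simp; ring
    rw [e, norm_neg, norm_mul, norm_mul]
    have := mul_le_mul hDD (mul_le_mul hqi hqi' (norm_nonneg _) (by positivity)) (by positivity)
      (by positivity)
    refine this.trans (le_of_eq ?_)
    field_simp
  have hpp : ‖(lam + 1)⁻¹ - (lam' + 1)⁻¹‖ ≤ 3 * W / freq n := by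
    have e : (lam + 1)⁻¹ - (lam' + 1)⁻¹ = -((lam - lam') * ((lam + 1)⁻¹ * (lam' + 1)⁻¹)) := by
      have h1 := add_one_ne_zero_of_mem hd
      have h2 := add_one_ne_zero_of_mem hd'
      field_simp; ring
    have hi : 5 / 4 / freq n ≤ 5 / 4 := div_le_self (by norm_num) h0
    rw [e, norm_neg, norm_mul, norm_mul]
    have := mul_le_mul hΔ1 (mul_le_mul (hp.trans hi) hp' (norm_nonneg _) (by norm_num))
      (by positivity) (by positivity)
    refine this.trans ?_
    rw [show 25 / 16 * W * (5 / 4 * (5 / 4 / freq n)) = (625 / 256 * W) / freq n by ring]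
    exact div_le_div_of_nonneg_right (by linarith) (by linarith)
  have hE' : ‖∑' m, ε m * u' m‖ ≤ 5 / 4 := (norm_tsum_mul_le hε hs').trans (by
    rw [one_mul]; exact hl')
  have hEE : ‖∑' m, ε m * u m - ∑' m, ε m * u' m‖ ≤ 8 * C * W := by
    rw [← (summable_mul_of_bounded hε hs).tsum_sub (summable_mul_of_bounded hε hs')]
    simp only [← mul_sub]
    refine (norm_tsum_mul_le hε (summable_norm_sub hs hs')).trans ?_
    rw [one_mul]
    exact hΔu.trans (le_of_eq (by ring))
  have hS : ‖-coupled A u i‖ ≤ 5 / 4 := by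
    rw [norm_neg]; exact (h.norm_coupled_le hs i).trans hl
  have hS' : ‖-coupled A u' i‖ ≤ 5 / 4 := by
    rw [norm_neg]; exact (h.norm_coupled_le hs' i).trans hl'
  have hSS : ‖-coupled A u i - -coupled A u' i‖ ≤ 8 * C * W := by
    rw [neg_sub_neg, norm_sub_rev, ← h.coupled_sub hs hs']
    linarith [h.norm_coupled_le (summable_norm_sub hs hs') i]
  have hmain := norm_mul_sub_mul_le (x := (∑' m, ε m * u m) * -coupled A u i)
    (x' := (∑' m, ε m * u' m) * -coupled A u' i) (y := (lam + 1)⁻¹ * D⁻¹)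
    (y' := (lam' + 1)⁻¹ * D'⁻¹)
    (a := 5 / 4 * (5 / 4)) (b := 5 / 4 / freq n * (1 / freq n))
    (by rw [norm_mul]; exact mul_le_mul hE' hS' (norm_nonneg _) (by norm_num))
    (by rw [norm_mul]; exact mul_le_mul hp hqi (norm_nonneg _) (by positivity))
    (norm_mul_sub_mul_le hE' hS hEE hSS) (norm_mul_sub_mul_le hp' hqi hpp hqq)
  unfold projEntry
  refine hmain.trans ?_
  have e : (8 * C * W * (5 / 4) + 5 / 4 * (8 * C * W)) * (5 / 4 / freq n * (1 / freq n))
      + 5 / 4 * (5 / 4) * (3 * W / freq n * (1 / freq n)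
        + 5 / 4 / freq n * ((120 * C + 40) * W / freq n))
      = (25 * C + 75 / 16 + 125 / 64 * (120 * C + 40)) * W / freq n ^ 2 := by
    field_simp; ring
  rw [e]
  refine div_le_div_of_nonneg_right (mul_le_mul_of_nonneg_right (by linarith) hW) (by positivity)

end

/-! ### The real basis adapted to the couplings, and the matrix of the potential in it. -/

section

open MeasureTheory

variable (α : Coupling) {c : ℤ → ℂ} {u : ℤ → ℂ} {lam : ℂ}

/-- The phases, times `1 / √2` for `m ≠ 0`, of a real orthonormal basis
`2 Re (phase m * expMode m)` in which the couplings at `m` and `-m` are orthogonal. -/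
noncomputable def phase (m : ℤ) : ℂ :=
  if m = 0 then 1 / 2
  else if 0 < m then Complex.exp ((α.dotSelf m).arg / 2 * Complex.I) * (√2 / 2 : ℝ)
  else -Complex.I * conj (Complex.exp ((α.dotSelf (-m)).arg / 2 * Complex.I)) * (√2 / 2 : ℝ)

lemma phase_zero : phase α 0 = 1 / 2 := by simp [phase]

/-- So the basis functions at m and -m are twice the real part and minus twice the imaginary part of
one function: a rotated cosine and sine. -/
lemma conj_phase_neg {m : ℤ} (hm : m ≠ 0) : conj (phase α (-m)) = Complex.I * phase α m := by
  unfold phase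
  rcases lt_or_gt_of_ne hm with h | h
  · have h1 : ¬ 0 < m := by omega
    have h2 : 0 < -m := by omega
    simp only [hm, h1, h2, neg_eq_zero, if_false, if_true, map_mul, Complex.conj_ofReal]
    linear_combination conj (Complex.exp ((α.dotSelf (-m)).arg / 2 * Complex.I))
      * ((√2 / 2 : ℝ) : ℂ) * Complex.I_sq
  · have h1 : ¬ 0 < -m := by omega
    simp only [hm, h1, h, neg_eq_zero, if_false, if_true, map_mul, Complex.conj_ofReal, neg_neg,
      Complex.conj_conj, map_neg, Complex.conj_I, mul_assoc]

lemma norm_exp_half_arg (z : ℂ) : ‖Complex.exp (z.arg / 2 * Complex.I)‖ = 1 := by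
  have := Complex.norm_exp_ofReal_mul_I (z.arg / 2)
  push_cast at this; exact this

lemma norm_phase {m : ℤ} (hm : m ≠ 0) : ‖phase α m‖ = √2 / 2 := by
  have h : |√2 / 2| = √2 / 2 := abs_of_nonneg (by positivity)
  unfold phase
  by_cases h1 : 0 < m <;>
    simp only [hm, h1, if_false, if_true, norm_mul, norm_exp_half_arg, Complex.norm_real,
      Real.norm_eq_abs, h, one_mul, norm_neg, Complex.norm_I, Complex.norm_conj]

lemma norm_phase_le (m : ℤ) : ‖phase α m‖ ≤ √2 / 2 := by
  by_cases hm : m = 0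
  · rw [hm, phase_zero]
    have : (1 : ℝ) ≤ √2 := Real.one_le_sqrt.mpr (by norm_num)
    norm_num; linarith
  · exact (norm_phase α hm).le

lemma conj_phase_mul {m : ℤ} (hm : m ≠ 0) : conj (phase α m) * phase α m = 1 / 2 := by
  rw [mul_comm, Complex.mul_conj, Complex.normSq_eq_norm_sq, norm_phase α hm, div_pow,
    Real.sq_sqrt (by norm_num)]
  norm_num

lemma dotSelf_eq {m : ℤ} (hm : 0 < m) :
    α.dotSelf m = 2 * ‖α.dotSelf m‖ * phase α m ^ 2 := by
  have h1 : ((√2 / 2 : ℝ) : ℂ) ^ 2 = 1 / 2 := by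
    rw [← Complex.ofReal_pow, div_pow, Real.sq_sqrt (by norm_num)]; norm_num
  have h2 : phase α m = Complex.exp ((α.dotSelf m).arg / 2 * Complex.I) * (√2 / 2 : ℝ) := by
    simp only [phase, hm.ne', hm, if_false, if_true]
  rw [h2, mul_pow, h1, ← Complex.exp_nat_mul]
  have h3 : ((2 : ℕ) : ℂ) * ((α.dotSelf m).arg / 2 * Complex.I)
      = (α.dotSelf m).arg * Complex.I := by push_cast; ring
  rw [h3]
  have := Complex.norm_mul_exp_arg_mul_I (α.dotSelf m)
  linear_combination -this

/-- Coefficients in the real basis, from Fourier coefficients. -/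
noncomputable def toRealBasis (c : ℤ → ℂ) (m : ℤ) : ℂ := conj (phase α m) * c m + phase α m * c (-m)

/-- Fourier coefficients, from coefficients in the real basis. -/
noncomputable def ofRealBasis (u : ℤ → ℂ) (m : ℤ) : ℂ := phase α m * u m + conj (phase α (-m)) * u (-m)

lemma phase_neg {m : ℤ} (hm : m ≠ 0) : phase α (-m) = -Complex.I * conj (phase α m) := by
  rw [← Complex.conj_conj (phase α (-m)), conj_phase_neg α hm, map_mul, Complex.conj_I]

lemma toRealBasis_ofRealBasis (u : ℤ → ℂ) : toRealBasis α (ofRealBasis α u) = u := by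
  ext m
  unfold toRealBasis ofRealBasis
  by_cases hm : m = 0
  · subst hm; simp only [phase_zero, neg_zero, map_div₀, map_one, map_ofNat]; ring
  · rw [neg_neg, conj_phase_neg α hm, phase_neg α hm]
    linear_combination 2 * u m * conj_phase_mul α hm

lemma ofRealBasis_toRealBasis (c : ℤ → ℂ) : ofRealBasis α (toRealBasis α c) = c := by
  ext m
  unfold toRealBasis ofRealBasis
  by_cases hm : m = 0
  · subst hm; simp only [phase_zero, neg_zero, map_div₀, map_one, map_ofNat]; ring
  · beta_reduce
    rw [neg_neg, conj_phase_neg α hm, phase_neg α hm]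
    linear_combination 2 * c m * conj_phase_mul α hm
      - (c m * conj (phase α m) * phase α m - c (-m) * phase α m ^ 2) * Complex.I_sq

lemma toRealBasis_eq_zero {x : ℤ → ℂ} (h : toRealBasis α x = 0) : x = 0 := by
  rw [← ofRealBasis_toRealBasis α x, h]; ext m; simp [ofRealBasis]

lemma norm_phase_le_one (m : ℤ) : ‖phase α m‖ ≤ 1 := by
  have h2 : √2 ≤ 2 := by rw [Real.sqrt_le_left (by norm_num)]; norm_num
  linarith [norm_phase_le α m]

lemma summable_comp_neg {c : ℤ → ℂ} (hc : Summable fun m => ‖c m‖) :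
    Summable fun m => ‖c (-m)‖ := (Equiv.neg ℤ).summable_iff.mpr hc

lemma norm_toRealBasis_le (c : ℤ → ℂ) (m : ℤ) : ‖toRealBasis α c m‖ ≤ ‖c m‖ + ‖c (-m)‖ := by
  refine (norm_add_le _ _).trans (add_le_add ?_ ?_) <;> rw [norm_mul]
  · rw [Complex.norm_conj]
    exact mul_le_of_le_one_left (norm_nonneg _) (norm_phase_le_one α m)
  · exact mul_le_of_le_one_left (norm_nonneg _) (norm_phase_le_one α m)

lemma norm_ofRealBasis_le (u : ℤ → ℂ) (m : ℤ) : ‖ofRealBasis α u m‖ ≤ ‖u m‖ + ‖u (-m)‖ := by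
  refine (norm_add_le _ _).trans (add_le_add ?_ ?_) <;> rw [norm_mul]
  · exact mul_le_of_le_one_left (norm_nonneg _) (norm_phase_le_one α m)
  · rw [Complex.norm_conj]
    exact mul_le_of_le_one_left (norm_nonneg _) (norm_phase_le_one α (-m))

lemma summable_toRealBasis (hc : Summable fun m => ‖c m‖) : Summable fun m => ‖toRealBasis α c m‖ :=
  Summable.of_nonneg_of_le (fun _ => norm_nonneg _) (norm_toRealBasis_le α c)
    (hc.add (summable_comp_neg hc))

lemma summable_ofRealBasis (hu : Summable fun m => ‖u m‖) : Summable fun m => ‖ofRealBasis α u m‖ :=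
  Summable.of_nonneg_of_le (fun _ => norm_nonneg _) (norm_ofRealBasis_le α u)
    (hu.add (summable_comp_neg hu))

/-- A bounded functional in Fourier coefficients and in the real basis. -/
lemma hasSum_toRealBasis (hc : Summable fun m => ‖c m‖) {f : ℤ → ℂ} {C : ℝ} (hf : ∀ m, ‖f m‖ ≤ C) :
    HasSum (fun m => (phase α m * f m + conj (phase α m) * f (-m)) * toRealBasis α c m)
      (∑' m, f m * c m) := by
  have hu := summable_toRealBasis α hc
  set u := toRealBasis α c
  have hcu : c = ofRealBasis α u := (ofRealBasis_toRealBasis α c).symm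
  have h1 : Summable fun m => phase α m * f m * u m := by
    refine summable_mul_of_bounded (C := 1 * C) (fun m => ?_) hu
    rw [norm_mul]
    exact mul_le_mul (norm_phase_le_one α m) (hf m) (norm_nonneg _) zero_le_one
  have h2 : Summable fun m => conj (phase α m) * f (-m) * u m := by
    refine summable_mul_of_bounded (C := 1 * C) (fun m => ?_) hu
    rw [norm_mul, Complex.norm_conj]
    exact mul_le_mul (norm_phase_le_one α m) (hf _) (norm_nonneg _) zero_le_one
  have h3 := (Equiv.neg ℤ).hasSum_iff.mpr h2.hasSum
  have e : ∑' m, f m * c m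
      = ∑' m, phase α m * f m * u m + ∑' m, conj (phase α m) * f (-m) * u m := by
    have h4 : HasSum (fun m => f m * c m) _ := (h1.hasSum.add h3).congr_fun fun m => by
      rw [hcu]
      simp only [ofRealBasis, Function.comp, Equiv.neg_apply, neg_neg]; ring
    exact h4.tsum_eq
  rw [e]
  exact (h1.hasSum.add h2.hasSum).congr_fun fun m => by ring

/-- The couplings in the real basis. -/
noncomputable def adapted (m : ℤ) (i : Fin 2) : ℝ := 2 * (conj (α.coeff m i) * phase α m).re

lemma ofReal_two_mul_re (z : ℂ) : ((2 * z.re : ℝ) : ℂ) = z + conj z := by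
  rw [Complex.add_conj]

lemma adapted_eq (m : ℤ) (i : Fin 2) :
    (adapted α m i : ℂ) = phase α m * conj (α.coeff m i) + conj (phase α m) * α.coeff m i := by
  rw [adapted, ofReal_two_mul_re, map_mul, Complex.conj_conj]; ring

lemma adapted_neg {m : ℤ} (hm : m ≠ 0) (i : Fin 2) :
    adapted α (-m) i = -2 * (conj (α.coeff m i) * phase α m).im := by
  have h1 : conj (conj (α.coeff (-m) i) * phase α (-m))
      = Complex.I * (conj (α.coeff m i) * phase α m) := by
    rw [map_mul, conj_phase_neg α hm, Complex.conj_conj, α.real]; ring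
  rw [adapted, ← Complex.conj_re, h1, Complex.I_mul_re]; ring

/-- The phase removes the argument of α̂·α̂. For zᵢ the products under the square, the adapted
couplings at m and -m are 2 Re zᵢ and -2 Im zᵢ: the imaginary part of this identity is their
orthogonality and the real part is the difference of their strengths. -/
lemma sum_sq_phase {m : ℤ} (hm : 0 < m) :
    ∑ i, (conj (α.coeff m i) * phase α m) ^ 2 = ((‖α.dotSelf m‖ / 2 : ℝ) : ℂ) := by
  have h1 : ∑ i, (conj (α.coeff m i) * phase α m) ^ 2 = conj (α.dotSelf m) * phase α m ^ 2 := by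
    simp only [Coupling.dotSelf, map_sum, map_mul, Finset.sum_mul]
    exact Finset.sum_congr rfl fun i _ => by ring
  have h2 := congrArg conj (dotSelf_eq α hm)
  simp only [map_mul, map_pow, Complex.conj_ofReal, map_ofNat] at h2
  rw [h1, h2]
  push_cast
  linear_combination (2 * (‖α.dotSelf m‖ : ℂ) * (conj (phase α m) * phase α m + 1 / 2))
    * conj_phase_mul α hm.ne'

lemma sum_adapted_mul_neg {m : ℤ} (hm : 0 < m) :
    ∑ i, adapted α m i * adapted α (-m) i = 0 := by
  have h := congrArg Complex.im (sum_sq_phase α hm)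
  simp only [adapted_neg α hm.ne']
  simp only [adapted, Fin.sum_univ_two, sq, Complex.add_im,
    Complex.ofReal_im] at h ⊢
  generalize conj (α.coeff m 0) * phase α m = z at h ⊢
  generalize conj (α.coeff m 1) * phase α m = z' at h ⊢
  simp only [Complex.mul_im] at h
  linarith

lemma strength_adapted_sub {m : ℤ} (hm : 0 < m) :
    strength (adapted α) m - strength (adapted α) (-m) = 2 * ‖α.dotSelf m‖ := by
  have h := congrArg Complex.re (sum_sq_phase α hm)
  simp only [strength, adapted_neg α hm.ne']
  simp only [adapted, Fin.sum_univ_two, sq, Complex.add_re,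
    Complex.ofReal_re] at h ⊢
  generalize conj (α.coeff m 0) * phase α m = z at h ⊢
  generalize conj (α.coeff m 1) * phase α m = z' at h ⊢
  simp only [Complex.mul_re] at h
  linarith

lemma strength_adapted_le (m : ℤ) : strength (adapted α) m ≤ 2 * α.normSq m := by
  unfold strength Coupling.normSq
  rw [Finset.mul_sum]
  refine Finset.sum_le_sum fun i _ => ?_
  have h1 : |adapted α m i| ≤ √2 * ‖α.coeff m i‖ := by
    rw [adapted, abs_mul, abs_two]
    have h2 := Complex.abs_re_le_norm (conj (α.coeff m i) * phase α m)
    rw [norm_mul, Complex.norm_conj] at h2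
    have h3 := mul_le_mul_of_nonneg_left (norm_phase_le α m) (norm_nonneg (α.coeff m i))
    linarith
  have h2 := pow_le_pow_left₀ (abs_nonneg _) h1 2
  rw [sq_abs, mul_pow, Real.sq_sqrt (by norm_num)] at h2
  linarith

/-- A real supremum over an unbounded family has the default value 0, so `supSq` is meaningful only
after this. -/
lemma Coupling.NonDegenerate.bddAbove {α : Coupling} {c₀ c₁ c₂ : ℝ}
    (h : α.NonDegenerate c₀ c₁ c₂) : BddAbove (Set.range α.normSq) := by
  have hc : 0 < c₂ := h.pos.trans h.lt
  refine ⟨c₀ / c₂, ?_⟩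
  rintro _ ⟨n, rfl⟩
  rw [le_div_iff₀ hc, mul_comm]; exact h.upper n

/-- Nondegenerate couplings of small size are regular in the adapted basis. -/
lemma Coupling.NonDegenerate.regular {α : Coupling} {c₀ c₁ c₂ κ k : ℝ}
    (h : α.NonDegenerate c₀ c₁ c₂) (hκ : 0 < κ) (hκc : κ * c₀ ≤ c₁) (hk : 0 < k) (hk1 : k ≤ 1)
    (hk2 : k ≤ κ * c₂) (hs : gapConst * α.supSq ≤ k / 10 ^ 4) :
    Regular (adapted α) α.supSq k := by
  have hc : 0 < c₂ := h.pos.trans h.lt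
  have hle : ∀ n, α.normSq n ≤ α.supSq := le_ciSup h.bddAbove
  have hst : ∀ m, strength (adapted α) m ≤ 2 * α.supSq := fun m =>
    (strength_adapted_le α m).trans (by linarith [hle m])
  have hMpos : 0 < α.supSq := by
    have h1 := h.lower 1 one_ne_zero
    have h2 := h.middle 1 one_ne_zero
    have h3 : 0 < c₂ * α.normSq 1 := by linarith [h.pos]
    exact (pos_of_mul_pos_right h3 hc.le).trans_le (hle 1)
  refine ⟨hMpos, hk, hk1, hs, fun m l => ?_, fun m hm => ?_, fun m hm => ?_⟩
  -- From 2|ab| ≤ a² + b² in each component.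
  · have h1 := hst m
    have h2 := hst l
    rw [strength, Fin.sum_univ_two] at h1 h2
    rw [Fin.sum_univ_two, abs_le]
    constructor <;>
    nlinarith [sq_nonneg (adapted α m 0 - adapted α l 0), sq_nonneg (adapted α m 1 - adapted α l 1),
      sq_nonneg (adapted α m 0 + adapted α l 0), sq_nonneg (adapted α m 1 + adapted α l 1)]
  · rcases lt_or_gt_of_ne hm with h1 | h1
    · have := sum_adapted_mul_neg α (m := -m) (by omega)
      rw [neg_neg] at this
      simpa only [mul_comm] using this
    · exact sum_adapted_mul_neg α h1
  -- The chain 2|α̂·α̂| ≥ 2c₁ ≥ 2κc₀ ≥ 2κc₂M ≥ 2kM, with M the supremum.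
  · rw [strength_adapted_sub α hm]
    have h1 := h.lower m hm.ne'
    have h2 : c₂ * α.supSq ≤ c₀ := by
      rw [mul_comm, ← le_div_iff₀ hc]
      refine ciSup_le fun n => ?_
      rw [le_div_iff₀ hc, mul_comm]; exact h.upper n
    have h3 : k * α.supSq ≤ κ * c₂ * α.supSq := mul_le_mul_of_nonneg_right hk2 hMpos.le
    have h4 : κ * (c₂ * α.supSq) ≤ κ * c₀ := mul_le_mul_of_nonneg_left h2 hκ.le
    linarith

lemma Coupling.NonDegenerate.norm_coeff_le {α : Coupling} {c₀ c₁ c₂ : ℝ}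
    (h : α.NonDegenerate c₀ c₁ c₂) (hM : α.supSq ≤ 1) (m : ℤ) (i : Fin 2) :
    ‖α.coeff m i‖ ≤ 1 := by
  have h1 : α.normSq m ≤ 1 := (le_ciSup h.bddAbove m).trans hM
  have h2 : ‖α.coeff m i‖ ^ 2 ≤ α.normSq m :=
    Finset.single_le_sum (f := fun i => ‖α.coeff m i‖ ^ 2) (fun _ _ => sq_nonneg _)
      (Finset.mem_univ i)
  exact (sq_le_one_iff₀ (norm_nonneg _)).mp (h2.trans h1)

/-- The real basis functions. -/
noncomputable def basisFun (m : ℤ) (x : Circ) : ℝ := 2 * (phase α m * expMode m x).re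

lemma conj_expMode (m : ℤ) (x : Circ) : conj (expMode m x) = expMode (-m) x := by
  simp [expMode]

lemma norm_expMode (m : ℤ) (x : Circ) : ‖expMode m x‖ = 1 / √(2 * Real.pi) := by
  rw [expMode, norm_div, fourier_apply, Circle.norm_coe, Complex.norm_real, Real.norm_eq_abs,
    abs_of_nonneg (Real.sqrt_nonneg _)]

lemma continuous_expMode (m : ℤ) : Continuous (expMode m) := by
  unfold expMode; fun_prop

lemma basisFun_eq (m : ℤ) (x : Circ) :
    (basisFun α m x : ℂ) = phase α m * expMode m x + conj (phase α m) * expMode (-m) x := by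
  rw [basisFun, ofReal_two_mul_re, map_mul, conj_expMode]

lemma continuous_basisFun (m : ℤ) : Continuous (basisFun α m) := by
  have := continuous_expMode m
  unfold basisFun
  exact continuous_const.mul (Complex.continuous_re.comp (continuous_const.mul this))

lemma one_le_sqrt_two_pi : 1 ≤ √(2 * Real.pi) := by
  rw [Real.one_le_sqrt]; linarith [Real.two_le_pi]

lemma abs_basisFun_le (m : ℤ) (x : Circ) : |basisFun α m x| ≤ √2 / √(2 * Real.pi) := by
  rw [basisFun, abs_mul, abs_two]
  have h2 := Complex.abs_re_le_norm (phase α m * expMode m x)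
  rw [norm_mul, norm_expMode] at h2
  have h3 : ‖phase α m‖ * (1 / √(2 * Real.pi)) ≤ √2 / 2 * (1 / √(2 * Real.pi)) :=
    mul_le_mul_of_nonneg_right (norm_phase_le α m) (by positivity)
  rw [show √2 / √(2 * Real.pi) = 2 * (√2 / 2 * (1 / √(2 * Real.pi))) by ring]
  linarith

lemma abs_basisFun_le_one (m : ℤ) (x : Circ) : |basisFun α m x| ≤ 1 := by
  refine (abs_basisFun_le α m x).trans ?_
  rw [div_le_one (by linarith [one_le_sqrt_two_pi])]
  exact Real.sqrt_le_sqrt (by linarith [Real.two_le_pi])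

lemma volume_circ : (volume : Measure Circ).real Set.univ = 2 * Real.pi := by
  rw [Measure.real, AddCircle.measure_univ, ENNReal.toReal_ofReal (by positivity)]

lemma integrable_circ {E : Type*} [NormedAddCommGroup E] {f : Circ → E} (hf : Continuous f) :
    Integrable f :=
  hf.integrable_of_hasCompactSupport (HasCompactSupport.of_compactSpace f)

/-- The matrix of the potential in the real basis. -/
noncomputable def potMatrix (v : C(Circ, ℝ)) (m l : ℤ) : ℝ :=
  ∫ x : Circ, basisFun α m x * (v x * basisFun α l x)

lemma integrable_potMatrix (v : C(Circ, ℝ)) (m l : ℤ) :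
    Integrable fun x : Circ => basisFun α m x * (v x * basisFun α l x) :=
  integrable_circ ((continuous_basisFun α m).mul (v.continuous.mul (continuous_basisFun α l)))

/-- The basis functions are bounded by 1/√π and the circle has length 2π, hence the factor 2. -/
lemma potential_potMatrix (v : C(Circ, ℝ)) : Potential (potMatrix α v) (2 * ‖v‖) := by
  refine ⟨fun m l => ?_, fun m l => ?_⟩
  · unfold potMatrix; congr 1; ext x; ring
  · have h1 : ∀ x : Circ, ‖basisFun α m x * (v x * basisFun α l x)‖
        ≤ √2 / √(2 * Real.pi) * (‖v‖ * (√2 / √(2 * Real.pi))) := by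
      intro x
      rw [norm_mul, norm_mul]
      exact mul_le_mul (abs_basisFun_le α m x) (mul_le_mul (v.norm_coe_le_norm x)
        (abs_basisFun_le α l x) (norm_nonneg _) (norm_nonneg _)) (by positivity) (by positivity)
    have h2 := norm_integral_le_of_norm_le_const (μ := (volume : Measure Circ))
      (Filter.Eventually.of_forall h1)
    rw [volume_circ] at h2
    refine h2.trans (le_of_eq ?_)
    have h3 : √2 * √2 = 2 := Real.mul_self_sqrt (by norm_num)
    have h4 : √(2 * Real.pi) * √(2 * Real.pi) = 2 * Real.pi := Real.mul_self_sqrt (by positivity)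
    have h5 : √(2 * Real.pi) ≠ 0 := by linarith [one_le_sqrt_two_pi]
    calc √2 / √(2 * Real.pi) * (‖v‖ * (√2 / √(2 * Real.pi))) * (2 * Real.pi)
        = (√2 * √2) / (√(2 * Real.pi) * √(2 * Real.pi)) * ‖v‖ * (2 * Real.pi) := by
          field_simp
      _ = 2 * ‖v‖ := by rw [h3, h4]; field_simp

lemma potMatrix_sub (v v' : C(Circ, ℝ)) :
    (fun m l => potMatrix α v m l - potMatrix α v' m l) = potMatrix α (v - v') := by
  ext m l
  unfold potMatrix
  rw [← integral_sub (integrable_potMatrix α v m l) (integrable_potMatrix α v' m l)]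
  congr 1; ext x
  rw [ContinuousMap.sub_apply]; ring

lemma synth_eq (hc : Summable fun m => ‖c m‖) (x : Circ) :
    HasSum (fun m => (basisFun α m x : ℂ) * toRealBasis α c m) (synth c x) := by
  have h := hasSum_toRealBasis α hc (f := fun m => expMode m x) (fun m => (norm_expMode m x).le)
  simp only [mul_comm (expMode _ x) (c _)] at h
  exact h.congr_fun fun m => by rw [basisFun_eq]

lemma pair_eq (hα : ∀ m i, ‖α.coeff m i‖ ≤ 1) (hc : Summable fun m => ‖c m‖) (i : Fin 2) :
    α.pair i c = coupled (adapted α) (toRealBasis α c) i := by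
  have h := hasSum_toRealBasis α hc (f := fun m => conj (α.coeff m i)) (C := 1) (fun m => by
    rw [Complex.norm_conj]; exact hα m i)
  unfold Coupling.pair coupled
  rw [← h.tsum_eq]
  refine tsum_congr fun m => ?_
  rw [adapted_eq, α.real, Complex.conj_conj]

/-- The expansion in the real basis is absolutely summable uniformly in x, so integral and sum can
be exchanged. -/
lemma mulPot_eq (v : C(Circ, ℝ)) (hc : Summable fun m => ‖c m‖) (m : ℤ) :
    HasSum (fun l => (∫ x : Circ, expMode (-m) x * (v x * basisFun α l x : ℝ)) * toRealBasis α c l)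
      (mulPot v c m) := by
  have hu := summable_toRealBasis α hc
  let F : ℤ → Circ → ℂ := fun l x =>
    expMode (-m) x * (v x * basisFun α l x : ℝ) * toRealBasis α c l
  have hFc : ∀ l, Continuous (F l) := fun l =>
    ((continuous_expMode (-m)).mul (Complex.continuous_ofReal.comp
      (v.continuous.mul (continuous_basisFun α l)))).mul continuous_const
  have hb : ∀ l x, ‖F l x‖ ≤ ‖v‖ * ‖toRealBasis α c l‖ := by
    intro l x
    simp only [F]
    rw [norm_mul, norm_mul, norm_expMode, Complex.norm_real, norm_mul]
    refine mul_le_mul_of_nonneg_right ?_ (norm_nonneg _)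
    have h1 : 1 / √(2 * Real.pi) ≤ 1 := div_le_self zero_le_one one_le_sqrt_two_pi
    have h2 := mul_le_mul (v.norm_coe_le_norm x) (abs_basisFun_le_one α l x) (abs_nonneg _)
      (norm_nonneg v)
    have h3 := mul_le_mul h1 h2 (by positivity) zero_le_one
    rw [Real.norm_eq_abs (basisFun α l x)]
    linarith
  have h := hasSum_integral_of_summable_integral_norm (F := F) (μ := (volume : Measure Circ))
    (fun l => integrable_circ (hFc l)) (by
      refine Summable.of_nonneg_of_le (fun l => integral_nonneg fun x => norm_nonneg _)
        (fun l => ?_) ((hu.mul_left ‖v‖).mul_right (2 * Real.pi))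
      have h1 := norm_integral_le_of_norm_le_const (μ := (volume : Measure Circ))
        (f := fun x => ‖F l x‖) (C := ‖v‖ * ‖toRealBasis α c l‖)
        (Filter.Eventually.of_forall fun x => by rw [norm_norm]; exact hb l x)
      rw [volume_circ] at h1
      exact (le_abs_self _).trans h1)
  have e : mulPot v c m = ∫ x : Circ, ∑' l, F l x := by
    unfold mulPot
    congr 1; ext x
    rw [← (synth_eq α hc x).tsum_eq, ← tsum_mul_left, ← tsum_mul_left, conj_expMode]
    refine tsum_congr fun l => ?_
    simp only [F]; push_cast; ring
  rw [e]
  exact h.congr_fun fun l => (integral_mul_const _ _).symm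

lemma toRealBasis_mulPot (v : C(Circ, ℝ)) (hc : Summable fun m => ‖c m‖) (m : ℤ) :
    toRealBasis α (mulPot v c) m = potApply (potMatrix α v) (toRealBasis α c) m := by
  have h1 := (mulPot_eq α v hc m).mul_left (conj (phase α m))
  have h2 := (mulPot_eq α v hc (-m)).mul_left (phase α m)
  rw [neg_neg] at h2
  have h3 := (h1.add h2).tsum_eq
  unfold toRealBasis at h3 ⊢
  rw [← h3]
  unfold potApply
  refine tsum_congr fun l => ?_
  have hi : ∀ j : ℤ, Integrable fun x : Circ => expMode j x * (v x * basisFun α l x : ℝ) :=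
    fun j => integrable_circ ((continuous_expMode j).mul (Complex.continuous_ofReal.comp
      (v.continuous.mul (continuous_basisFun α l))))
  have e : (potMatrix α v m l : ℂ) = conj (phase α m) *
      (∫ x : Circ, expMode (-m) x * (v x * basisFun α l x : ℝ))
      + phase α m * ∫ x : Circ, expMode m x * (v x * basisFun α l x : ℝ) := by
    rw [← integral_const_mul, ← integral_const_mul, ← integral_add ((hi _).const_mul _)
      ((hi _).const_mul _), potMatrix, ← integral_complex_ofReal]
    congr 1; ext x
    rw [Complex.ofReal_mul, basisFun_eq]; ring
  rw [e]; ring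

end

/-! ### Eigenvectors of the drift operator and of its adjoint as solutions of the reduced equation.
-/

section

open MeasureTheory

variable {α : Coupling} {v v' : C(Circ, ℝ)} {c u : ℤ → ℂ} {lam lam' : ℂ} {e f : Vec} {M k : ℝ}
  {n : ℤ} {s : Fin 2}

lemma summable_one_div_one_add_sq : Summable fun m : ℤ => 1 / (1 + (m : ℝ) ^ 2) := by
  refine Summable.of_norm_bounded_eventually summable_one_div_int_sq ?_
  filter_upwards [(Set.finite_singleton (0 : ℤ)).compl_mem_cofinite] with m hm
  have hm0 : (m : ℝ) ≠ 0 := by simpa using hm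
  rw [Real.norm_eq_abs, abs_of_nonneg (by positivity)]
  exact one_div_le_one_div_of_le (by positivity) (by linarith)

/-- Each term is at most 1/(1+m²) or at most (1+m²)‖c(m)‖². This places the form domain inside ℓ¹,
where the reduced analysis takes place. -/
lemma summable_norm_of_memH1 (h : MemH1 c) : Summable fun m => ‖c m‖ := by
  have h2 := summable_one_div_one_add_sq
  refine Summable.of_nonneg_of_le (fun _ => norm_nonneg _) (fun m => ?_) ((h.add h2).mul_left 1)
  have h3 : 0 < 1 + (m : ℝ) ^ 2 := by positivity
  rw [one_mul]
  by_cases hc : (1 + (m : ℝ) ^ 2) * ‖c m‖ ≤ 1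
  · have : ‖c m‖ ≤ 1 / (1 + (m : ℝ) ^ 2) := by rw [le_div_iff₀ h3]; linarith
    have : 0 ≤ (1 + (m : ℝ) ^ 2) * ‖c m‖ ^ 2 := by positivity
    linarith
  · push Not at hc
    have : ‖c m‖ ≤ (1 + (m : ℝ) ^ 2) * ‖c m‖ ^ 2 := by nlinarith [norm_nonneg (c m)]
    have : 0 ≤ 1 / (1 + (m : ℝ) ^ 2) := by positivity
    linarith

/-- The left-hand side of the eigenvalue equation for the `φ`-component. -/
noncomputable def fieldRow (α : Coupling) (v : C(Circ, ℝ)) (lam : ℂ) (c : ℤ → ℂ) (m : ℤ) : ℂ :=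
  (lam ^ 2 + (m : ℂ) ^ 2 + 1) * c m + lam / (lam + 1) * ∑ i, α.coeff m i * α.pair i c
    + mulPot v c m

lemma residual_toRealBasis (hα : ∀ m i, ‖α.coeff m i‖ ≤ 1) (hc : Summable fun m => ‖c m‖) (m : ℤ) :
    residual (adapted α) (potMatrix α v) lam (toRealBasis α c) m
      = toRealBasis α (fieldRow α v lam c) m := by
  rw [residual, ← toRealBasis_mulPot α v hc]
  simp only [← pair_eq α hα hc, adapted_eq, Fin.sum_univ_two]
  simp only [toRealBasis, fieldRow, Fin.sum_univ_two, α.real]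
  push_cast; ring

lemma fieldRow_eq_zero_iff (hα : ∀ m i, ‖α.coeff m i‖ ≤ 1) (hc : Summable fun m => ‖c m‖) :
    (∀ m, fieldRow α v lam c m = 0) ↔
      ∀ m, residual (adapted α) (potMatrix α v) lam (toRealBasis α c) m = 0 := by
  simp only [residual_toRealBasis hα hc]
  constructor
  · intro h m
    simp [toRealBasis, h]
  · intro h m
    exact congrFun (toRealBasis_eq_zero α (funext h)) m

/-- Solutions of the reduced equation are smooth. -/
lemma exists_decay (h : Regular (adapted α) M k) (hu : Summable fun m => ‖u m‖)
    (hr : ∀ m, residual (adapted α) (potMatrix α v) lam u m = 0) :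
    ∃ B, ∀ m : ℤ, (1 + (m : ℝ) ^ 2) * ‖ofRealBasis α u m‖ ≤ B := by
  have hb : ∃ B, ∀ m : ℤ, (1 + (m : ℝ) ^ 2) * ‖u m‖ ≤ B := by
    refine ⟨‖lam ^ 2‖ * l1 u + ‖lam / (lam + 1)‖ * (2 * M * l1 u) + 2 * ‖v‖ * l1 u, fun m => ?_⟩
    have h1 : (((1 + (m : ℝ) ^ 2 : ℝ)) : ℂ) * u m = -(lam ^ 2 * u m
        + lam / (lam + 1) * ∑ i, (adapted α m i : ℂ) * coupled (adapted α) u i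
        + potApply (potMatrix α v) u m) := by
      have := hr m
      unfold residual at this
      push_cast
      linear_combination this
    have h2 : ‖(((1 + (m : ℝ) ^ 2 : ℝ)) : ℂ)‖ = 1 + (m : ℝ) ^ 2 := by
      rw [Complex.norm_real, Real.norm_eq_abs, abs_of_pos (by positivity)]
    rw [← h2, ← norm_mul, h1, norm_neg]
    refine norm_add₃_le.trans (add_le_add (add_le_add ?_ ?_) ?_)
    · rw [norm_mul]
      exact mul_le_mul_of_nonneg_left (norm_apply_le_l1 hu m) (norm_nonneg _)
    · rw [norm_mul]
      exact mul_le_mul_of_nonneg_left (h.norm_sum_coupled_le hu m) (norm_nonneg _)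
    · exact (potential_potMatrix α v).norm_potApply_le hu m
  obtain ⟨B, hB⟩ := hb
  refine ⟨B + B, fun m => ?_⟩
  have h1 := hB m
  have h2 := hB (-m)
  push_cast at h2
  rw [neg_sq] at h2
  have h3 := mul_le_mul_of_nonneg_left (norm_ofRealBasis_le α u m)
    (by positivity : (0 : ℝ) ≤ 1 + (m : ℝ) ^ 2)
  linarith

lemma memH1_of_decay {B : ℝ} (hc : Summable fun m => ‖c m‖)
    (hB : ∀ m : ℤ, (1 + (m : ℝ) ^ 2) * ‖c m‖ ≤ B) : MemH1 c := by
  refine Summable.of_nonneg_of_le (fun m => by positivity) (fun m => ?_) (hc.mul_left B)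
  rw [sq ‖c m‖, ← mul_assoc]
  exact mul_le_mul_of_nonneg_right (hB m) (norm_nonneg _)

lemma MemH1.smul (h : MemH1 c) (a : ℂ) : MemH1 (a • c) := by
  refine (Summable.mul_left (‖a‖ ^ 2) h).congr fun m => ?_
  rw [Pi.smul_apply, norm_smul]; ring

lemma pair_smul (α : Coupling) (i : Fin 2) (a : ℂ) (c : ℤ → ℂ) :
    α.pair i (a • c) = a * α.pair i c := by
  unfold Coupling.pair
  rw [← tsum_mul_left]
  refine tsum_congr fun m => ?_
  rw [Pi.smul_apply, smul_eq_mul]; ring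

lemma Vec.smul_phi (a : ℂ) (e : Vec) : (a • e).phi = a • e.phi := rfl
lemma Vec.smul_mom (a : ℂ) (e : Vec) : (a • e).mom = a • e.mom := rfl
lemma Vec.smul_r (a : ℂ) (e : Vec) : (a • e).r = a • e.r := rfl
lemma Vec.zero_phi : (0 : Vec).phi = 0 := rfl

/-- The coefficients in the real basis of the field component of a right eigenvector. -/
noncomputable def rightCoeff (α : Coupling) (e : Vec) : ℤ → ℂ := toRealBasis α e.phi

/-- The conjugate coefficients in the real basis of the momentum component of a left eigenvector. -/
noncomputable def leftCoeff (α : Coupling) (f : Vec) (m : ℤ) : ℂ := conj (toRealBasis α f.mom m)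

structure RightReduced (α : Coupling) (v : C(Circ, ℝ)) (lam : ℂ) (e : Vec) : Prop where
  summable_phi : Summable fun m => ‖e.phi m‖
  summable : Summable fun m => ‖rightCoeff α e m‖
  ne_zero : rightCoeff α e ≠ 0
  eq_zero : ∀ m, residual (adapted α) (potMatrix α v) lam (rightCoeff α e) m = 0
  mom_eq : e.mom = lam • e.phi
  r_eq : ∀ i, e.r i = lam / (lam + 1) * α.pair i e.phi

lemma IsRightEigenvector.reduced (he : IsRightEigenvector α v lam e)
    (hα : ∀ m i, ‖α.coeff m i‖ ≤ 1) (hlam : lam + 1 ≠ 0) : RightReduced α v lam e := by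
  obtain ⟨hne, hphi, -, heq⟩ := he
  have hs := summable_norm_of_memH1 hphi
  have h1 : e.mom = lam • e.phi := congrArg Vec.phi heq
  have h2 : ∀ m : ℤ, -((m : ℂ) ^ 2 + 1) * e.phi m - mulPot v e.phi m - ∑ i, α.coeff m i * e.r i
      = lam * e.mom m := fun m => congrFun (congrArg Vec.mom heq) m
  have h3 : ∀ i, α.pair i e.mom - e.r i = lam * e.r i := fun i =>
    congrFun (congrArg Vec.r heq) i
  have h4 : ∀ i, e.r i = lam / (lam + 1) * α.pair i e.phi := fun i => by
    have := h3 i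
    rw [h1, pair_smul] at this
    field_simp
    linear_combination -this
  refine ⟨hs, summable_toRealBasis α hs, ?_, ?_, h1, h4⟩
  -- The momentum and `r` are determined by the field component, so a nonzero eigenvector has a
  -- nonzero field component.
  · intro h0
    have h5 := toRealBasis_eq_zero α h0
    refine hne ?_
    have h6 : e.r = 0 := by
      ext i
      rw [h4, h5]; simp [Coupling.pair]
    ext m
    · rw [h5]; rfl
    · rw [h1, h5, smul_zero]; rfl
    · rw [h6]; rfl
  · refine (fieldRow_eq_zero_iff hα hs).mp fun m => ?_
    have h5 := h2 m
    rw [h1, Pi.smul_apply, smul_eq_mul, Fin.sum_univ_two, h4 0, h4 1] at h5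
    unfold fieldRow
    rw [Fin.sum_univ_two]
    linear_combination -h5

lemma exists_right (h : Regular (adapted α) M k) (hα : ∀ m i, ‖α.coeff m i‖ ≤ 1)
    (hlam : lam + 1 ≠ 0) (hu : Summable fun m => ‖u m‖) (hu0 : u ≠ 0)
    (hr : ∀ m, residual (adapted α) (potMatrix α v) lam u m = 0) :
    ∃ e, IsRightEigenvector α v lam e ∧ rightCoeff α e = u := by
  obtain ⟨B, hB⟩ := exists_decay h hu hr
  have hc := summable_ofRealBasis α hu
  have hrow : ∀ m, fieldRow α v lam (ofRealBasis α u) m = 0 := by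
    rw [fieldRow_eq_zero_iff hα hc, toRealBasis_ofRealBasis]; exact hr
  have hH := memH1_of_decay hc hB
  refine ⟨⟨ofRealBasis α u, lam • ofRealBasis α u,
    fun i => lam / (lam + 1) * α.pair i (ofRealBasis α u)⟩, ⟨?_, hH, hH.smul lam, ?_⟩,
    toRealBasis_ofRealBasis α u⟩
  · intro h0
    have h1 : ofRealBasis α u = 0 := congrArg Vec.phi h0
    refine hu0 ?_
    rw [← toRealBasis_ofRealBasis α u, h1]
    ext m; simp [toRealBasis]
  · ext m
    · rfl
    · have := hrow m
      unfold fieldRow at this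
      simp only [drift, Vec.smul_mom, Pi.smul_apply, smul_eq_mul, Fin.sum_univ_two] at this ⊢
      linear_combination -this
    · simp only [drift, Vec.smul_r, Pi.smul_apply, smul_eq_mul, pair_smul]
      field_simp; ring

structure LeftReduced (α : Coupling) (v : C(Circ, ℝ)) (lam : ℂ) (f : Vec) : Prop where
  summable_mom : Summable fun m => ‖f.mom m‖
  summable : Summable fun m => ‖leftCoeff α f m‖
  ne_zero : leftCoeff α f ≠ 0
  eq_zero : ∀ m, residual (adapted α) (potMatrix α v) lam (leftCoeff α f) m = 0
  phi_eq : ∀ m, f.phi m = conj lam * f.mom m - ∑ i, α.coeff m i * f.r i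
  r_eq : ∀ i, f.r i = -α.pair i f.mom / (conj lam + 1)

lemma conj_add_one_ne_zero (hlam : lam + 1 ≠ 0) : conj lam + 1 ≠ 0 := by
  have := (map_ne_zero (starRingEnd ℂ)).mpr hlam
  simpa using this

lemma IsLeftEigenvector.reduced (hf : IsLeftEigenvector α v lam f)
    (hα : ∀ m i, ‖α.coeff m i‖ ≤ 1) (hlam : lam + 1 ≠ 0) : LeftReduced α v lam f := by
  obtain ⟨hne, -, hmom, heq⟩ := hf
  have hlam' := conj_add_one_ne_zero hlam
  have hs := summable_norm_of_memH1 hmom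
  have h1 : ∀ m : ℤ, -((m : ℂ) ^ 2 + 1) * f.mom m - mulPot v f.mom m = conj lam * f.phi m :=
    fun m => congrFun (congrArg Vec.phi heq) m
  have h2 : ∀ m, f.phi m + ∑ i, α.coeff m i * f.r i = conj lam * f.mom m :=
    fun m => congrFun (congrArg Vec.mom heq) m
  have h3 : ∀ i, -α.pair i f.mom - f.r i = conj lam * f.r i := fun i =>
    congrFun (congrArg Vec.r heq) i
  have h4 : ∀ i, f.r i = -α.pair i f.mom / (conj lam + 1) := fun i => by
    rw [eq_div_iff hlam']
    linear_combination -h3 i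
  have h5 : ∀ m, f.phi m = conj lam * f.mom m - ∑ i, α.coeff m i * f.r i := fun m => by
    linear_combination h2 m
  refine ⟨hs, summable_norm_conj (summable_toRealBasis α hs), ?_, ?_, h5, h4⟩
  · intro h0
    have h6 : f.mom = 0 := toRealBasis_eq_zero α (funext fun m => by
      have := congrFun h0 m
      simpa [leftCoeff] using this)
    have h7 : f.r = 0 := by
      ext i
      rw [h4, h6]; simp [Coupling.pair]
    refine hne ?_
    ext m
    · rw [h5, h6, h7, Vec.zero_phi]; simp
    · rw [h6]; rfl
    · rw [h7]; rfl
  · intro m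
    -- The momentum component solves the reduced equation at λ̄; as the matrices are real, its
    -- conjugate solves it at λ.
    have h6 := (fieldRow_eq_zero_iff (v := v) (lam := conj lam) hα hs).mp (fun m => by
      have h6 := h1 m
      rw [h5, Fin.sum_univ_two, h4 0, h4 1] at h6
      unfold fieldRow
      rw [Fin.sum_univ_two]
      linear_combination -h6) m
    have h7 := residual_conj (adapted α) (potMatrix α v) (conj lam) (toRealBasis α f.mom) m
    rw [h6, map_zero, Complex.conj_conj] at h7
    exact h7

lemma exists_left (h : Regular (adapted α) M k) (hα : ∀ m i, ‖α.coeff m i‖ ≤ 1)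
    (hlam : lam + 1 ≠ 0) (hu : Summable fun m => ‖u m‖) (hu0 : u ≠ 0)
    (hr : ∀ m, residual (adapted α) (potMatrix α v) lam u m = 0) :
    ∃ f, IsLeftEigenvector α v lam f ∧ leftCoeff α f = u := by
  have hlam' := conj_add_one_ne_zero hlam
  set w : ℤ → ℂ := fun m => conj (u m) with hw
  have hws := summable_norm_conj hu
  have hwr : ∀ m, residual (adapted α) (potMatrix α v) (conj lam) w m = 0 := fun m => by
    rw [hw, residual_conj, hr, map_zero]
  obtain ⟨B, hB⟩ := exists_decay h hws hwr
  have hc := summable_ofRealBasis α hws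
  have hrow : ∀ m, fieldRow α v (conj lam) (ofRealBasis α w) m = 0 := by
    rw [fieldRow_eq_zero_iff hα hc, toRealBasis_ofRealBasis]; exact hwr
  have hH := memH1_of_decay hc hB
  set c := ofRealBasis α w with hcdef
  set r : Fin 2 → ℂ := fun i => -α.pair i c / (conj lam + 1) with hrdef
  have hleft : leftCoeff α ⟨fun m => conj lam * c m - ∑ i, α.coeff m i * r i, c, r⟩ = u := by
    ext m
    simp only [leftCoeff, hcdef, toRealBasis_ofRealBasis, hw, Complex.conj_conj]
  refine ⟨⟨fun m => conj lam * c m - ∑ i, α.coeff m i * r i, c, r⟩, ⟨?_, ?_, hH, ?_⟩, hleft⟩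
  · intro h0
    have h1 : c = 0 := congrArg Vec.mom h0
    refine hu0 ?_
    rw [← hleft]
    ext m; simp [leftCoeff, toRealBasis, h1]
  -- The φ-component contains α·r, whose coefficients are only bounded; that suffices for H⁻¹
  -- because ∑ 1/(1+m²) is finite.
  · have h2 := summable_one_div_one_add_sq
    set R : ℝ := ‖conj lam‖ * l1 c + (‖r 0‖ + ‖r 1‖) with hR
    have h3 : ∀ m, ‖conj lam * c m - ∑ i, α.coeff m i * r i‖ ≤ R := by
      intro m
      refine (norm_sub_le _ _).trans (add_le_add ?_ ?_)
      · rw [norm_mul]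
        exact mul_le_mul_of_nonneg_left (norm_apply_le_l1 hc m) (norm_nonneg _)
      · rw [Fin.sum_univ_two]
        refine (norm_add_le _ _).trans (add_le_add ?_ ?_) <;> rw [norm_mul] <;>
        exact mul_le_of_le_one_left (norm_nonneg _) (hα m _)
    refine Summable.of_nonneg_of_le (fun m => by positivity) (fun m => ?_) (h2.mul_left (R ^ 2))
    rw [mul_one_div]
    exact div_le_div_of_nonneg_right (pow_le_pow_left₀ (norm_nonneg _) (h3 m) 2) (by positivity)
  · ext m
    · have := hrow m
      unfold fieldRow at this
      simp only [driftAdj, Vec.smul_phi, Pi.smul_apply, smul_eq_mul, Fin.sum_univ_two, hrdef]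
        at this ⊢
      linear_combination -this
    · simp only [driftAdj, Vec.smul_mom, Pi.smul_apply, smul_eq_mul]; ring
    · simp only [driftAdj, Vec.smul_r, Pi.smul_apply, smul_eq_mul, hrdef]
      field_simp; ring

lemma tsum_conj_mul (hf : Summable fun m => ‖f.mom m‖) (hc : Summable fun m => ‖c m‖) :
    ∑' m, conj (f.mom m) * c m = bilin (leftCoeff α f) (toRealBasis α c) := by
  have h := hasSum_toRealBasis α hc (f := fun m => conj (f.mom m)) (C := l1 f.mom) fun m => by
    rw [Complex.norm_conj]; exact norm_apply_le_l1 hf m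
  rw [← h.tsum_eq, bilin]
  refine tsum_congr fun m => ?_
  simp only [leftCoeff, toRealBasis, map_add, map_mul, Complex.conj_conj]

lemma conj_pair (hα : ∀ m i, ‖α.coeff m i‖ ≤ 1) (hf : Summable fun m => ‖f.mom m‖) (i : Fin 2) :
    conj (α.pair i f.mom) = coupled (adapted α) (leftCoeff α f) i := by
  rw [pair_eq α hα hf, ← coupled_conj]; rfl

lemma LeftReduced.conj_r (hf : LeftReduced α v lam f) (hα : ∀ m i, ‖α.coeff m i‖ ≤ 1)
    (i : Fin 2) : conj (f.r i) = -coupled (adapted α) (leftCoeff α f) i * (lam + 1)⁻¹ := by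
  rw [hf.r_eq, map_div₀, map_neg, conj_pair hα hf.summable_mom, map_add, Complex.conj_conj, map_one,
    div_eq_mul_inv]

/-- The field and momentum parts each give λ·`bilin`. The α·r contribution to f_φ combines with the
`r` part through λ/(λ+1) - 1 = -1/(λ+1), and f_r supplies the second factor 1/(λ+1). -/
lemma pairing_eq (hα : ∀ m i, ‖α.coeff m i‖ ≤ 1) (hlam : lam + 1 ≠ 0)
    (he : RightReduced α v lam e) (hf : LeftReduced α v lam f) :
    pairing f e = denom (adapted α) lam lam (leftCoeff α f) (rightCoeff α e) := by
  have hb := tsum_conj_mul (α := α) hf.summable_mom he.summable_phi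
  have s1 : Summable fun m => conj (f.mom m) * e.phi m :=
    summable_mul_of_bounded (C := l1 f.mom) (fun m => by
      rw [Complex.norm_conj]; exact norm_apply_le_l1 hf.summable_mom m) he.summable_phi
  have s2 : ∀ i, Summable fun m => conj (α.coeff m i) * e.phi m := fun i =>
    summable_mul_of_bounded (C := 1) (fun m => by
      rw [Complex.norm_conj]; exact hα m i) he.summable_phi
  have h1 : ∑' m, conj (f.phi m) * e.phi m = lam * ∑' m, conj (f.mom m) * e.phi m
      - (conj (f.r 0) * α.pair 0 e.phi + conj (f.r 1) * α.pair 1 e.phi) := by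
    refine HasSum.tsum_eq (((s1.hasSum.mul_left lam).sub (((s2 0).hasSum.mul_left (conj (f.r 0))).add
      ((s2 1).hasSum.mul_left (conj (f.r 1))))).congr_fun fun m => ?_)
    rw [hf.phi_eq, Fin.sum_univ_two]
    simp only [map_sub, map_add, map_mul, Complex.conj_conj]
    ring
  have h2 : ∑' m, conj (f.mom m) * e.mom m = lam * ∑' m, conj (f.mom m) * e.phi m := by
    rw [← tsum_mul_left]
    refine tsum_congr fun m => ?_
    rw [he.mom_eq, Pi.smul_apply, smul_eq_mul]; ring
  have hp : ∀ i, α.pair i e.phi = coupled (adapted α) (rightCoeff α e) i := fun i =>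
    pair_eq α hα he.summable_phi i
  unfold pairing denom
  rw [h1, h2, hb]
  simp only [Fin.sum_univ_two, he.r_eq, hp, hf.conj_r hα]
  rw [show toRealBasis α e.phi = rightCoeff α e from rfl]
  field_simp
  ring

end

/-! ### Identification of the modes, simplicity, and the entries of the projection. -/

section

variable {A : ℤ → Fin 2 → ℝ} {V : ℤ → ℤ → ℝ} {α : Coupling} {v v' : C(Circ, ℝ)} {c u : ℤ → ℂ}
  {lam lam' : ℂ} {e e' f f' : Vec} {M k w : ℝ} {n : ℤ} {s : Fin 2}

lemma Potential.mono {w' : ℝ} (hV : Potential V w) (h : w ≤ w') : Potential V w' :=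
  ⟨hV.symm, fun m l => (hV.bound m l).trans h⟩

lemma residual_const_mul (A : ℤ → Fin 2 → ℝ) (V : ℤ → ℤ → ℝ) (lam a : ℂ) (u : ℤ → ℂ) (m : ℤ) :
    residual A V lam (fun m => a * u m) m = a * residual A V lam u m := by
  have h1 : ∀ i, coupled A (fun m => a * u m) i = a * coupled A u i := fun i => by
    unfold coupled; rw [← tsum_mul_left]; exact tsum_congr fun l => by ring
  have h2 : potApply V (fun m => a * u m) m = a * potApply V u m := by
    unfold potApply; rw [← tsum_mul_left]; exact tsum_congr fun l => by ring
  simp only [residual, h1, h2, Fin.sum_univ_two]; ring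

/-- Normalization of a solution of the reduced equation. -/
lemma Near.exists_normalized (hlam : Near A M k n s lam) (h : Regular A M k) (hV : Potential V w)
    (hw : w ≤ k * M / 10 ^ 4) (hu : Summable fun m => ‖u m‖) (hu0 : u ≠ 0)
    (hr : ∀ m, residual A V lam u m = 0) :
    ∃ a û, a ≠ 0 ∧ ReducedEigen A V M k n s lam û ∧ u = fun m => a * û m := by
  -- With vanishing residuals the a priori estimate bounds all other components by u(n).
  have h1 : u n ≠ 0 := by
    intro h0
    have h2 := hlam.apriori h hV hw hu le_rfl fun m _ => by rw [hr]; simp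
    rw [h0, norm_zero, mul_zero, mul_zero, add_zero] at h2
    refine hu0 (eq_zero_of_l1 hu ?_)
    rw [l1_eq n hu, h0, norm_zero]; linarith
  refine ⟨u n, fun m => (u n)⁻¹ * u m, h1, ⟨hlam, ⟨?_, inv_mul_cancel₀ h1, fun m _ => ?_⟩, ?_⟩, ?_⟩
  · simpa only [norm_mul] using hu.mul_left ‖(u n)⁻¹‖
  · rw [residual_const_mul, hr, mul_zero]
  · rw [residual_const_mul, hr, mul_zero]
  · ext m; rw [mul_inv_cancel_left₀ h1]

lemma Solves.ne_zero (hu : Solves A V n lam u) : u ≠ 0 := fun h => by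
  have := hu.apply_self; rw [h] at this; simp at this

lemma IsLevelEigenvalue.near (hl : IsLevelEigenvalue α v n s lam) (h : Regular (adapted α) M k)
    (hα : ∀ m i, ‖α.coeff m i‖ ≤ 1) (hV : Potential (potMatrix α v) w) (hw : w ≤ k * M / 10 ^ 4) :
    Near (adapted α) M k n s lam ∨ Near (adapted α) M k (-n) s lam := by
  obtain ⟨⟨e, he⟩, hd⟩ := hl
  have hr := he.reduced hα (add_one_ne_zero_of_mem hd)
  exact h.near_or_near_neg hV hw hd hr.summable hr.ne_zero hr.eq_zero

lemma IsEigenvalue.exists_reduced (hl : IsEigenvalue α v lam) (hn : Near (adapted α) M k n s lam)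
    (h : Regular (adapted α) M k) (hα : ∀ m i, ‖α.coeff m i‖ ≤ 1)
    (hV : Potential (potMatrix α v) w) (hw : w ≤ k * M / 10 ^ 4) :
    ∃ û, ReducedEigen (adapted α) (potMatrix α v) M k n s lam û := by
  obtain ⟨e, he⟩ := hl
  have hr := he.reduced hα (add_one_ne_zero_of_mem (hn.mem_disc h))
  obtain ⟨-, û, -, hû, -⟩ := hn.exists_normalized h hV hw hr.summable hr.ne_zero hr.eq_zero
  exact ⟨û, hû⟩

lemma eq_of_near (hl : IsEigenvalue α v lam) (hl' : IsEigenvalue α v lam')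
    (hn : Near (adapted α) M k n s lam) (hn' : Near (adapted α) M k n s lam')
    (h : Regular (adapted α) M k) (hα : ∀ m i, ‖α.coeff m i‖ ≤ 1)
    (hV : Potential (potMatrix α v) w) (hw : w ≤ k * M / 10 ^ 4) : lam = lam' := by
  obtain ⟨û, hû⟩ := hl.exists_reduced hn h hα hV hw
  obtain ⟨û', hû'⟩ := hl'.exists_reduced hn' h hα hV hw
  exact (hû.unique hû' h hV hw).1

/-- The eigenvalue with mode number `(n, s)` is the one near the corresponding approximate
eigenvalue. -/
lemma IsModeEigenvalue.near (hl : IsModeEigenvalue α v n s lam) (h : Regular (adapted α) M k)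
    (hα : ∀ m i, ‖α.coeff m i‖ ≤ 1) (hV : Potential (potMatrix α v) w) (hw : w ≤ k * M / 10 ^ 4) :
    Near (adapted α) M k n s lam := by
  obtain ⟨hlev, hpos, hneg⟩ := hl
  rcases hlev.near h hα hV hw with h1 | h1
  · exact h1
  -- Suppose λ is near the center of -n. The companion required by the labelling is either near the
  -- center of n, and then the order of |Im| is reversed, or near that of -n, and then it equals λ,
  -- against the strict inequality.
  · rcases lt_trichotomy n 0 with hn | hn | hn
    · obtain ⟨mu, hmu, him⟩ := hneg hn
      rcases hmu.near h hα hV hw with h2 | h2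
      · have h3 : Near (adapted α) M k (-(-n)) s mu := by rwa [neg_neg]
        exact absurd him (h3.abs_im_lt h1 h (by omega)).not_gt
      · rw [eq_of_near hlev.1 hmu.1 h1 h2 h hα hV hw] at him
        exact absurd him (lt_irrefl _)
    · rw [hn, neg_zero] at h1; rwa [hn]
    · obtain ⟨mu, hmu, him⟩ := hpos hn
      rcases hmu.near h hα hV hw with h2 | h2
      · exact absurd him (h1.abs_im_lt h2 h hn).not_gt
      · rw [eq_of_near hlev.1 hmu.1 h1 h2 h hα hV hw] at him
        exact absurd him (lt_irrefl _)

lemma ReducedEigen.isLevelEigenvalue (hu : ReducedEigen (adapted α) (potMatrix α v) M k n s lam u)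
    (h : Regular (adapted α) M k) (hα : ∀ m i, ‖α.coeff m i‖ ≤ 1) :
    IsLevelEigenvalue α v n s lam := by
  have hd := hu.near.mem_disc h
  obtain ⟨e, he, -⟩ := exists_right h hα (add_one_ne_zero_of_mem hd) hu.solves.summable
    hu.solves.ne_zero hu.eq_zero
  exact ⟨⟨e, he⟩, hd⟩

lemma toRealBasis_const_mul (α : Coupling) (a : ℂ) (c : ℤ → ℂ) :
    toRealBasis α (a • c) = fun m => a * toRealBasis α c m := by
  ext m; simp only [toRealBasis, Pi.smul_apply, smul_eq_mul]; ring

lemma toRealBasis_injective (α : Coupling) : Function.Injective (toRealBasis α) :=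
  (show Function.LeftInverse (ofRealBasis α) (toRealBasis α) from ofRealBasis_toRealBasis α).injective

lemma RightReduced.eq_smul {a : ℂ} (he : RightReduced α v lam e) (he' : RightReduced α v lam e')
    (h : rightCoeff α e' = fun m => a * rightCoeff α e m) : e' = a • e := by
  have h1 : e'.phi = a • e.phi := toRealBasis_injective α (by
    rw [toRealBasis_const_mul]; exact h)
  ext m
  · rw [h1]; rfl
  · rw [he'.mom_eq, h1, Vec.smul_mom, he.mom_eq, smul_comm]
  · rw [he'.r_eq, h1, pair_smul, Vec.smul_r, Pi.smul_apply, he.r_eq, smul_eq_mul]; ring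

lemma LeftReduced.eq_smul {a : ℂ} (hf : LeftReduced α v lam f) (hf' : LeftReduced α v lam f')
    (h : leftCoeff α f' = fun m => a * leftCoeff α f m) : f' = conj a • f := by
  have h1 : f'.mom = conj a • f.mom := toRealBasis_injective α (by
    rw [toRealBasis_const_mul]
    ext m
    have := congrArg conj (congrFun h m)
    simpa only [leftCoeff, map_mul, Complex.conj_conj] using this)
  have h2 : ∀ i, f'.r i = conj a * f.r i := fun i => by
    rw [hf'.r_eq, h1, pair_smul, hf.r_eq]; ring
  ext m
  · rw [hf'.phi_eq, h1, Vec.smul_phi, Pi.smul_apply, Pi.smul_apply, hf.phi_eq]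
    simp only [h2, Fin.sum_univ_two, smul_eq_mul]; ring
  · rw [h1]; rfl
  · rw [h2]; rfl

/-- Left and right eigenvectors both reduce to multiples of the unique normalized solution, which
makes both eigenspaces lines; their pairing is a multiple of `denom`, hence nonzero. -/
lemma ReducedEigen.isSimpleEigenvalue
    (hu : ReducedEigen (adapted α) (potMatrix α v) M k n s lam u)
    (h : Regular (adapted α) M k) (hα : ∀ m i, ‖α.coeff m i‖ ≤ 1)
    (hV : Potential (potMatrix α v) w) (hw : w ≤ k * M / 10 ^ 4) :
    IsSimpleEigenvalue α v lam := by
  have hlam := add_one_ne_zero_of_mem (hu.near.mem_disc h)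
  obtain ⟨e, he, heu⟩ := exists_right h hα hlam hu.solves.summable hu.solves.ne_zero hu.eq_zero
  obtain ⟨f, hf, hfu⟩ := exists_left h hα hlam hu.solves.summable hu.solves.ne_zero hu.eq_zero
  have he1 := he.reduced hα hlam
  have hf1 := hf.reduced hα hlam
  refine ⟨e, f, he, hf, ?_, fun e' he' => ?_, fun f' hf' => ?_⟩
  · rw [pairing_eq hα hlam he1 hf1, heu, hfu, ← norm_pos_iff]
    linarith [hu.freq_le_norm_denom hu h hV hV hw, one_le_freq n]
  · have he2 := he'.reduced hα hlam
    obtain ⟨a, û, -, hû, hua⟩ := hu.near.exists_normalized h hV hw he2.summable he2.ne_zero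
      he2.eq_zero
    refine ⟨a, he1.eq_smul he2 ?_⟩
    rw [hua, heu, (hu.unique hû h hV hw).2]
  · have hf2 := hf'.reduced hα hlam
    obtain ⟨a, û, -, hû, hua⟩ := hu.near.exists_normalized h hV hw hf2.summable hf2.ne_zero
      hf2.eq_zero
    refine ⟨conj a, hf1.eq_smul hf2 ?_⟩
    rw [hua, hfu, (hu.unique hû h hV hw).2]

lemma exists_modeEigenvalue (h : Regular (adapted α) M k) (hα : ∀ m i, ‖α.coeff m i‖ ≤ 1)
    (hV : Potential (potMatrix α v) w) (hw : w ≤ k * M / 10 ^ 4) (n : ℤ) (s : Fin 2) :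
    ∃ lam, IsModeEigenvalue α v n s lam ∧ IsSimpleEigenvalue α v lam := by
  obtain ⟨lam, u, h1, h2, h3⟩ := h.exists_eigenvalue hV hw n s
  obtain ⟨mu, u', h1', h2', h3'⟩ := h.exists_eigenvalue hV hw (-n) s
  have hu : ReducedEigen (adapted α) (potMatrix α v) M k n s lam u := ⟨h1, h2, h3⟩
  have hu' : ReducedEigen (adapted α) (potMatrix α v) M k (-n) s mu u' := ⟨h1', h2', h3'⟩
  have hmu : IsLevelEigenvalue α v n s mu := by
    have := hu'.isLevelEigenvalue h hα
    exact ⟨this.1, by rw [← freeEigenvalue_neg]; exact this.2⟩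
  refine ⟨lam, ⟨hu.isLevelEigenvalue h hα, fun hn => ⟨mu, hmu, h1'.abs_im_lt h1 h hn⟩,
    fun hn => ⟨mu, hmu, ?_⟩⟩, hu.isSimpleEigenvalue h hα hV hw⟩
  have h4 : Near (adapted α) M k (-(-n)) s lam := by rwa [neg_neg]
  exact h4.abs_im_lt h1' h (by omega)

/-- The entries of the eigenprojection in terms of the normalized reduced eigenvector. -/
lemma ReducedEigen.projPhiR_eq
    (hu : ReducedEigen (adapted α) (potMatrix α v) M k n s lam u)
    (h : Regular (adapted α) M k) (hα : ∀ m i, ‖α.coeff m i‖ ≤ 1)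
    (hV : Potential (potMatrix α v) w) (hw : w ≤ k * M / 10 ^ 4)
    (he : IsRightEigenvector α v lam e) (hf : IsLeftEigenvector α v lam f) (x : Circ)
    (j : Fin 2) :
    projPhiR e f x j = projEntry (adapted α) (fun m => (basisFun α m x : ℂ)) lam u j := by
  have hlam := add_one_ne_zero_of_mem (hu.near.mem_disc h)
  have he1 := he.reduced hα hlam
  have hf1 := hf.reduced hα hlam
  obtain ⟨a, û, ha, hû, hua⟩ := hu.near.exists_normalized h hV hw he1.summable he1.ne_zero
    he1.eq_zero
  obtain ⟨b, û', hb, hû', hub⟩ := hu.near.exists_normalized h hV hw hf1.summable hf1.ne_zero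
    hf1.eq_zero
  rw [← (hu.unique hû h hV hw).2] at hua
  -- Both eigenvectors are now scalar multiples of the same `u`; the scalars cancel in the quotient
  -- defining the projection.
  rw [← (hu.unique hû' h hV hw).2] at hub
  have hc : ∀ (t : ℂ) i, coupled (adapted α) (fun m => t * u m) i = t * coupled (adapted α) u i :=
    fun t i => by unfold coupled; rw [← tsum_mul_left]; exact tsum_congr fun l => by ring
  have hbil : bilin (fun m => b * u m) (fun m => a * u m) = b * a * bilin u u := by
    unfold bilin; rw [← tsum_mul_left]; exact tsum_congr fun l => by ring
  have hden : denom (adapted α) lam lam (fun m => b * u m) (fun m => a * u m)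
      = b * a * denom (adapted α) lam lam u u := by
    unfold denom; simp only [hbil, hc, Fin.sum_univ_two]; ring
  have hsyn : synth e.phi x = a * ∑' m, (basisFun α m x : ℂ) * u m := by
    have h1 := (synth_eq α he1.summable_phi x).tsum_eq
    rw [← h1, ← tsum_mul_left]
    refine tsum_congr fun m => ?_
    have : toRealBasis α e.phi m = a * u m := congrFun hua m
    rw [this]; ring
  have hD0 : denom (adapted α) lam lam u u ≠ 0 := by
    rw [← norm_pos_iff]
    linarith [hu.freq_le_norm_denom hu h hV hV hw, one_le_freq n]
  unfold projPhiR projEntry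
  rw [pairing_eq hα hlam he1 hf1, hf1.conj_r hα, hub, hua, hden, hsyn, hc]
  field_simp

end

end ThermalRing

theorem mainTheorem2 (κ c₂ : ℝ) (hκ : 0 < κ) (hc₂ : 0 < c₂) (hc₂' : c₂ < 1) :
    ∃ δ ε₀ : ℝ, 0 < δ ∧ 0 < ε₀ ∧
      ∀ (α : Coupling) (c₀ c₁ : ℝ), α.NonDegenerate c₀ c₁ c₂ → κ * c₀ ≤ c₁ → α.supSq ≤ δ →
        ∃ Cφ Clam : ℝ, 0 < Cφ ∧ 0 < Clam ∧
          ∀ (n : ℤ) (s : Fin 2),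
            (∀ v : C(Circ, ℝ), ‖v‖ ≤ ε₀ * α.supSq →
              ∃ lam : ℂ, IsModeEigenvalue α v n s lam ∧ IsSimpleEigenvalue α v lam ∧
                ∀ mu : ℂ, IsModeEigenvalue α v n s mu → mu = lam) ∧
            ∀ v₁ v₂ : C(Circ, ℝ), ‖v₁‖ ≤ ε₀ * α.supSq → ‖v₂‖ ≤ ε₀ * α.supSq →
              ∀ lam₁ lam₂ : ℂ, IsModeEigenvalue α v₁ n s lam₁ → IsModeEigenvalue α v₂ n s lam₂ →
                (∀ e₁ f₁ e₂ f₂ : Vec,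
                  IsRightEigenvector α v₁ lam₁ e₁ → IsLeftEigenvector α v₁ lam₁ f₁ →
                  IsRightEigenvector α v₂ lam₂ e₂ → IsLeftEigenvector α v₂ lam₂ f₂ →
                  ∀ (x : Circ) (j : Fin 2),
                    ‖projPhiR e₂ f₂ x j - projPhiR e₁ f₁ x j‖
                      ≤ Cφ * ‖v₂ - v₁‖ / ((n : ℝ) ^ 2 + 1)) ∧
                ‖lam₂ - lam₁‖ ≤ Clam * ‖v₂ - v₁‖ / (|(n : ℝ)| + 1) ∧
                |(lam₂ - lam₁).re| ≤ Clam * ‖v₂ - v₁‖ / ((n : ℝ) ^ 2 + 1) := by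
  set k : ℝ := min (κ * c₂) 1 with hk
  have hk0 : 0 < k := lt_min (mul_pos hκ hc₂) one_pos
  have hk1 : k ≤ 1 := min_le_right _ _
  have hG := one_le_gapConst
  -- The first choice gives `gapConst`·M ≤ k/10⁴. The second has an extra 1/2 because the matrix
  -- entries of v are bounded by 2‖v‖.
  refine ⟨k / 10 ^ 4 / gapConst, k / (2 * 10 ^ 4), by positivity, by positivity, ?_⟩
  intro α c₀ c₁ hnd hκc hδ
  rw [le_div_iff₀ (by linarith), mul_comm] at hδ
  have h := hnd.regular hκ hκc hk0 hk1 (min_le_left _ _) hδ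
  have hα := hnd.norm_coeff_le (h.M_le'.trans (by norm_num))
  have hC := aprioriConst_nonneg h
  set M := α.supSq with hM
  set C := aprioriConst M k with hCdef
  have hV : ∀ v : C(Circ, ℝ), ‖v‖ ≤ k / (2 * 10 ^ 4) * M →
      Potential (potMatrix α v) (k * M / 10 ^ 4) := fun v hv =>
    (potential_potMatrix α v).mono (by linarith)
  -- Twice the constants of the reduced estimates, since W = 2‖v₂ - v₁‖. The second constant also
  -- leaves room for |n| + 1 ≤ 2ω in the eigenvalue bound.
  refine ⟨600 * C + 200, 120 * C + 20, by positivity, by positivity, fun n s => ⟨?_, ?_⟩⟩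
  · intro v hv
    obtain ⟨lam, h1, h2⟩ := exists_modeEigenvalue h hα (hV v hv) le_rfl n s
    refine ⟨lam, h1, h2, fun mu hmu => ?_⟩
    exact eq_of_near hmu.1.1 h1.1.1 (hmu.near h hα (hV v hv) le_rfl)
      (h1.near h hα (hV v hv) le_rfl) h hα (hV v hv) le_rfl
  · intro v₁ v₂ hv₁ hv₂ lam₁ lam₂ hl₁ hl₂
    have hV₁ := hV v₁ hv₁
    have hV₂ := hV v₂ hv₂
    obtain ⟨u₁, hu₁⟩ := hl₁.1.1.exists_reduced (hl₁.near h hα hV₁ le_rfl) h hα hV₁ le_rfl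
    obtain ⟨u₂, hu₂⟩ := hl₂.1.1.exists_reduced (hl₂.near h hα hV₂ le_rfl) h hα hV₂ le_rfl
    have hD : Potential (fun m l => potMatrix α v₂ m l - potMatrix α v₁ m l) (2 * ‖v₂ - v₁‖) := by
      rw [potMatrix_sub]; exact potential_potMatrix α (v₂ - v₁)
    have hf := one_le_freq n
    rw [← freq_sq]
    refine ⟨fun e₁ f₁ e₂ f₂ he₁ hf₁ he₂ hf₂ x j => ?_, ?_, ?_⟩
    · rw [hu₂.projPhiR_eq h hα hV₂ le_rfl he₂ hf₂, hu₁.projPhiR_eq h hα hV₁ le_rfl he₁ hf₁]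
      refine (hu₂.norm_projEntry_sub_le hu₁ h hV₂ hV₁ le_rfl hD (fun m => ?_) j).trans
        (le_of_eq ?_)
      · rw [Complex.norm_real]; exact abs_basisFun_le_one α m x
      · rw [← hCdef]; ring
    · refine (hu₂.eigenvalue_sub_le hu₁ h hV₂ hV₁ le_rfl hD).trans ?_
      rw [div_le_div_iff₀ (by linarith) (by positivity)]
      have h1 : |(n : ℝ)| + 1 ≤ 2 * freq n := by linarith [abs_le_freq n]
      have h2 := norm_nonneg (v₂ - v₁)
      have h3 := mul_le_mul_of_nonneg_left h1 h2
      have h4 : 0 ≤ C * ‖v₂ - v₁‖ * freq n := by positivity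
      have h5 : 0 ≤ ‖v₂ - v₁‖ * freq n := by positivity
      linarith
    · refine (hu₂.abs_re_sub_le hu₁ h hV₂ hV₁ le_rfl hD).trans (le_of_eq ?_)
      rw [← hCdef]; ring
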